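/- Let $L,H>0$ and let $D=\mathbb T_L\times(0,H)$, $\mathbb T_L=\mathbb R/L\mathbb Z$, be the periodic channel with coordinates $\mathbf x=(x_1,x_2)$ and $\mathbf e_1=(1,0)$. Let $\Lambda_1$ be the smallest eigenvalue of the problem $$-\Delta u=\Lambda u\ \text{ in } D,\qquad u|_{x_2=0}=u|_{x_2=H}=\text{constant},\qquad \int_D u\,d\mathbf x=0,$$ and let $\mathbb E_1$ be the corresponding eigenspace. Let $g\in C^1(\mathbb R)$, $\lambda\in\mathbb R$, $1<p<\infty$, and let $\bar\psi\in C^2(\bar D)$ satisfy $$-\Delta\bar\psi=g(\bar\psi-\lambda x_2)\ \text{ in } D,\qquad \bar\psi \text{ is constant on each of } \{x_2=0\} \text{ and } \{x_2=H\}.$$ Put $\bar\omega:=-\Delta\bar\psi$. If $$0\le\min_{\bar D}g'(\bar\psi-\lambda x_2)\le\max_{\bar D}g'(\bar\psi-\lambda x_2)\le\Lambda_1,$$ then: (i) $\bar\psi=\bar\psi^e+\bar\psi^s$ for some $\bar\psi^e\in\mathbb E_1$ and some function $\bar\psi^s$ that depends only on $x_2$; (ii) the steady or traveling flow with stream function $\bar\psi(x_1-\lambda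 t,x_2)$ is orbitally stable in the following sense: for every $\varepsilon>0$ there is $\delta>0$ such that, for every Euler flow in $D$ with vorticity $\omega(t,\mathbf x)$, if $$\|\omega(0,\cdot)-\bar\omega\|_{L^p(D)}<\delta,$$ then for every $t\in\mathbb R$ there is $\alpha_t\in\mathbb R$ such that $$\|\omega(t,\cdot)-\bar\omega(\cdot+\alpha_t\mathbf e_1)\|_{L^p(D)}<\varepsilon .$$ Here an Euler flow in $D$ is a velocity field $\mathbf v=(v_1,v_2)$ on $\mathbb R\times\bar D$ that is of class $C^2$ in $(t,\mathbf x)$ up to the boundary and satisfies, for some pressure $P(t,\mathbf x)$ on $\bar D$ that is $C^1$ in $\mathbf x$, $\partial_t\mathbf v+(\mathbf v\cdot\nabla)\mathbf v=-\nabla P$ and $\nabla\cdot\mathbf v=0$ in $D$ and $v_2=0$ on $\{x_2=0\}\cup\{x_2=H\}$, for all $t\in\mathbb R$; its vorticity is $\omega=\partial_{x_1}v_2-\partial_{x_2}v_1$. -/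

import Mathlib

noncomputable section

namespace PeriodicChannel

open MeasureTheory Set

/-- Partial derivative in the first variable of a function on the plane. -/
def pd1 (f : ℝ × ℝ → ℝ) (x : ℝ × ℝ) : ℝ := deriv (fun s => f (s, x.2)) x.1

/-- Partial derivative in the second variable of a function on the plane. -/
def pd2 (f : ℝ × ℝ → ℝ) (x : ℝ × ℝ) : ℝ := deriv (fun s => f (x.1, s)) x.2

/-- The Laplacian in the plane. -/
def lap (f : ℝ × ℝ → ℝ) (x : ℝ × ℝ) : ℝ := pd1 (pd1 f) x + pd2 (pd2 f) x

/-- The open strip `ℝ × (0, H)`, the universal cover of the channel `D = 𝕋_L × (0, H)`.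
Functions on the channel are functions on the strip that are `L`-periodic in `x₁`. -/
def strip (H : ℝ) : Set (ℝ × ℝ) := univ ×ˢ Ioo 0 H

/-- The closed strip `ℝ × [0, H]`, the universal cover of the closed channel. -/
def closedStrip (H : ℝ) : Set (ℝ × ℝ) := univ ×ˢ Icc 0 H

/-- Lebesgue measure on the channel: Lebesgue measure on the period cell `(0, L] × (0, H)`. -/
def channelMeasure (L H : ℝ) : Measure (ℝ × ℝ) :=
  (volume : Measure (ℝ × ℝ)).restrict (Ioc 0 L ×ˢ Ioo 0 H)

/-- `f` is `L`-periodic in `x₁` on the closed strip, that is, a function on the closed channel. -/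
def IsPeriodic {E : Type*} (L H : ℝ) (f : ℝ × ℝ → E) : Prop :=
  ∀ x ∈ closedStrip H, f (x.1 + L, x.2) = f x

/-- `f` belongs to `C²` of the closed channel (twice continuously differentiable up to the
boundary). -/
def IsC2 (L H : ℝ) (f : ℝ × ℝ → ℝ) : Prop :=
  IsPeriodic L H f ∧ ContDiffOn ℝ 2 f (closedStrip H)

/-- The solutions `u` of the eigenvalue problem `-Δu = Λu` in the channel, `u` equal to one and
the same constant on both boundary components, with zero integral. -/
def eigenspace (L H Λ : ℝ) : Set (ℝ × ℝ → ℝ) :=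
  {u | IsC2 L H u ∧ (∀ x ∈ strip H, -lap u x = Λ * u x) ∧
    (∃ c : ℝ, ∀ s : ℝ, u (s, 0) = c ∧ u (s, H) = c) ∧
    ∫ x, u x ∂(channelMeasure L H) = 0}

/-- `Λ` is an eigenvalue: it has an eigenfunction that does not vanish identically on the
channel. -/
def IsEigenvalue (L H Λ : ℝ) : Prop :=
  ∃ u ∈ eigenspace L H Λ, ∃ x ∈ closedStrip H, u x ≠ 0

/-- The first (smallest) eigenvalue `Λ₁`. -/
def firstEigenvalue (L H : ℝ) : ℝ := sInf {Λ | IsEigenvalue L H Λ}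

/-- The first eigenspace `𝔼₁`. -/
def firstEigenspace (L H : ℝ) : Set (ℝ × ℝ → ℝ) := eigenspace L H (firstEigenvalue L H)

/-- `ψ ∈ C²` of the closed channel solves `-Δψ = g(ψ - λ x₂)` in the channel and is constant on
each of the two boundary components (with possibly different constants). -/
def SolvesStreamEquation (L H : ℝ) (g : ℝ → ℝ) (lam : ℝ) (ψ : ℝ × ℝ → ℝ) : Prop :=
  IsC2 L H ψ ∧ (∀ x ∈ strip H, -lap ψ x = g (ψ x - lam * x.2)) ∧
    (∃ a : ℝ, ∀ s : ℝ, ψ (s, 0) = a) ∧ (∃ b : ℝ, ∀ s : ℝ, ψ (s, H) = b)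

/-- The scalar vorticity `∂₁ v₂ - ∂₂ v₁` of a planar velocity field. -/
def vorticity (v : ℝ × ℝ → ℝ × ℝ) (x : ℝ × ℝ) : ℝ :=
  pd1 (fun y => (v y).2) x - pd2 (fun y => (v y).1) x

/-- `v` is a (classical, global in time) Euler flow in the periodic channel: the velocity is `C²`
in `(t, x)` up to the boundary, and with some pressure `P`, also a function on the channel, it
solves the incompressible Euler equation with the impermeability condition. -/
structure IsEulerFlow (L H : ℝ) (v : ℝ → ℝ × ℝ → ℝ × ℝ) : Prop where
  periodic : ∀ t, IsPeriodic L H (v t)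
  smooth : ContDiffOn ℝ 2 (fun q : ℝ × (ℝ × ℝ) => v q.1 q.2) (univ ×ˢ closedStrip H)
  momentum : ∃ P : ℝ → ℝ × ℝ → ℝ,
    (∀ t, IsPeriodic L H (P t)) ∧ (∀ t, ContDiffOn ℝ 1 (P t) (closedStrip H)) ∧
    ∀ t, ∀ x ∈ strip H,
      (deriv (fun τ => (v τ x).1) t + (v t x).1 * pd1 (fun y => (v t y).1) x
        + (v t x).2 * pd2 (fun y => (v t y).1) x = -pd1 (P t) x) ∧
      (deriv (fun τ => (v τ x).2) t + (v t x).1 * pd1 (fun y => (v t y).2) x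
        + (v t x).2 * pd2 (fun y => (v t y).2) x = -pd2 (P t) x)
  divFree : ∀ t, ∀ x ∈ strip H,
    pd1 (fun y => (v t y).1) x + pd2 (fun y => (v t y).2) x = 0
  impermeable : ∀ t s, (v t (s, 0)).2 = 0 ∧ (v t (s, H)).2 = 0

end PeriodicChannel

end

open PeriodicChannel

noncomputable section

namespace PeriodicChannel

open MeasureTheory Set Filter Topology
open scoped Pointwise

set_option linter.unusedSectionVars false


/-! The least eigenvalue is the minimum of `waveEigenvalue`, (2π/L)² + (π/H)², attained by
sin(πx₂/H) times a first harmonic in x₁, and `shearEigenvalue`, (2π/H)², attained by first harmonics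
in x₂. Everything rests on Poincaré inequalities with these constants and with a gap: the surplus
controls the distance to the extremal modes (`wave_gap`, `channel_gap`).

For (i), let u be ψ minus its average along x₁. It vanishes on the walls and is orthogonal to
functions of x₂ alone, so testing the equation with u and comparing g(φ), φ = ψ - λx₂, with g at the
x₁-average of φ gives ∫|∇u|² ≤ Λ₁∫u². By `wave_gap`, u is either zero or a wave mode
(`stream_decomposition`).

For (ii), write the flow as the steady one plus a constant uniform flow plus a perturbation with
stream function χ vanishing on both walls. Conserved are the energy, every integral of a continuous
function of ω, the momentum ∫x₂ω and the mean horizontal velocity. Since ω̄ = g(φ) with slopes of g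
in [0, Λ₁], a convex conjugate F of a primitive of g satisfies F(s) ≥ F(ω̄) + φ(s - ω̄) + (s -
ω̄)²/(2Λ₁). Combined with the energy and a completed square, this bounds ∫(h - Λ₁(χ - mean))²/(2Λ₁)
+ (∫|∇χ|² - Λ₁∫(χ - mean)²)/2 by the size of the initial perturbation, where h is the vorticity
perturbation (`exists_pseudoenergy_bound`). Both terms are nonnegative, and the gap then puts h
close to a combination of the wave modes with amplitudes (A, B) and of cos(2πx₂/H), sin(2πx₂/H) with
amplitudes C, D.

These four directions are degenerate for the energy, and other invariants settle them. The momentum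
controls D. The second and third moments of ω are conserved; eliminating the squared wave amplitude
between them leaves a cubic polynomial in C, with nonzero leading coefficient, whose value must stay
small. As C is continuous in time and starts near 0, it cannot cross to another root
(`exists_trapping`). With C small, the second moment says that the wave amplitude vectors of ω and
ω̄ have nearly equal lengths, so one is nearly a rotation of the other. A rotation of the amplitudes
is a translation in x₁, which is the orbit (`exists_orbital_estimate`).

For every p > 1 the vorticity is truncated at a bound M of |ω̄|. The tail ω - clip ω stays small in
L^p because its norm is conserved, and it enters the energy only through a pairing with χ, bounded
by the two-dimensional Sobolev inequality (`sobolev_dual`). The truncated part is bounded, so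
smallness in L² implies smallness in L^p. -/

/-! ### Wirtinger inequalities with a spectral gap. -/

theorem normSq_fourierCoeffOn_ofReal {T : ℝ} (hT : 0 < T) {f : ℝ → ℝ} (hf : Continuous f) (n : ℤ) :
    ‖fourierCoeffOn hT (fun x => (f x : ℂ)) n‖ ^ 2 =
      (1 / T ^ 2) * ((∫ x in (0 : ℝ)..T, f x * Real.cos (2 * Real.pi / T * n * x)) ^ 2 +
        (∫ x in (0 : ℝ)..T, f x * Real.sin (2 * Real.pi / T * n * x)) ^ 2) := by
  have key : fourierCoeffOn hT (fun x => (f x : ℂ)) n = ((1 / T : ℝ) : ℂ) *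
      (((∫ x in (0 : ℝ)..T, f x * Real.cos (2 * Real.pi / T * n * x) : ℝ) : ℂ) -
       ((∫ x in (0 : ℝ)..T, f x * Real.sin (2 * Real.pi / T * n * x) : ℝ) : ℂ) * Complex.I) := by
    rw [fourierCoeffOn_eq_integral]
    simp only [sub_zero]
    rw [Complex.real_smul]
    congr 1
    rw [← intervalIntegral.integral_ofReal, ← intervalIntegral.integral_ofReal,
      ← intervalIntegral.integral_mul_const, ← intervalIntegral.integral_sub]
    · refine intervalIntegral.integral_congr fun x _ => ?_
      simp only [smul_eq_mul, fourier_coe_apply]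
      have : (2 * Real.pi * Complex.I * ((-n : ℤ) : ℂ) * (x : ℂ) / ((T - 0 : ℝ) : ℂ)) =
          ((-(2 * Real.pi / T * n * x) : ℝ) : ℂ) * Complex.I := by
        rw [sub_zero]; push_cast; ring
      rw [this, Complex.exp_mul_I, ← Complex.ofReal_cos, ← Complex.ofReal_sin, Real.cos_neg,
        Real.sin_neg]
      push_cast; ring
    · exact (Continuous.intervalIntegrable (by fun_prop) _ _)
    · exact (Continuous.intervalIntegrable (by fun_prop) _ _)
  rw [key, norm_mul, mul_pow, Complex.norm_real, ← Complex.normSq_eq_norm_sq, Complex.normSq_apply]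
  simp only [Complex.sub_re, Complex.sub_im, Complex.ofReal_re, Complex.ofReal_im, Complex.mul_re,
    Complex.mul_im, Complex.I_re, Complex.I_im, Real.norm_eq_abs, sq_abs]
  ring

/-- Parseval: modes with |n| ≥ 2 satisfy the inequality with constant 4κ², κ = 2π/T, the zero mode
is absent, and the modes ±1 fall short by 3κ² each, which the last term restores. Only right
derivatives are required, so that reflected functions with a corner in their formula qualify. -/
theorem wirtinger_periodic_gap {T : ℝ} (hT : 0 < T) {f f' : ℝ → ℝ} (hf : Continuous f)
    (hf' : Continuous f') (hd : ∀ x ∈ Ioo 0 T, HasDerivWithinAt f (f' x) (Ioi x) x)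
    (h0 : f 0 = f T) (hmean : ∫ x in (0 : ℝ)..T, f x = 0) :
    4 * (2 * Real.pi / T) ^ 2 * ∫ x in (0 : ℝ)..T, f x ^ 2 ≤ (∫ x in (0 : ℝ)..T, f' x ^ 2) +
      6 * (2 * Real.pi / T) ^ 2 / T *
        ((∫ x in (0 : ℝ)..T, f x * Real.cos (2 * Real.pi / T * x)) ^ 2 +
          (∫ x in (0 : ℝ)..T, f x * Real.sin (2 * Real.pi / T * x)) ^ 2) := by
  set κ := 2 * Real.pi / T with hκ
  have hκ0 : 0 < κ := by positivity
  set c := fourierCoeffOn hT (fun x => (f x : ℂ)) with hc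
  set d := fourierCoeffOn hT (fun x => (f' x : ℂ)) with hd'
  have mem : ∀ g : ℝ → ℝ, Continuous g →
      MemLp (fun x => (g x : ℂ)) 2 (volume.restrict (Ioc 0 T)) := fun g hg => by
    obtain ⟨C, hC⟩ := (isCompact_Icc (a := (0:ℝ)) (b := T)).exists_bound_of_continuousOn
      (f := fun x => (g x : ℂ)) (by fun_prop)
    refine MemLp.of_bound (Continuous.aestronglyMeasurable (by fun_prop)) C ?_
    exact (ae_restrict_iff' measurableSet_Ioc).2 (ae_of_all _ fun x hx => hC x (Ioc_subset_Icc_self hx))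
  have s1 := hasSum_sq_fourierCoeffOn hT (mem f hf)
  have s2 := hasSum_sq_fourierCoeffOn hT (mem f' hf')
  simp only [Complex.norm_real, Real.norm_eq_abs, sq_abs, sub_zero, smul_eq_mul] at s1 s2
  rw [← hc] at s1
  rw [← hd'] at s2
  have rel : ∀ n : ℤ, n ≠ 0 → ‖d n‖ ^ 2 = κ ^ 2 * n ^ 2 * ‖c n‖ ^ 2 := fun n hn => by
    have := fourierCoeffOn_of_hasDeriv_right hT (f := fun x => (f x : ℂ)) (f' := fun x => (f' x : ℂ))
      hn (by fun_prop) (fun x hx => by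
        rw [min_eq_left hT.le, max_eq_right hT.le] at hx
        exact (hd x hx).ofReal_comp) (Continuous.intervalIntegrable (by fun_prop) _ _)
    rw [← hc, ← hd', h0] at this
    have h2 : ‖c n‖ = 1 / (2 * Real.pi * |(n : ℝ)|) * (T * ‖d n‖) := by
      rw [this]
      simp [abs_of_pos Real.pi_pos, abs_of_pos hT]
    have hn' : (0:ℝ) < |(n : ℝ)| := by positivity
    rw [h2, ← sq_abs (n : ℝ), hκ]
    field_simp
  have c0 : c 0 = 0 := by
    have h3 : ‖c 0‖ ^ 2 = 0 := by
      rw [hc, normSq_fourierCoeffOn_ofReal hT hf 0]; simp [hmean]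
    simpa using h3
  -- The deficits of the modes ±1 are added to the Parseval series of f', so that the comparison
  -- becomes termwise.
  have s3 : HasSum (fun n : ℤ => ‖d n‖ ^ 2 + ((if n = 1 then 3 * κ ^ 2 * ‖c 1‖ ^ 2 else 0) +
      (if n = -1 then 3 * κ ^ 2 * ‖c (-1)‖ ^ 2 else 0)))
      (T⁻¹ * (∫ x in (0 : ℝ)..T, f' x ^ 2) + (3 * κ ^ 2 * ‖c 1‖ ^ 2 + 3 * κ ^ 2 * ‖c (-1)‖ ^ 2)) :=
    s2.add ((hasSum_ite_eq 1 _).add (hasSum_ite_eq (-1) _))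
  have s4 := s1.mul_left (4 * κ ^ 2)
  have hle := hasSum_le (fun n => ?_) s4 s3
  · rw [hc, normSq_fourierCoeffOn_ofReal hT hf 1, normSq_fourierCoeffOn_ofReal hT hf (-1), ← hκ] at hle
    simp only [Int.cast_one, mul_one, Int.cast_neg, mul_neg, neg_mul, Real.cos_neg, Real.sin_neg,
      intervalIntegral.integral_neg, neg_sq] at hle
    have := mul_le_mul_of_nonneg_left hle hT.le
    refine le_of_eq_of_le ?_ (this.trans_eq ?_)
    · rw [mul_left_comm, ← mul_assoc T, mul_inv_cancel₀ hT.ne', one_mul]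
    · rw [mul_add, ← mul_assoc T, mul_inv_cancel₀ hT.ne', one_mul]
      field_simp; ring
  · by_cases h00 : n = 0
    · subst h00; simp [c0]
    · rw [rel n h00]
      by_cases h1 : n = 1
      · subst h1; simp; nlinarith [sq_nonneg ‖c 1‖]
      by_cases h2 : n = -1
      · subst h2; simp; nlinarith [sq_nonneg ‖c 1‖]
      simp only [h1, h2, if_false, add_zero]
      have h4 : (4:ℝ) ≤ (n:ℝ) ^ 2 := by
        have : (4:ℤ) ≤ n ^ 2 := by
          have : n ≤ -2 ∨ 2 ≤ n := by omega
          rcases this with h | h <;> nlinarith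
        exact_mod_cast this
      have : 0 ≤ κ ^ 2 * ‖c n‖ ^ 2 := by positivity
      nlinarith

/-- The odd reflection across H is 2H-periodic with zero mean. It has no cosine coefficient and
twice the sine coefficient, so the periodic inequality on [0, 2H] reduces to this one. -/
theorem wirtinger_dirichlet_gap {H : ℝ} (hH : 0 < H) {f f' : ℝ → ℝ} (hf : Continuous f)
    (hf' : Continuous f') (hd : ∀ x ∈ Icc 0 H, HasDerivWithinAt f (f' x) (Icc 0 H) x)
    (h0 : f 0 = 0) (hH0 : f H = 0) :
    4 * (Real.pi / H) ^ 2 * ∫ x in (0 : ℝ)..H, f x ^ 2 ≤ (∫ x in (0 : ℝ)..H, f' x ^ 2) +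
      6 * (Real.pi / H) ^ 2 / H * (∫ x in (0 : ℝ)..H, f x * Real.sin (Real.pi / H * x)) ^ 2 := by
  set F : ℝ → ℝ := fun y => if y ≤ H then f y else -f (2 * H - y) with hF
  set F' : ℝ → ℝ := fun y => if y ≤ H then f' y else f' (2 * H - y) with hF'
  have cF : Continuous F := Continuous.if_le hf (by fun_prop) continuous_id continuous_const
    (fun x hx => by change x = H at hx; subst hx; rw [two_mul, add_sub_cancel_left, hH0, neg_zero])
  have cF' : Continuous F' := Continuous.if_le hf' (by fun_prop) continuous_id continuous_const
    (fun x hx => by change x = H at hx; subst hx; rw [two_mul, add_sub_cancel_left])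
  have fold : ∀ G g : ℝ → ℝ, ∀ σ : ℝ, Continuous G → (∀ y ∈ Icc 0 H, G y = g y) →
      (∀ y ∈ Icc 0 H, G (2 * H - y) = σ * g y) →
      ∫ y in (0 : ℝ)..(2 * H), G y = (1 + σ) * ∫ y in (0 : ℝ)..H, g y := by
    intro G g σ hG h1 h2
    rw [← intervalIntegral.integral_add_adjacent_intervals (hG.intervalIntegrable 0 H)
      (hG.intervalIntegrable H (2 * H))]
    have e1 : ∫ y in (0 : ℝ)..H, G y = ∫ y in (0 : ℝ)..H, g y :=
      intervalIntegral.integral_congr fun y hy => h1 y (by rwa [uIcc_of_le hH.le] at hy)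
    have e2 : ∫ y in H..(2 * H), G y = σ * ∫ y in (0 : ℝ)..H, g y := by
      have := intervalIntegral.integral_comp_sub_left (a := 0) (b := H) G (2 * H)
      rw [sub_zero, two_mul, add_sub_cancel_left, ← two_mul] at this
      rw [← this, ← intervalIntegral.integral_const_mul]
      exact intervalIntegral.integral_congr fun y hy => h2 y (by rwa [uIcc_of_le hH.le] at hy)
    rw [e1, e2]; ring
  have v1 : ∀ y ∈ Icc 0 H, F y = f y := fun y hy => by simp [hF, hy.2]
  have v2 : ∀ y ∈ Icc 0 H, F (2 * H - y) = -f y := fun y hy => by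
    by_cases h : 2 * H - y ≤ H
    · have : y = H := le_antisymm hy.2 (by linarith)
      subst this
      simp only [hF, h, if_true]; rw [two_mul, add_sub_cancel_left, hH0, neg_zero]
    · simp only [hF, h, if_false]; rw [sub_sub_cancel]
  have w1 : ∀ y ∈ Icc 0 H, F' y = f' y := fun y hy => by simp [hF', hy.2]
  have w2 : ∀ y ∈ Icc 0 H, F' (2 * H - y) = f' y := fun y hy => by
    by_cases h : 2 * H - y ≤ H
    · have : y = H := le_antisymm hy.2 (by linarith)
      subst this
      simp only [hF', h, if_true]; rw [two_mul, add_sub_cancel_left]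
    · simp only [hF', h, if_false]; rw [sub_sub_cancel]
  have hpi : 2 * Real.pi / (2 * H) = Real.pi / H := by field_simp
  have hang : ∀ y, Real.pi / H * (2 * H - y) = 2 * Real.pi - Real.pi / H * y := fun y => by
    field_simp
  have main := wirtinger_periodic_gap (T := 2 * H) (by positivity) cF cF' ?_ ?_ ?_
  · rw [fold (fun y => F y ^ 2) (fun y => f y ^ 2) 1 (by fun_prop) (fun y hy => by simp [v1 y hy])
        (fun y hy => by simp [v2 y hy]),
      fold (fun y => F' y ^ 2) (fun y => f' y ^ 2) 1 (by fun_prop) (fun y hy => by simp [w1 y hy])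
        (fun y hy => by simp [w2 y hy]), hpi,
      fold (fun y => F y * Real.cos (Real.pi / H * y)) (fun y => f y * Real.cos (Real.pi / H * y))
        (-1) (by fun_prop) (fun y hy => by simp [v1 y hy])
        (fun y hy => by simp [v2 y hy, hang, Real.cos_two_pi_sub]),
      fold (fun y => F y * Real.sin (Real.pi / H * y)) (fun y => f y * Real.sin (Real.pi / H * y))
        1 (by fun_prop) (fun y hy => by simp [v1 y hy])
        (fun y hy => by simp [v2 y hy, hang, Real.sin_two_pi_sub])] at main
    have e : 6 * (Real.pi / H) ^ 2 / (2 * H) * (((1 + -1) * ∫ y in (0 : ℝ)..H, f y * Real.cos (Real.pi / H * y)) ^ 2 +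
        ((1 + 1) * ∫ y in (0 : ℝ)..H, f y * Real.sin (Real.pi / H * y)) ^ 2) =
        2 * (6 * (Real.pi / H) ^ 2 / H * (∫ x in (0 : ℝ)..H, f x * Real.sin (Real.pi / H * x)) ^ 2) := by
      field_simp; ring
    rw [e] at main
    linarith
  · intro x hx
    rcases lt_or_ge x H with h | h
    · have hx' : x ∈ Icc 0 H := ⟨hx.1.le, h.le⟩
      have : HasDerivAt f (f' x) x := (hd x hx').hasDerivAt (Icc_mem_nhds hx.1 h)
      rw [w1 x hx']
      refine (this.congr_of_eventuallyEq ?_).hasDerivWithinAt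
      filter_upwards [Iio_mem_nhds h] with z hz
      simp [hF, (show z ≤ H from le_of_lt hz)]
    · have hx' : 2 * H - x ∈ Icc 0 H := ⟨by linarith [hx.2], by linarith⟩
      have hder : HasDerivWithinAt (fun y => -f (2 * H - y)) (f' (2 * H - x)) (Icc H (2 * H)) x := by
        have h1 : HasDerivWithinAt (fun y : ℝ => 2 * H - y) (-1) (Icc H (2 * H)) x :=
          ((hasDerivAt_id x).const_sub _).hasDerivWithinAt
        have := ((hd _ hx').scomp x h1 (fun z hz => ⟨by linarith [hz.2], by linarith [hz.1]⟩)).neg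
        rw [neg_smul, one_smul, neg_neg] at this
        exact this
      have h5 : F' x = f' (2 * H - x) := by
        have := w2 _ hx'; rwa [sub_sub_cancel] at this
      rw [h5]
      have h6 : HasDerivWithinAt F (f' (2 * H - x)) (Icc H (2 * H)) x :=
        hder.congr (fun z hz => by
          have := v2 (2 * H - z) ⟨by linarith [hz.2], by linarith [hz.1]⟩
          rwa [sub_sub_cancel] at this)
          (by have := v2 _ hx'; rwa [sub_sub_cancel] at this)
      refine (h6.mono_of_mem_nhdsWithin ?_)
      exact mem_of_superset (Ioo_mem_nhdsGT hx.2) (fun z hz => ⟨h.trans hz.1.le, hz.2.le⟩)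
  · rw [v1 0 ⟨le_rfl, hH.le⟩, h0]
    have := v2 0 ⟨le_rfl, hH.le⟩
    rw [sub_zero, h0] at this; rw [this]; simp
  · rw [fold F f (-1) cF v1 (fun y hy => by simp [v2 y hy])]; simp

/-! ### Calculus on the closed strip. -/

/-- Projection of the plane onto the closed strip. -/
def clamp (H : ℝ) (x : ℝ × ℝ) : ℝ × ℝ := (x.1, max 0 (min H x.2))

theorem continuous_clamp (H : ℝ) : Continuous (clamp H) := by unfold clamp; fun_prop

theorem clamp_mem {H : ℝ} (hH : 0 < H) (x : ℝ × ℝ) : clamp H x ∈ closedStrip H :=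
  ⟨mem_univ _, le_max_left _ _, max_le hH.le (min_le_left _ _)⟩

theorem clamp_of_mem {H : ℝ} {x : ℝ × ℝ} (hx : x ∈ closedStrip H) : clamp H x = x := by
  have h := hx.2
  ext
  · rfl
  · simp only [clamp]; rw [min_eq_right h.2, max_eq_right h.1]

theorem strip_subset (H : ℝ) : strip H ⊆ closedStrip H := prod_mono le_rfl Ioo_subset_Icc_self

theorem isOpen_strip (H : ℝ) : IsOpen (strip H) := isOpen_univ.prod isOpen_Ioo

theorem closedStrip_mem_nhds {H : ℝ} {x : ℝ × ℝ} (hx : x ∈ strip H) : closedStrip H ∈ 𝓝 x :=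
  mem_of_superset ((isOpen_strip H).mem_nhds hx) (strip_subset H)

theorem uniqueDiffOn_closedStrip {H : ℝ} (hH : 0 < H) : UniqueDiffOn ℝ (closedStrip H) :=
  uniqueDiffOn_univ.prod (uniqueDiffOn_Icc hH)

theorem continuous_comp_clamp {E : Type*} [TopologicalSpace E] {H : ℝ} (hH : 0 < H)
    {f : ℝ × ℝ → E} (hf : ContinuousOn f (closedStrip H)) : Continuous (fun x => f (clamp H x)) :=
  hf.comp_continuous (continuous_clamp H) (clamp_mem hH)

/-- `f` is a continuously differentiable function on the closed channel with partial derivatives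
`f₁` and `f₂`; all three are continuous and periodic in the whole plane. -/
structure HasGrad (L H : ℝ) (f f₁ f₂ : ℝ × ℝ → ℝ) : Prop where
  cont : Continuous f
  cont1 : Continuous f₁
  cont2 : Continuous f₂
  per : ∀ x y, f (x + L, y) = f (x, y)
  hasFDeriv : ∀ x ∈ closedStrip H, HasFDerivWithinAt f
    (f₁ x • ContinuousLinearMap.fst ℝ ℝ ℝ + f₂ x • ContinuousLinearMap.snd ℝ ℝ ℝ) (closedStrip H) x

namespace HasGrad
variable {L H : ℝ} {f f₁ f₂ g g₁ g₂ : ℝ × ℝ → ℝ}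

theorem hasFDerivAt (h : HasGrad L H f f₁ f₂) {x : ℝ × ℝ} (hx : x ∈ strip H) :
    HasFDerivAt f (f₁ x • ContinuousLinearMap.fst ℝ ℝ ℝ + f₂ x • ContinuousLinearMap.snd ℝ ℝ ℝ) x :=
  (h.hasFDeriv x (strip_subset H hx)).hasFDerivAt (closedStrip_mem_nhds hx)

theorem hasDerivAt_fst (h : HasGrad L H f f₁ f₂) {x y : ℝ} (hy : y ∈ Icc 0 H) :
    HasDerivAt (fun s => f (s, y)) (f₁ (x, y)) x := by
  have h1 : HasDerivWithinAt (fun s : ℝ => (s, y)) ((1 : ℝ), (0 : ℝ)) univ x :=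
    ((hasDerivAt_id x).prodMk (hasDerivAt_const x y)).hasDerivWithinAt
  have := (h.hasFDeriv (x, y) ⟨mem_univ _, hy⟩).comp_hasDerivWithinAt x h1
    (fun s _ => show (s, y) ∈ closedStrip H from ⟨mem_univ _, hy⟩)
  simpa [Function.comp_def] using this

theorem hasDerivWithinAt_snd (h : HasGrad L H f f₁ f₂) {x y : ℝ} (hy : y ∈ Icc 0 H) :
    HasDerivWithinAt (fun s => f (x, s)) (f₂ (x, y)) (Icc 0 H) y := by
  have h1 : HasDerivWithinAt (fun s : ℝ => (x, s)) ((0 : ℝ), (1 : ℝ)) (Icc 0 H) y :=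
    ((hasDerivAt_const y x).prodMk (hasDerivAt_id y)).hasDerivWithinAt
  have := (h.hasFDeriv (x, y) ⟨mem_univ _, hy⟩).comp_hasDerivWithinAt y h1
    (fun s hs => show (x, s) ∈ closedStrip H from ⟨mem_univ _, hs⟩)
  simpa [Function.comp_def] using this

theorem pd1_eq (h : HasGrad L H f f₁ f₂) {x : ℝ × ℝ} (hx : x ∈ closedStrip H) : pd1 f x = f₁ x :=
  (h.hasDerivAt_fst (x := x.1) hx.2).deriv

theorem pd2_eq (h : HasGrad L H f f₁ f₂) {x : ℝ × ℝ} (hx : x ∈ strip H) : pd2 f x = f₂ x :=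
  ((h.hasDerivWithinAt_snd (x := x.1) (strip_subset H hx).2).hasDerivAt
    (Icc_mem_nhds hx.2.1 hx.2.2)).deriv

theorem mul (hf : HasGrad L H f f₁ f₂) (hg : HasGrad L H g g₁ g₂) :
    HasGrad L H (fun x => f x * g x) (fun x => f₁ x * g x + f x * g₁ x)
      (fun x => f₂ x * g x + f x * g₂ x) where
  cont := hf.cont.mul hg.cont
  cont1 := (hf.cont1.mul hg.cont).add (hf.cont.mul hg.cont1)
  cont2 := (hf.cont2.mul hg.cont).add (hf.cont.mul hg.cont2)
  per x y := by rw [hf.per, hg.per]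
  hasFDeriv x hx := by
    refine ((hf.hasFDeriv x hx).mul (hg.hasFDeriv x hx)).congr_fderiv ?_
    ext <;> simp <;> ring

theorem add (hf : HasGrad L H f f₁ f₂) (hg : HasGrad L H g g₁ g₂) :
    HasGrad L H (fun x => f x + g x) (fun x => f₁ x + g₁ x) (fun x => f₂ x + g₂ x) where
  cont := hf.cont.add hg.cont
  cont1 := hf.cont1.add hg.cont1
  cont2 := hf.cont2.add hg.cont2
  per x y := by rw [hf.per, hg.per]
  hasFDeriv x hx := by
    refine ((hf.hasFDeriv x hx).add (hg.hasFDeriv x hx)).congr_fderiv ?_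
    ext <;> simp

theorem const (L H c : ℝ) : HasGrad L H (fun _ => c) (fun _ => 0) (fun _ => 0) where
  cont := continuous_const
  cont1 := continuous_const
  cont2 := continuous_const
  per _ _ := rfl
  hasFDeriv x _ := by
    simpa using hasFDerivWithinAt_const c x (closedStrip H)

theorem const_mul (hf : HasGrad L H f f₁ f₂) (c : ℝ) :
    HasGrad L H (fun x => c * f x) (fun x => c * f₁ x) (fun x => c * f₂ x) := by
  simpa using (const L H c).mul hf

theorem neg (hf : HasGrad L H f f₁ f₂) :
    HasGrad L H (fun x => - f x) (fun x => - f₁ x) (fun x => - f₂ x) := by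
  simpa using hf.const_mul (-1)

theorem sub (hf : HasGrad L H f f₁ f₂) (hg : HasGrad L H g g₁ g₂) :
    HasGrad L H (fun x => f x - g x) (fun x => f₁ x - g₁ x) (fun x => f₂ x - g₂ x) := by
  simpa [sub_eq_add_neg] using hf.add hg.neg

theorem comp (hf : HasGrad L H f f₁ f₂) {Φ Φ' : ℝ → ℝ} (hΦ : ∀ s, HasDerivAt Φ (Φ' s) s)
    (hΦ' : Continuous Φ') :
    HasGrad L H (fun x => Φ (f x)) (fun x => Φ' (f x) * f₁ x) (fun x => Φ' (f x) * f₂ x) where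
  cont := (continuous_iff_continuousAt.2 fun s => (hΦ s).continuousAt).comp hf.cont
  cont1 := (hΦ'.comp hf.cont).mul hf.cont1
  cont2 := (hΦ'.comp hf.cont).mul hf.cont2
  per x y := by rw [hf.per]
  hasFDeriv x hx := by
    refine ((hΦ (f x)).comp_hasFDerivWithinAt x (hf.hasFDeriv x hx)).congr_fderiv ?_
    ext <;> simp

theorem of_snd {a a' : ℝ → ℝ} (hc : Continuous a) (hc' : Continuous a')
    (ha : ∀ y ∈ Icc 0 H, HasDerivWithinAt a (a' y) (Icc 0 H) y) :
    HasGrad L H (fun x => a x.2) (fun _ => 0) (fun x => a' x.2) where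
  cont := hc.comp continuous_snd
  cont1 := continuous_const
  cont2 := hc'.comp continuous_snd
  per _ _ := rfl
  hasFDeriv x hx := by
    have := (ha x.2 hx.2).hasFDerivWithinAt.comp x
      (hasFDerivWithinAt_snd (𝕜 := ℝ) (E := ℝ) (F := ℝ) (s := closedStrip H)) (fun z hz => hz.2)
    refine this.congr_fderiv ?_
    ext <;> simp

theorem of_fst {a a' : ℝ → ℝ} (hc' : Continuous a') (ha : ∀ x, HasDerivAt a (a' x) x)
    (hp : ∀ x, a (x + L) = a x) :
    HasGrad L H (fun x => a x.1) (fun x => a' x.1) (fun _ => 0) where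
  cont := (continuous_iff_continuousAt.2 fun s => (ha s).continuousAt).comp continuous_fst
  cont1 := hc'.comp continuous_fst
  cont2 := continuous_const
  per x _ := hp x
  hasFDeriv x _ := by
    have := (ha x.1).comp_hasFDerivWithinAt x
      (hasFDerivWithinAt_fst (𝕜 := ℝ) (E := ℝ) (F := ℝ) (s := closedStrip H))
    refine this.congr_fderiv ?_
    ext <;> simp

theorem congr_grad (hf : HasGrad L H f f₁ f₂) (h1 : f₁ = g₁) (h2 : f₂ = g₂) :
    HasGrad L H f g₁ g₂ := h1 ▸ h2 ▸ hf

end HasGrad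

/-! ### Integration over the channel and the divergence theorem. -/

instance (L H : ℝ) : IsFiniteMeasure (channelMeasure L H) := by
  refine ⟨?_⟩
  rw [channelMeasure, Measure.restrict_apply_univ]
  exact (((isCompact_Icc (a := (0:ℝ)) (b := L)).prod (isCompact_Icc (a := (0:ℝ)) (b := H))).measure_lt_top).trans_le'
    (measure_mono (prod_mono Ioc_subset_Icc_self Ioo_subset_Icc_self))

theorem ae_channelMeasure {L H : ℝ} {P : ℝ × ℝ → Prop}
    (h : ∀ x ∈ strip H, P x) : ∀ᵐ x ∂(channelMeasure L H), P x := by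
  rw [channelMeasure, ae_restrict_iff' (measurableSet_Ioc.prod measurableSet_Ioo)]
  exact ae_of_all _ fun x hx => h x ⟨mem_univ _, hx.2⟩

theorem integrable_channel (L H : ℝ) {f : ℝ × ℝ → ℝ} (hf : Continuous f) :
    Integrable f (channelMeasure L H) := by
  have : IntegrableOn f (Icc 0 L ×ˢ Icc 0 H) :=
    hf.continuousOn.integrableOn_compact (isCompact_Icc.prod isCompact_Icc)
  exact this.mono_set (prod_mono Ioc_subset_Icc_self Ioo_subset_Icc_self)

theorem integral_channel {L H : ℝ} (hL : 0 < L) (hH : 0 < H) {f : ℝ × ℝ → ℝ} (hf : Continuous f) :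
    ∫ x, f x ∂(channelMeasure L H) = ∫ x in (0 : ℝ)..L, ∫ y in (0 : ℝ)..H, f (x, y) := by
  have hi := integrable_channel L H hf
  rw [channelMeasure, Measure.volume_eq_prod, ← Measure.prod_restrict] at *
  rw [integral_prod _ hi, intervalIntegral.integral_of_le hL.le]
  refine integral_congr_ae (ae_of_all _ fun x => ?_)
  simp only
  rw [intervalIntegral.integral_of_le hH.le, integral_Ioc_eq_integral_Ioo]

theorem integral_channel_swap {L H : ℝ} (hL : 0 < L) (hH : 0 < H) {f : ℝ × ℝ → ℝ}
    (hf : Continuous f) :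
    ∫ x, f x ∂(channelMeasure L H) = ∫ y in (0 : ℝ)..H, ∫ x in (0 : ℝ)..L, f (x, y) := by
  have hi := integrable_channel L H hf
  rw [channelMeasure, Measure.volume_eq_prod, ← Measure.prod_restrict] at *
  rw [integral_prod_symm _ hi, intervalIntegral.integral_of_le hH.le, integral_Ioc_eq_integral_Ioo]
  refine integral_congr_ae (ae_of_all _ fun x => ?_)
  simp only
  rw [intervalIntegral.integral_of_le hL.le]

theorem continuous_integral_snd {f : ℝ × ℝ → ℝ} (hf : Continuous f) (a b : ℝ) :
    Continuous (fun x => ∫ y in a..b, f (x, y)) :=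
  intervalIntegral.continuous_parametric_intervalIntegral_of_continuous' (by fun_prop) _ _

theorem continuous_integral_fst {f : ℝ × ℝ → ℝ} (hf : Continuous f) (a b : ℝ) :
    Continuous (fun y => ∫ x in a..b, f (x, y)) :=
  intervalIntegral.continuous_parametric_intervalIntegral_of_continuous' (by fun_prop) _ _

/-- The fluxes through the two ends of the period cell cancel by periodicity; only the walls
contribute. -/
theorem integral_divergence {L H : ℝ} (hL : 0 < L) (hH : 0 < H) {a a₁ a₂ b b₁ b₂ : ℝ × ℝ → ℝ}
    (ha : HasGrad L H a a₁ a₂) (hb : HasGrad L H b b₁ b₂) :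
    ∫ x, (a₁ x + b₂ x) ∂(channelMeasure L H) =
      (∫ x in (0 : ℝ)..L, b (x, H)) - ∫ x in (0 : ℝ)..L, b (x, 0) := by
  rw [integral_channel hL hH (f := fun x => a₁ x + b₂ x) (ha.cont1.add hb.cont2)]
  have key := integral2_divergence_prod_of_hasFDerivAt_off_countable a b
    (fun x => a₁ x • ContinuousLinearMap.fst ℝ ℝ ℝ + a₂ x • ContinuousLinearMap.snd ℝ ℝ ℝ)
    (fun x => b₁ x • ContinuousLinearMap.fst ℝ ℝ ℝ + b₂ x • ContinuousLinearMap.snd ℝ ℝ ℝ)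
    0 0 L H ∅ countable_empty ha.cont.continuousOn hb.cont.continuousOn
    (fun x hx => ha.hasFDerivAt ⟨mem_univ _, by
      have := hx.1.2; rwa [min_eq_left hH.le, max_eq_right hH.le] at this⟩)
    (fun x hx => hb.hasFDerivAt ⟨mem_univ _, by
      have := hx.1.2; rwa [min_eq_left hH.le, max_eq_right hH.le] at this⟩)
    (by
      have h : Continuous (fun x => a₁ x + b₂ x) := ha.cont1.add hb.cont2
      simpa using h.continuousOn.integrableOn_compact (isCompact_uIcc.prod isCompact_uIcc))
  simp only [add_apply, smul_apply,
    ContinuousLinearMap.coe_fst', ContinuousLinearMap.coe_snd', smul_eq_mul, mul_one, mul_zero,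
    add_zero, zero_add] at key
  rw [key]
  have : ∀ y, a (L, y) = a (0, y) := fun y => by simpa using ha.per 0 y
  simp [this]

/-! ### Functions of class C² up to the boundary, and Green's identity. -/

/-- The partial derivative in the direction `e`, one-sided at the boundary of the strip. -/
noncomputable def stripDeriv (H : ℝ) (e : ℝ × ℝ) (f : ℝ × ℝ → ℝ) (x : ℝ × ℝ) : ℝ :=
  fderivWithin ℝ f (closedStrip H) x e

theorem IsPeriodic.stripDeriv {L H : ℝ} {f : ℝ × ℝ → ℝ} (hf : IsPeriodic L H f) (e : ℝ × ℝ) :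
    IsPeriodic L H (stripDeriv H e f) := by
  intro x hx
  have hset : (L, (0 : ℝ)) +ᵥ closedStrip H = closedStrip H := by
    ext z
    rw [mem_vadd_set_iff_neg_vadd_mem]
    simp [closedStrip]
  have h1 := fderivWithin_comp_add_right (𝕜 := ℝ) (f := f) (s := closedStrip H) (x := x) (L, (0 : ℝ))
  rw [hset] at h1
  have h2 : fderivWithin ℝ (fun z => f (z + (L, (0 : ℝ)))) (closedStrip H) x =
      fderivWithin ℝ f (closedStrip H) x :=
    fderivWithin_congr (fun z hz => by
      have := hf z hz
      rw [← this]; congr 1; ext <;> simp) (by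
      have := hf x hx
      rw [← this]; congr 1; ext <;> simp)
  have h3 : x + (L, (0 : ℝ)) = (x.1 + L, x.2) := by ext <;> simp
  rw [h3, h2] at h1
  simp only [PeriodicChannel.stripDeriv, h1]

theorem contDiffOn_stripDeriv {H : ℝ} (hH : 0 < H) {f : ℝ × ℝ → ℝ} {n : WithTop ℕ∞}
    (hf : ContDiffOn ℝ (n + 1) f (closedStrip H)) (e : ℝ × ℝ) :
    ContDiffOn ℝ n (stripDeriv H e f) (closedStrip H) :=
  (hf.fderivWithin (uniqueDiffOn_closedStrip hH) le_rfl).clm_apply contDiffOn_const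

/-- Composing with `clamp` makes the function and its one-sided derivatives continuous on the whole
plane without changing them on the closed strip. All integrals below then have globally continuous
integrands. -/
theorem hasGrad_of_contDiffOn {L H : ℝ} (hH : 0 < H) {f : ℝ × ℝ → ℝ} (hp : IsPeriodic L H f)
    (hf : ContDiffOn ℝ 1 f (closedStrip H)) :
    HasGrad L H (fun x => f (clamp H x)) (fun x => stripDeriv H (1, 0) f (clamp H x))
      (fun x => stripDeriv H (0, 1) f (clamp H x)) where
  cont := continuous_comp_clamp hH hf.continuousOn
  cont1 := continuous_comp_clamp hH
    (contDiffOn_stripDeriv hH (n := 0) (by simpa using hf) _).continuousOn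
  cont2 := continuous_comp_clamp hH
    (contDiffOn_stripDeriv hH (n := 0) (by simpa using hf) _).continuousOn
  per x y := hp _ (clamp_mem hH (x, y))
  hasFDeriv x hx := by
    have h1 := ((hf x hx).differentiableWithinAt one_ne_zero).hasFDerivWithinAt
    have h2 := h1.congr (f₁ := fun x => f (clamp H x)) (fun z hz => by simp only [clamp_of_mem hz])
      (by simp only [clamp_of_mem hx])
    refine h2.congr_fderiv ?_
    rw [clamp_of_mem hx]
    ext <;> simp [stripDeriv]

/-- A function with periodic, continuously differentiable first partial derivatives. -/
structure HasHess (L H : ℝ) (f f₁ f₂ f₁₁ f₁₂ f₂₁ f₂₂ : ℝ × ℝ → ℝ) : Prop where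
  grad : HasGrad L H f f₁ f₂
  grad1 : HasGrad L H f₁ f₁₁ f₁₂
  grad2 : HasGrad L H f₂ f₂₁ f₂₂

theorem HasHess.lap_eq {L H : ℝ} {f f₁ f₂ f₁₁ f₁₂ f₂₁ f₂₂ : ℝ × ℝ → ℝ}
    (h : HasHess L H f f₁ f₂ f₁₁ f₁₂ f₂₁ f₂₂) {x : ℝ × ℝ} (hx : x ∈ strip H) :
    lap f x = f₁₁ x + f₂₂ x := by
  have e1 : pd1 (pd1 f) x = pd1 f₁ x := by
    unfold pd1
    congr 1
    ext s
    exact (h.grad.hasDerivAt_fst (x := s) (strip_subset H hx).2).deriv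
  have e2 : pd2 (pd2 f) x = pd2 f₂ x := by
    unfold pd2
    refine Filter.EventuallyEq.deriv_eq ?_
    filter_upwards [isOpen_Ioo.mem_nhds hx.2] with s hs
    exact h.grad.pd2_eq (x := (x.1, s)) ⟨mem_univ _, hs⟩
  rw [lap, e1, e2, h.grad1.pd1_eq (strip_subset H hx), h.grad2.pd2_eq hx]

theorem lap_congr {H : ℝ} {f g : ℝ × ℝ → ℝ} (h : ∀ x ∈ strip H, f x = g x) {x : ℝ × ℝ}
    (hx : x ∈ strip H) : lap f x = lap g x := by
  have k1 : ∀ z ∈ strip H, pd1 f z = pd1 g z := fun z hz => by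
    unfold pd1; congr 1; ext s; exact h (s, z.2) ⟨mem_univ _, hz.2⟩
  have k2 : ∀ z ∈ strip H, pd2 f z = pd2 g z := fun z hz => by
    unfold pd2
    refine Filter.EventuallyEq.deriv_eq ?_
    filter_upwards [isOpen_Ioo.mem_nhds hz.2] with s hs
    exact h (z.1, s) ⟨mem_univ _, hs⟩
  have e1 : pd1 (pd1 f) x = pd1 (pd1 g) x := by
    rw [pd1, pd1]; congr 1; ext s; exact k1 (s, x.2) ⟨mem_univ _, hx.2⟩
  have e2 : pd2 (pd2 f) x = pd2 (pd2 g) x := by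
    rw [pd2, pd2]
    refine Filter.EventuallyEq.deriv_eq ?_
    filter_upwards [isOpen_Ioo.mem_nhds hx.2] with s hs
    exact k2 (x.1, s) ⟨mem_univ _, hs⟩
  rw [lap, lap, e1, e2]

theorem IsC2.exists_hasHess {L H : ℝ} (hH : 0 < H) {f : ℝ × ℝ → ℝ} (hf : IsC2 L H f) :
    ∃ f₁ f₂ f₁₁ f₁₂ f₂₁ f₂₂, HasHess L H (fun x => f (clamp H x)) f₁ f₂ f₁₁ f₁₂ f₂₁ f₂₂ :=
  ⟨_, _, _, _, _, _, hasGrad_of_contDiffOn hH hf.1 (hf.2.of_le (by norm_num)),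
    hasGrad_of_contDiffOn hH (hf.1.stripDeriv _) (contDiffOn_stripDeriv hH (n := 1)
      (by simpa [one_add_one_eq_two] using hf.2) _),
    hasGrad_of_contDiffOn hH (hf.1.stripDeriv _) (contDiffOn_stripDeriv hH (n := 1)
      (by simpa [one_add_one_eq_two] using hf.2) _)⟩

/-- Green's first identity on the channel; the boundary values of `f` are constants. -/
theorem green {L H : ℝ} (hL : 0 < L) (hH : 0 < H) {f f₁ f₂ g g₁ g₂ g₁₁ g₁₂ g₂₁ g₂₂ : ℝ × ℝ → ℝ}
    (hf : HasGrad L H f f₁ f₂) (hg : HasHess L H g g₁ g₂ g₁₁ g₁₂ g₂₁ g₂₂) {a b : ℝ}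
    (ha : ∀ s, f (s, 0) = a) (hb : ∀ s, f (s, H) = b) :
    ∫ x, (f₁ x * g₁ x + f₂ x * g₂ x) ∂(channelMeasure L H) =
      (∫ x, f x * (-(g₁₁ x + g₂₂ x)) ∂(channelMeasure L H)) +
      (b * (∫ x in (0 : ℝ)..L, g₂ (x, H)) - a * ∫ x in (0 : ℝ)..L, g₂ (x, 0)) := by
  have h := integral_divergence hL hH (hf.mul hg.grad1) (hf.mul hg.grad2)
  simp only [ha, hb, intervalIntegral.integral_const_mul] at h
  rw [← h, ← integral_add]
  · refine integral_congr_ae (ae_of_all _ fun x => ?_)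
    simp only; ring
  · exact integrable_channel L H (hf.cont.mul (hg.grad1.cont1.add hg.grad2.cont2).neg)
  · exact integrable_channel L H ((hf.mul hg.grad1).cont1.add (hf.mul hg.grad2).cont2)

/-! ### Trigonometric integrals and Bessel's inequality. -/

section trig

theorem integral_cos_mul_zero {T : ℝ} (hT : 0 < T) (n : ℕ) (hn : n ≠ 0) :
    ∫ x in (0 : ℝ)..T, Real.cos (n * (2 * Real.pi / T * x)) = 0 := by
  have h : (n : ℝ) * (2 * Real.pi / T) ≠ 0 := by positivity
  simp_rw [← mul_assoc]
  rw [intervalIntegral.integral_comp_mul_left _ h, integral_cos]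
  have : (n : ℝ) * (2 * Real.pi / T) * T = n * (2 * Real.pi) := by field_simp
  rw [this, show (n : ℝ) * (2 * Real.pi) = ((2 * n : ℕ) : ℝ) * Real.pi by push_cast; ring,
    Real.sin_nat_mul_pi]
  simp

theorem integral_sin_mul_zero {T : ℝ} (hT : 0 < T) (n : ℕ) (hn : n ≠ 0) :
    ∫ x in (0 : ℝ)..T, Real.sin (n * (2 * Real.pi / T * x)) = 0 := by
  have h : (n : ℝ) * (2 * Real.pi / T) ≠ 0 := by positivity
  simp_rw [← mul_assoc]
  rw [intervalIntegral.integral_comp_mul_left _ h, integral_sin]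
  have : (n : ℝ) * (2 * Real.pi / T) * T = n * (2 * Real.pi) := by field_simp
  rw [this, Real.cos_nat_mul_two_pi]
  simp

variable {T : ℝ}

theorem integral_cos_period (hT : 0 < T) : ∫ x in (0 : ℝ)..T, Real.cos (2 * Real.pi / T * x) = 0 := by
  simpa using integral_cos_mul_zero hT 1 one_ne_zero

theorem integral_sin_period (hT : 0 < T) : ∫ x in (0 : ℝ)..T, Real.sin (2 * Real.pi / T * x) = 0 := by
  simpa using integral_sin_mul_zero hT 1 one_ne_zero

theorem integral_cos_sq_period (hT : 0 < T) :
    ∫ x in (0 : ℝ)..T, Real.cos (2 * Real.pi / T * x) ^ 2 = T / 2 := by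
  have h := integral_cos_mul_zero hT 2 two_ne_zero
  have : ∀ x : ℝ, Real.cos (2 * Real.pi / T * x) ^ 2 =
      1 / 2 + Real.cos ((2 : ℕ) * (2 * Real.pi / T * x)) / 2 := fun x => by
    rw [Real.cos_sq]; push_cast; ring
  simp_rw [this]
  rw [intervalIntegral.integral_add (by simp) (Continuous.intervalIntegrable (by fun_prop) _ _),
    intervalIntegral.integral_div, intervalIntegral.integral_div, h]
  simp

theorem integral_sin_sq_period (hT : 0 < T) :
    ∫ x in (0 : ℝ)..T, Real.sin (2 * Real.pi / T * x) ^ 2 = T / 2 := by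
  simp_rw [Real.sin_sq]
  rw [intervalIntegral.integral_sub (by simp) (Continuous.intervalIntegrable (by fun_prop) _ _),
    integral_cos_sq_period hT]
  simp; ring

theorem integral_cos_mul_sin_period (hT : 0 < T) :
    ∫ x in (0 : ℝ)..T, Real.cos (2 * Real.pi / T * x) * Real.sin (2 * Real.pi / T * x) = 0 := by
  have h := integral_sin_mul_zero hT 2 two_ne_zero
  have : ∀ x : ℝ, Real.cos (2 * Real.pi / T * x) * Real.sin (2 * Real.pi / T * x) =
      Real.sin ((2 : ℕ) * (2 * Real.pi / T * x)) / 2 := fun x => by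
    push_cast; rw [Real.sin_two_mul]; ring
  simp_rw [this]
  rw [intervalIntegral.integral_div, h, zero_div]

theorem sin_half_sq (y : ℝ) :
    Real.sin (Real.pi / T * y) ^ 2 = 1 / 2 - Real.cos (2 * Real.pi / T * y) / 2 := by
  have : 2 * Real.pi / T * y = 2 * (Real.pi / T * y) := by ring
  rw [this, Real.cos_two_mul, Real.sin_sq]; ring

theorem integral_sin_half_sq (hT : 0 < T) :
    ∫ x in (0 : ℝ)..T, Real.sin (Real.pi / T * x) ^ 2 = T / 2 := by
  simp_rw [sin_half_sq]
  rw [intervalIntegral.integral_sub (by simp) (Continuous.intervalIntegrable (by fun_prop) _ _),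
    intervalIntegral.integral_div, intervalIntegral.integral_div, integral_cos_period hT]
  simp

end trig

theorem integral_sq_sub_two {α : Type*} [MeasurableSpace α] {ν : Measure α} {f e₁ e₂ : α → ℝ}
    (h0 : Integrable (fun x => f x ^ 2) ν) (h1 : Integrable (fun x => f x * e₁ x) ν)
    (h2 : Integrable (fun x => f x * e₂ x) ν) (h11 : Integrable (fun x => e₁ x ^ 2) ν)
    (h12 : Integrable (fun x => e₁ x * e₂ x) ν) (h22 : Integrable (fun x => e₂ x ^ 2) ν) (p q : ℝ) :
    ∫ x, (f x - (p * e₁ x + q * e₂ x)) ^ 2 ∂ν = (∫ x, f x ^ 2 ∂ν) - 2 * p * (∫ x, f x * e₁ x ∂ν)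
      - 2 * q * (∫ x, f x * e₂ x ∂ν) + p ^ 2 * (∫ x, e₁ x ^ 2 ∂ν) +
      2 * p * q * (∫ x, e₁ x * e₂ x ∂ν) + q ^ 2 * ∫ x, e₂ x ^ 2 ∂ν := by
  have e : ∀ x, (f x - (p * e₁ x + q * e₂ x)) ^ 2 = f x ^ 2 - 2 * p * (f x * e₁ x)
      - 2 * q * (f x * e₂ x) + p ^ 2 * e₁ x ^ 2 + 2 * p * q * (e₁ x * e₂ x) + q ^ 2 * e₂ x ^ 2 :=
    fun x => by ring
  simp_rw [e]
  have i1 : Integrable (fun x => f x ^ 2 - 2 * p * (f x * e₁ x)) ν := h0.sub (h1.const_mul (2 * p))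
  have i2 : Integrable (fun x => f x ^ 2 - 2 * p * (f x * e₁ x) - 2 * q * (f x * e₂ x)) ν :=
    i1.sub (h2.const_mul (2 * q))
  have i3 : Integrable (fun x => f x ^ 2 - 2 * p * (f x * e₁ x) - 2 * q * (f x * e₂ x) +
    p ^ 2 * e₁ x ^ 2) ν := i2.add (h11.const_mul (p ^ 2))
  have i4 : Integrable (fun x => f x ^ 2 - 2 * p * (f x * e₁ x) - 2 * q * (f x * e₂ x) +
    p ^ 2 * e₁ x ^ 2 + 2 * p * q * (e₁ x * e₂ x)) ν := i3.add (h12.const_mul (2 * p * q))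
  rw [integral_add i4 (h22.const_mul _), integral_add i3 (h12.const_mul _),
    integral_add i2 (h11.const_mul _), integral_sub i1 (h2.const_mul _),
    integral_sub h0 (h1.const_mul _)]
  simp only [integral_const_mul]

theorem intervalIntegral_sq_sub_two {f e₁ e₂ : ℝ → ℝ} (hf : Continuous f) (h1 : Continuous e₁)
    (h2 : Continuous e₂) {T : ℝ} (hT : 0 ≤ T) (p q : ℝ) :
    ∫ x in (0 : ℝ)..T, (f x - (p * e₁ x + q * e₂ x)) ^ 2 =
      (∫ x in (0 : ℝ)..T, f x ^ 2) - 2 * p * (∫ x in (0 : ℝ)..T, f x * e₁ x)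
      - 2 * q * (∫ x in (0 : ℝ)..T, f x * e₂ x) + p ^ 2 * (∫ x in (0 : ℝ)..T, e₁ x ^ 2) +
      2 * p * q * (∫ x in (0 : ℝ)..T, e₁ x * e₂ x) + q ^ 2 * ∫ x in (0 : ℝ)..T, e₂ x ^ 2 := by
  have hi : ∀ g : ℝ → ℝ, Continuous g → Integrable g (volume.restrict (Ioc 0 T)) := fun g hg =>
    (intervalIntegrable_iff_integrableOn_Ioc_of_le hT).1 (hg.intervalIntegrable 0 T)
  simp only [intervalIntegral.integral_of_le hT]
  exact integral_sq_sub_two (hi _ (by fun_prop)) (hi _ (by fun_prop)) (hi _ (by fun_prop))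
    (hi _ (by fun_prop)) (hi _ (by fun_prop)) (hi _ (by fun_prop)) p q

theorem channel_sq_sub_two {L H : ℝ} {f e₁ e₂ : ℝ × ℝ → ℝ} (hf : Continuous f)
    (h1 : Continuous e₁) (h2 : Continuous e₂) (p q : ℝ) :
    ∫ x, (f x - (p * e₁ x + q * e₂ x)) ^ 2 ∂(channelMeasure L H) =
      (∫ x, f x ^ 2 ∂(channelMeasure L H)) - 2 * p * (∫ x, f x * e₁ x ∂(channelMeasure L H))
      - 2 * q * (∫ x, f x * e₂ x ∂(channelMeasure L H))
      + p ^ 2 * (∫ x, e₁ x ^ 2 ∂(channelMeasure L H)) +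
      2 * p * q * (∫ x, e₁ x * e₂ x ∂(channelMeasure L H))
      + q ^ 2 * ∫ x, e₂ x ^ 2 ∂(channelMeasure L H) :=
  integral_sq_sub_two (integrable_channel L H (by fun_prop)) (integrable_channel L H (by fun_prop))
    (integrable_channel L H (by fun_prop)) (integrable_channel L H (by fun_prop))
    (integrable_channel L H (by fun_prop)) (integrable_channel L H (by fun_prop)) p q

/-- Bessel's identity for the first two periodic trigonometric modes. -/
theorem bessel_periodic {T : ℝ} (hT : 0 < T) {f : ℝ → ℝ} (hf : Continuous f) :
    ∫ x in (0 : ℝ)..T, (f x -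
      (2 / T * (∫ x in (0 : ℝ)..T, f x * Real.cos (2 * Real.pi / T * x)) * Real.cos (2 * Real.pi / T * x)
      + 2 / T * (∫ x in (0 : ℝ)..T, f x * Real.sin (2 * Real.pi / T * x)) *
        Real.sin (2 * Real.pi / T * x))) ^ 2 =
      (∫ x in (0 : ℝ)..T, f x ^ 2) -
      2 / T * ((∫ x in (0 : ℝ)..T, f x * Real.cos (2 * Real.pi / T * x)) ^ 2 +
        (∫ x in (0 : ℝ)..T, f x * Real.sin (2 * Real.pi / T * x)) ^ 2) := by
  rw [intervalIntegral_sq_sub_two hf (by fun_prop) (by fun_prop) hT.le, integral_cos_sq_period hT,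
    integral_sin_sq_period hT, integral_cos_mul_sin_period hT]
  field_simp; ring

theorem bessel_periodic_le {T : ℝ} (hT : 0 < T) {f : ℝ → ℝ} (hf : Continuous f) :
    2 / T * ((∫ x in (0 : ℝ)..T, f x * Real.cos (2 * Real.pi / T * x)) ^ 2 +
        (∫ x in (0 : ℝ)..T, f x * Real.sin (2 * Real.pi / T * x)) ^ 2) ≤
      ∫ x in (0 : ℝ)..T, f x ^ 2 := by
  have h := bessel_periodic hT hf
  have h2 : (0:ℝ) ≤ _ := intervalIntegral.integral_nonneg hT.le (μ := volume) (fun x _ => sq_nonneg (f x -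
      (2 / T * (∫ x in (0 : ℝ)..T, f x * Real.cos (2 * Real.pi / T * x)) * Real.cos (2 * Real.pi / T * x)
      + 2 / T * (∫ x in (0 : ℝ)..T, f x * Real.sin (2 * Real.pi / T * x)) *
        Real.sin (2 * Real.pi / T * x))))
  linarith

/-- Bessel's identity for the first Dirichlet mode. -/
theorem bessel_dirichlet {T : ℝ} (hT : 0 < T) {f : ℝ → ℝ} (hf : Continuous f) :
    ∫ x in (0 : ℝ)..T, (f x -
      2 / T * (∫ x in (0 : ℝ)..T, f x * Real.sin (Real.pi / T * x)) * Real.sin (Real.pi / T * x)) ^ 2 =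
      (∫ x in (0 : ℝ)..T, f x ^ 2) -
      2 / T * (∫ x in (0 : ℝ)..T, f x * Real.sin (Real.pi / T * x)) ^ 2 := by
  have h := intervalIntegral_sq_sub_two hf (e₁ := fun x => Real.sin (Real.pi / T * x))
    (e₂ := fun _ => 0) (by fun_prop) (by fun_prop) hT.le
    (2 / T * (∫ x in (0 : ℝ)..T, f x * Real.sin (Real.pi / T * x))) 0
  simp only [zero_mul, add_zero] at h
  rw [h, integral_sin_half_sq hT]
  field_simp; ring

theorem bessel_dirichlet_le {T : ℝ} (hT : 0 < T) {f : ℝ → ℝ} (hf : Continuous f) :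
    2 / T * (∫ x in (0 : ℝ)..T, f x * Real.sin (Real.pi / T * x)) ^ 2 ≤
      ∫ x in (0 : ℝ)..T, f x ^ 2 := by
  have h := bessel_dirichlet hT hf
  have h2 : (0:ℝ) ≤ _ := intervalIntegral.integral_nonneg hT.le (μ := volume) (fun x _ => sq_nonneg (f x -
      2 / T * (∫ x in (0 : ℝ)..T, f x * Real.sin (Real.pi / T * x)) * Real.sin (Real.pi / T * x)))
  linarith

/-! ### Poincaré inequalities on the channel with a spectral gap. -/

/-- The functions of the first nonconstant Fourier mode along the channel. -/
noncomputable def waveMode (L H A B : ℝ) (x : ℝ × ℝ) : ℝ :=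
  Real.sin (Real.pi / H * x.2) *
    (A * Real.cos (2 * Real.pi / L * x.1) + B * Real.sin (2 * Real.pi / L * x.1))

/-- The functions of the first nonconstant mode across the channel. -/
noncomputable def shearMode (H C D : ℝ) (x : ℝ × ℝ) : ℝ :=
  C * Real.cos (2 * Real.pi / H * x.2) + D * Real.sin (2 * Real.pi / H * x.2)

@[fun_prop] theorem continuous_waveMode (L H A B : ℝ) : Continuous (waveMode L H A B) := by
  unfold waveMode; fun_prop

@[fun_prop] theorem continuous_shearMode (H C D : ℝ) : Continuous (shearMode H C D) := by
  unfold shearMode; fun_prop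

/-- The smallest eigenvalue among modes that depend on `x₁`. -/
noncomputable def waveEigenvalue (L H : ℝ) : ℝ := (2 * Real.pi / L) ^ 2 + (Real.pi / H) ^ 2

/-- The smallest eigenvalue among modes that do not depend on `x₁`. -/
noncomputable def shearEigenvalue (H : ℝ) : ℝ := (2 * Real.pi / H) ^ 2

/-- The constant in the spectral gap estimates. -/
noncomputable def gapConst (L H : ℝ) : ℝ := 3 * min ((2 * Real.pi / L) ^ 2) ((Real.pi / H) ^ 2)

theorem gapConst_pos {L H : ℝ} (hL : 0 < L) (hH : 0 < H) : 0 < gapConst L H := by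
  unfold gapConst; positivity

section
variable {L H : ℝ} (hL : 0 < L) (hH : 0 < H)
include hL hH

theorem channel_add {f g : ℝ × ℝ → ℝ} (hf : Continuous f) (hg : Continuous g) :
    ∫ x, (f x + g x) ∂(channelMeasure L H) =
      (∫ x, f x ∂(channelMeasure L H)) + ∫ x, g x ∂(channelMeasure L H) :=
  integral_add (integrable_channel L H hf) (integrable_channel L H hg)

theorem integral_channel_mul {a b : ℝ → ℝ} (ha : Continuous a) (hb : Continuous b) :
    ∫ x, a x.1 * b x.2 ∂(channelMeasure L H) =
      (∫ x in (0 : ℝ)..L, a x) * ∫ y in (0 : ℝ)..H, b y := by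
  rw [integral_channel hL hH (by fun_prop), ← intervalIntegral.integral_mul_const]
  simp only [intervalIntegral.integral_const_mul]

theorem integral_channel_snd {b : ℝ → ℝ} (hb : Continuous b) :
    ∫ x, b x.2 ∂(channelMeasure L H) = L * ∫ y in (0 : ℝ)..H, b y := by
  have := integral_channel_mul hL hH (continuous_const (y := (1:ℝ))) hb
  simpa using this

theorem integral_waveMode_parts {p q : ℝ → ℝ} (hp : Continuous p) (hq : Continuous q) {u : ℝ × ℝ → ℝ}
    (hu : Continuous u) :
    ∫ x, u x * (q x.2 * p x.1) ∂(channelMeasure L H) =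
      ∫ y in (0 : ℝ)..H, (∫ x in (0 : ℝ)..L, u (x, y) * p x) * q y := by
  rw [integral_channel_swap hL hH (by fun_prop)]
  congr 1; ext y
  rw [← intervalIntegral.integral_mul_const]
  congr 1; ext x; ring

theorem integral_waveMode_sq (A B : ℝ) :
    ∫ x, waveMode L H A B x ^ 2 ∂(channelMeasure L H) = L * H / 4 * (A ^ 2 + B ^ 2) := by
  have e : ∀ x, waveMode L H A B x ^ 2 = (A * Real.cos (2 * Real.pi / L * x.1) +
    B * Real.sin (2 * Real.pi / L * x.1)) ^ 2 * Real.sin (Real.pi / H * x.2) ^ 2 := fun x => by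
    unfold waveMode; ring
  simp_rw [e]
  rw [integral_channel_mul hL hH (a := fun s => (A * Real.cos (2 * Real.pi / L * s) +
    B * Real.sin (2 * Real.pi / L * s)) ^ 2) (b := fun s => Real.sin (Real.pi / H * s) ^ 2)
    (by fun_prop) (by fun_prop), integral_sin_half_sq hH]
  have := intervalIntegral_sq_sub_two (f := fun _ => 0)
    (e₁ := fun s => Real.cos (2 * Real.pi / L * s)) (e₂ := fun s => Real.sin (2 * Real.pi / L * s))
    continuous_const (by fun_prop) (by fun_prop) hL.le A B
  simp only [zero_sub, neg_sq, integral_cos_sq_period hL, integral_sin_sq_period hL,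
    integral_cos_mul_sin_period hL] at this
  rw [this]; simp; ring

theorem integral_shearMode_sq (C D : ℝ) :
    ∫ x, shearMode H C D x ^ 2 ∂(channelMeasure L H) = L * H / 2 * (C ^ 2 + D ^ 2) := by
  unfold shearMode
  rw [integral_channel_snd hL hH (b := fun s => (C * Real.cos (2 * Real.pi / H * s) +
    D * Real.sin (2 * Real.pi / H * s)) ^ 2) (by fun_prop)]
  have := intervalIntegral_sq_sub_two (f := fun _ => 0)
    (e₁ := fun s => Real.cos (2 * Real.pi / H * s)) (e₂ := fun s => Real.sin (2 * Real.pi / H * s))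
    continuous_const (by fun_prop) (by fun_prop) hH.le C D
  simp only [zero_sub, neg_sq, integral_cos_sq_period hH, integral_sin_sq_period hH,
    integral_cos_mul_sin_period hH] at this
  rw [this]; simp; ring

/-- Poincaré's inequality, with spectral gap, for functions of zero average along the channel. -/
theorem wave_gap {u u₁ u₂ : ℝ × ℝ → ℝ} (hu : HasGrad L H u u₁ u₂) (h0 : ∀ s, u (s, 0) = 0)
    (hH0 : ∀ s, u (s, H) = 0) (hm : ∀ y ∈ Icc 0 H, ∫ x in (0 : ℝ)..L, u (x, y) = 0) :
    ∃ A B : ℝ, waveEigenvalue L H * (∫ x, u x ^ 2 ∂(channelMeasure L H)) +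
      gapConst L H * ∫ x, (u x - waveMode L H A B x) ^ 2 ∂(channelMeasure L H) ≤
      ∫ x, (u₁ x ^ 2 + u₂ x ^ 2) ∂(channelMeasure L H) := by
  have cu := hu.cont
  have cu1 := hu.cont1
  have cu2 := hu.cont2
  set k := 2 * Real.pi / L with hk
  set κ := Real.pi / H with hκ
  set ac : ℝ → ℝ := fun y => ∫ x in (0 : ℝ)..L, u (x, y) * Real.cos (k * x) with hac
  set as : ℝ → ℝ := fun y => ∫ x in (0 : ℝ)..L, u (x, y) * Real.sin (k * x) with has
  set b : ℝ → ℝ := fun x => ∫ y in (0 : ℝ)..H, u (x, y) * Real.sin (κ * y) with hb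
  have cac : Continuous ac := continuous_integral_fst (f := fun z => u z * Real.cos (k * z.1)) (by fun_prop) 0 L
  have cas : Continuous as := continuous_integral_fst (f := fun z => u z * Real.sin (k * z.1)) (by fun_prop) 0 L
  have cb : Continuous b := continuous_integral_snd (f := fun z => u z * Real.sin (κ * z.2)) (by fun_prop) 0 H
  set α := ∫ y in (0 : ℝ)..H, ac y * Real.sin (κ * y) with hα
  set β := ∫ y in (0 : ℝ)..H, as y * Real.sin (κ * y) with hβ
  set X := ∫ x, u x ^ 2 ∂(channelMeasure L H) with hX
  have X1 : X = ∫ y in (0 : ℝ)..H, ∫ x in (0 : ℝ)..L, u (x, y) ^ 2 :=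
    integral_channel_swap hL hH (f := fun z => u z ^ 2) (by fun_prop)
  have X2 : X = ∫ x in (0 : ℝ)..L, ∫ y in (0 : ℝ)..H, u (x, y) ^ 2 :=
    integral_channel hL hH (f := fun z => u z ^ 2) (by fun_prop)
  have U1 := integral_channel_swap hL hH (f := fun z => u₁ z ^ 2) (by fun_prop)
  have U2 := integral_channel hL hH (f := fun z => u₂ z ^ 2) (by fun_prop)
  set Y1 := ∫ y in (0 : ℝ)..H, (ac y ^ 2 + as y ^ 2) with hY1
  set Y2 := ∫ x in (0 : ℝ)..L, b x ^ 2 with hY2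
  have cX1 := continuous_integral_fst (f := fun z => u z ^ 2) (by fun_prop) 0 L
  have cX2 := continuous_integral_snd (f := fun z => u z ^ 2) (by fun_prop) 0 H
  have cU1 := continuous_integral_fst (f := fun z => u₁ z ^ 2) (by fun_prop) 0 L
  have cU2 := continuous_integral_snd (f := fun z => u₂ z ^ 2) (by fun_prop) 0 H
  have ii : ∀ {g : ℝ → ℝ} {a b : ℝ}, Continuous g → IntervalIntegrable g volume a b :=
    fun hg => hg.intervalIntegrable _ _
  -- The one-dimensional inequalities, on horizontal and then on vertical lines, integrated over the
  -- other variable.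
  have ineqx : 4 * k ^ 2 * X ≤ (∫ x, u₁ x ^ 2 ∂(channelMeasure L H)) + 6 * k ^ 2 / L * Y1 := by
    rw [X1, U1, hY1, ← intervalIntegral.integral_const_mul, ← intervalIntegral.integral_const_mul,
      ← intervalIntegral.integral_add (ii cU1) (ii (by fun_prop))]
    refine intervalIntegral.integral_mono_on hH.le (ii (by fun_prop)) (ii (by fun_prop)) fun y hy => ?_
    exact wirtinger_periodic_gap hL (f := fun x => u (x, y)) (f' := fun x => u₁ (x, y))
      (by fun_prop) (by fun_prop) (fun x _ => (hu.hasDerivAt_fst hy).hasDerivWithinAt)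
      (by simpa using (hu.per 0 y).symm) (hm y hy)
  have ineqy : 4 * κ ^ 2 * X ≤ (∫ x, u₂ x ^ 2 ∂(channelMeasure L H)) + 6 * κ ^ 2 / H * Y2 := by
    rw [X2, U2, hY2, ← intervalIntegral.integral_const_mul, ← intervalIntegral.integral_const_mul,
      ← intervalIntegral.integral_add (ii cU2) (ii (by fun_prop))]
    refine intervalIntegral.integral_mono_on hL.le (ii (by fun_prop)) (ii (by fun_prop)) fun x hx => ?_
    exact wirtinger_dirichlet_gap hH (f := fun y => u (x, y)) (f' := fun y => u₂ (x, y))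
      (by fun_prop) (by fun_prop) (fun y hy => hu.hasDerivWithinAt_snd hy) (h0 x) (hH0 x)
  have besx : 2 / L * Y1 ≤ X := by
    rw [X1, hY1, ← intervalIntegral.integral_const_mul]
    refine intervalIntegral.integral_mono_on hH.le (ii (by fun_prop)) (ii (by fun_prop)) fun y hy => ?_
    exact bessel_periodic_le hL (f := fun x => u (x, y)) (by fun_prop)
  have besy : 2 / H * Y2 ≤ X := by
    rw [X2, hY2, ← intervalIntegral.integral_const_mul]
    refine intervalIntegral.integral_mono_on hL.le (ii (by fun_prop)) (ii (by fun_prop)) fun x hx => ?_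
    exact bessel_dirichlet_le hH (f := fun y => u (x, y)) (by fun_prop)
  have hα' : ∫ x, u x * (Real.sin (κ * x.2) * Real.cos (k * x.1)) ∂(channelMeasure L H) = α :=
    integral_waveMode_parts hL hH (p := fun s => Real.cos (k * s)) (q := fun s => Real.sin (κ * s))
      (by fun_prop) (by fun_prop) cu
  have hβ' : ∫ x, u x * (Real.sin (κ * x.2) * Real.sin (k * x.1)) ∂(channelMeasure L H) = β :=
    integral_waveMode_parts hL hH (p := fun s => Real.sin (k * s)) (q := fun s => Real.sin (κ * s))
      (by fun_prop) (by fun_prop) cu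
  -- the part of `u` orthogonal to the first Dirichlet mode
  set w : ℝ × ℝ → ℝ := fun z => u z - 2 / H * b z.1 * Real.sin (κ * z.2) with hw
  have cw : Continuous w := by fun_prop
  have Wx : ∫ x, w x ^ 2 ∂(channelMeasure L H) = X - 2 / H * Y2 := by
    rw [integral_channel hL hH (f := fun z => w z ^ 2) (by fun_prop), X2, hY2,
      ← intervalIntegral.integral_const_mul,
      ← intervalIntegral.integral_sub (ii cX2) (ii (by fun_prop))]
    congr 1; ext x
    exact bessel_dirichlet hH (f := fun y => u (x, y)) (by fun_prop)
  have fub : ∀ p : ℝ → ℝ, Continuous p → ∫ x in (0 : ℝ)..L, b x * p x =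
      ∫ y in (0 : ℝ)..H, (∫ x in (0 : ℝ)..L, u (x, y) * p x) * Real.sin (κ * y) := fun p hp => by
    rw [← integral_waveMode_parts hL hH (q := fun s => Real.sin (κ * s)) hp (by fun_prop) cu,
      integral_channel hL hH (by fun_prop)]
    congr 1; ext x
    rw [hb, ← intervalIntegral.integral_mul_const]
    congr 1; ext y; ring
  have proj : ∀ p : ℝ → ℝ, Continuous p → ∀ y, ∫ x in (0 : ℝ)..L, w (x, y) * p x =
      (∫ x in (0 : ℝ)..L, u (x, y) * p x) -
        (2 / H * ∫ x in (0 : ℝ)..L, b x * p x) * Real.sin (κ * y) := fun p hp y => by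
    rw [← intervalIntegral.integral_const_mul, ← intervalIntegral.integral_mul_const,
      ← intervalIntegral.integral_sub (ii (by fun_prop)) (ii (by fun_prop))]
    congr 1; ext x; simp only [hw]; ring
  have wc : ∀ y, ∫ x in (0 : ℝ)..L, w (x, y) * Real.cos (k * x) =
      ac y - 2 / H * α * Real.sin (κ * y) := fun y => by
    rw [proj _ (by fun_prop), fub (fun x => Real.cos (k * x)) (by fun_prop)]
  have ws : ∀ y, ∫ x in (0 : ℝ)..L, w (x, y) * Real.sin (k * x) =
      as y - 2 / H * β * Real.sin (κ * y) := fun y => by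
    rw [proj _ (by fun_prop), fub (fun x => Real.sin (k * x)) (by fun_prop)]
  -- If P and Q project onto the first harmonics in x₁ and onto the first Dirichlet mode in x₂, this
  -- is (1 - P)(1 - Q) ≥ 0. Equivalently 1 - PQ ≤ (1 - P) + (1 - Q), which turns the two
  -- one-dimensional surpluses into the distance to the wave modes.
  have bes2 : 2 / L * (Y1 - 2 / H * (α ^ 2 + β ^ 2)) ≤ X - 2 / H * Y2 := by
    rw [← Wx, integral_channel_swap hL hH (f := fun z => w z ^ 2) (by fun_prop)]
    have e1 : Y1 - 2 / H * (α ^ 2 + β ^ 2) = ∫ y in (0 : ℝ)..H,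
        ((ac y - 2 / H * α * Real.sin (κ * y)) ^ 2 + (as y - 2 / H * β * Real.sin (κ * y)) ^ 2) := by
      rw [intervalIntegral.integral_add (ii (by fun_prop)) (ii (by fun_prop)), hα, hβ,
        bessel_dirichlet hH cac, bessel_dirichlet hH cas, hY1,
        intervalIntegral.integral_add (ii (by fun_prop)) (ii (by fun_prop))]
      ring
    rw [e1, ← intervalIntegral.integral_const_mul]
    refine intervalIntegral.integral_mono_on hH.le (ii (by fun_prop))
      (ii (continuous_integral_fst (f := fun z => w z ^ 2) (by fun_prop) 0 L)) fun y hy => ?_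
    rw [← wc, ← ws]
    exact bessel_periodic_le hL (f := fun x => w (x, y)) (by fun_prop)
  have hQ : ∀ A B : ℝ, ∫ x, (u x - waveMode L H A B x) ^ 2 ∂(channelMeasure L H) =
      X - 2 * A * α - 2 * B * β + L * H / 4 * (A ^ 2 + B ^ 2) := fun A B => by
    have e := channel_sq_sub_two (L := L) (H := H) cu
      (e₁ := fun z => Real.sin (κ * z.2) * Real.cos (k * z.1))
      (e₂ := fun z => Real.sin (κ * z.2) * Real.sin (k * z.1)) (by fun_prop) (by fun_prop) A B
    have e0 := channel_sq_sub_two (L := L) (H := H) (f := fun _ => 0) continuous_const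
      (e₁ := fun z => Real.sin (κ * z.2) * Real.cos (k * z.1))
      (e₂ := fun z => Real.sin (κ * z.2) * Real.sin (k * z.1)) (by fun_prop) (by fun_prop) A B
    have e2 := integral_waveMode_sq hL hH A B
    have f1 : ∀ x, u x - (A * (Real.sin (κ * x.2) * Real.cos (k * x.1)) +
        B * (Real.sin (κ * x.2) * Real.sin (k * x.1))) = u x - waveMode L H A B x := fun x => by
      unfold waveMode; ring
    have f2 : ∀ x : ℝ × ℝ, (0 - (A * (Real.sin (κ * x.2) * Real.cos (k * x.1)) +
        B * (Real.sin (κ * x.2) * Real.sin (k * x.1)))) ^ 2 = waveMode L H A B x ^ 2 := fun x => by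
      unfold waveMode; ring
    simp only [f1] at e
    simp only [f2] at e0
    simp only [zero_mul, integral_zero, ne_eq, OfNat.ofNat_ne_zero, not_false_eq_true, zero_pow,
      mul_zero, sub_zero, zero_add] at e0
    rw [e, hα', hβ', ← hX, ← e2, e0]
    ring
  -- Fourier coefficients of u: a wave mode of unit amplitude has squared norm LH/4.
  refine ⟨4 / (L * H) * α, 4 / (L * H) * β, ?_⟩
  rw [hQ, channel_add hL hH (f := fun x => u₁ x ^ 2) (g := fun x => u₂ x ^ 2) (by fun_prop) (by fun_prop)]
  have e3 : X - 2 * (4 / (L * H) * α) * α - 2 * (4 / (L * H) * β) * β +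
      L * H / 4 * ((4 / (L * H) * α) ^ 2 + (4 / (L * H) * β) ^ 2) =
      X - 2 / L * (2 / H * (α ^ 2 + β ^ 2)) := by
    field_simp; ring
  rw [e3]
  have m1 : gapConst L H ≤ 3 * k ^ 2 := by
    unfold gapConst; exact mul_le_mul_of_nonneg_left (min_le_left _ _) (by norm_num)
  have m2 : gapConst L H ≤ 3 * κ ^ 2 := by
    unfold gapConst; exact mul_le_mul_of_nonneg_left (min_le_right _ _) (by norm_num)
  have t1 := mul_le_mul_of_nonneg_right m1 (sub_nonneg.2 besx)
  have t2 := mul_le_mul_of_nonneg_right m2 (sub_nonneg.2 besy)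
  have t3 := mul_le_mul_of_nonneg_left bes2 (gapConst_pos hL hH).le
  have s1 : 6 * k ^ 2 / L * Y1 = 3 * k ^ 2 * (2 / L * Y1) := by ring
  have s2 : 6 * κ ^ 2 / H * Y2 = 3 * κ ^ 2 * (2 / H * Y2) := by ring
  rw [s1] at ineqx
  rw [s2] at ineqy
  have : waveEigenvalue L H = k ^ 2 + κ ^ 2 := rfl
  rw [this]
  nlinarith [t1, t2, t3, ineqx, ineqy]

end

/-- The average of `f` along the channel. -/
noncomputable def xmean (L : ℝ) (f : ℝ × ℝ → ℝ) (y : ℝ) : ℝ := 1 / L * ∫ x in (0 : ℝ)..L, f (x, y)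

theorem continuous_xmean {L : ℝ} {f : ℝ × ℝ → ℝ} (hf : Continuous f) : Continuous (xmean L f) :=
  continuous_const.mul (continuous_integral_fst hf 0 L)

section
variable {L H : ℝ} (hL : 0 < L) (hH : 0 < H)
include hL hH

theorem HasGrad.xmean_eq {f f₁ f₂ : ℝ × ℝ → ℝ} (hf : HasGrad L H f f₁ f₂) {y : ℝ}
    (hy : y ∈ Icc 0 H) : xmean L f y = xmean L f 0 + ∫ s in (0 : ℝ)..y, xmean L f₂ s := by
  have cf2 := hf.cont2
  have cf := hf.cont
  rcases eq_or_lt_of_le hy.1 with h | h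
  · subst h; simp
  have ftc : ∀ x, ∫ s in (0 : ℝ)..y, f₂ (x, s) = f (x, y) - f (x, 0) := fun x => by
    refine intervalIntegral.integral_eq_sub_of_hasDeriv_right_of_le hy.1
      (f := fun s => f (x, s)) (by fun_prop) (fun s hs => ?_)
      (Continuous.intervalIntegrable (by fun_prop) _ _)
    exact ((hf.hasDerivWithinAt_snd (x := x) ⟨hs.1.le, hs.2.le.trans hy.2⟩).hasDerivAt
      (Icc_mem_nhds hs.1 (hs.2.trans_le hy.2))).hasDerivWithinAt
  unfold xmean
  rw [intervalIntegral.integral_const_mul, ← mul_add]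
  congr 1
  rw [← integral_channel_swap hL h cf2, integral_channel hL h cf2]
  simp_rw [ftc]
  rw [intervalIntegral.integral_sub (Continuous.intervalIntegrable (by fun_prop) _ _)
    (Continuous.intervalIntegrable (by fun_prop) _ _)]
  ring

theorem HasGrad.xmean {f f₁ f₂ : ℝ × ℝ → ℝ} (hf : HasGrad L H f f₁ f₂) :
    HasGrad L H (fun x => xmean L f x.2) (fun _ => 0) (fun x => xmean L f₂ x.2) := by
  have c2 := continuous_xmean (L := L) hf.cont2
  refine HasGrad.of_snd (continuous_xmean hf.cont) c2 fun y hy => ?_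
  have h : HasDerivAt (fun z => PeriodicChannel.xmean L f 0 +
      ∫ s in (0 : ℝ)..z, PeriodicChannel.xmean L f₂ s) (PeriodicChannel.xmean L f₂ y) y :=
    (intervalIntegral.integral_hasDerivAt_right (c2.intervalIntegrable _ _)
      (c2.stronglyMeasurableAtFilter _ _) c2.continuousAt).const_add _
  exact h.hasDerivWithinAt.congr (fun z hz => hf.xmean_eq hL hH hz) (hf.xmean_eq hL hH hy)

theorem integral_sub_xmean {f : ℝ × ℝ → ℝ} (hf : Continuous f) (y : ℝ) :
    ∫ x in (0 : ℝ)..L, (f (x, y) - xmean L f y) = 0 := by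
  rw [intervalIntegral.integral_sub (Continuous.intervalIntegrable (by fun_prop) _ _) (by simp)]
  simp only [intervalIntegral.integral_const, xmean, smul_eq_mul, sub_zero]
  field_simp; ring

/-- Functions with zero average along the channel are orthogonal to functions of `x₂`. -/
theorem integral_mul_snd_eq_zero {u : ℝ × ℝ → ℝ} (hu : Continuous u)
    (hm : ∀ y ∈ Icc 0 H, ∫ x in (0 : ℝ)..L, u (x, y) = 0) {b : ℝ → ℝ} (hb : Continuous b) :
    ∫ x, u x * b x.2 ∂(channelMeasure L H) = 0 := by
  rw [integral_channel_swap hL hH (by fun_prop)]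
  simp only [intervalIntegral.integral_mul_const]
  rw [intervalIntegral.integral_congr (g := fun _ => 0) (fun y hy => ?_)]
  · simp
  · rw [uIcc_of_le hH.le] at hy
    simp [hm y hy]

theorem integral_sq_add_snd {u : ℝ × ℝ → ℝ} (hu : Continuous u)
    (hm : ∀ y ∈ Icc 0 H, ∫ x in (0 : ℝ)..L, u (x, y) = 0) {b : ℝ → ℝ} (hb : Continuous b) :
    ∫ x, (u x + b x.2) ^ 2 ∂(channelMeasure L H) =
      (∫ x, u x ^ 2 ∂(channelMeasure L H)) + ∫ x, b x.2 ^ 2 ∂(channelMeasure L H) := by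
  have e : ∀ x : ℝ × ℝ, (u x + b x.2) ^ 2 = (u x ^ 2 + 2 * (u x * b x.2)) + b x.2 ^ 2 := fun x => by ring
  simp_rw [e]
  rw [channel_add hL hH (f := fun x => u x ^ 2 + 2 * (u x * b x.2)) (g := fun x => b x.2 ^ 2)
    (by fun_prop) (by fun_prop), channel_add hL hH (f := fun x => u x ^ 2)
    (g := fun x => 2 * (u x * b x.2)) (by fun_prop) (by fun_prop), integral_const_mul,
    integral_mul_snd_eq_zero hL hH hu hm hb]
  ring

/-- The average over the channel. -/
noncomputable def channelMean (L H : ℝ) (f : ℝ × ℝ → ℝ) : ℝ :=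
  1 / (L * H) * ∫ x, f x ∂(channelMeasure L H)

/-- The average-free part of the average along the channel. -/
noncomputable def shearPart (L H : ℝ) (f : ℝ × ℝ → ℝ) (y : ℝ) : ℝ := xmean L f y - channelMean L H f

theorem integral_shearPart {f : ℝ × ℝ → ℝ} (hf : Continuous f) :
    ∫ y in (0 : ℝ)..H, shearPart L H f y = 0 := by
  unfold shearPart
  rw [intervalIntegral.integral_sub ((continuous_xmean hf).intervalIntegrable _ _) (by simp)]
  unfold xmean channelMean
  rw [integral_channel_swap hL hH hf, intervalIntegral.integral_const_mul]
  simp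
  field_simp; ring

/-- Poincaré's inequality with spectral gap on the channel. -/
theorem channel_gap {χ χ₁ χ₂ : ℝ × ℝ → ℝ} (hχ : HasGrad L H χ χ₁ χ₂) (h0 : ∀ s, χ (s, 0) = 0)
    (hH0 : ∀ s, χ (s, H) = 0) : ∃ u n : ℝ × ℝ → ℝ, Continuous u ∧ Continuous n ∧ ∃ A B C D : ℝ,
      (∀ x, χ x - channelMean L H χ = u x + n x) ∧
      ∫ x, (χ x - channelMean L H χ) ^ 2 ∂(channelMeasure L H) =
        (∫ x, u x ^ 2 ∂(channelMeasure L H)) + (∫ x, n x ^ 2 ∂(channelMeasure L H)) ∧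
      waveEigenvalue L H * (∫ x, u x ^ 2 ∂(channelMeasure L H)) +
        shearEigenvalue H * (∫ x, n x ^ 2 ∂(channelMeasure L H)) +
        gapConst L H * (∫ x, (u x - waveMode L H A B x) ^ 2 ∂(channelMeasure L H)) +
        gapConst L H * (∫ x, (n x - shearMode H C D x) ^ 2 ∂(channelMeasure L H)) ≤
        ∫ x, (χ₁ x ^ 2 + χ₂ x ^ 2) ∂(channelMeasure L H) := by
  have cχ := hχ.cont
  have cχ1 := hχ.cont1
  have cχ2 := hχ.cont2
  have hm := hχ.xmean hL hH
  have cm : Continuous (PeriodicChannel.xmean L χ) := continuous_xmean cχ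
  have cm2 : Continuous (PeriodicChannel.xmean L χ₂) := continuous_xmean cχ2
  have m0 : PeriodicChannel.xmean L χ 0 = 0 := by simp [PeriodicChannel.xmean, h0]
  have mH : PeriodicChannel.xmean L χ H = 0 := by simp [PeriodicChannel.xmean, hH0]
  set u : ℝ × ℝ → ℝ := fun x => χ x - PeriodicChannel.xmean L χ x.2 with hu
  have gu : HasGrad L H u χ₁ (fun x => χ₂ x - PeriodicChannel.xmean L χ₂ x.2) :=
    (hχ.sub hm).congr_grad (by simp) rfl
  have cu := gu.cont
  have um : ∀ y ∈ Icc 0 H, ∫ x in (0 : ℝ)..L, u (x, y) = 0 := fun y _ => integral_sub_xmean hL hH cχ y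
  obtain ⟨A, B, hAB⟩ := wave_gap hL hH gu (fun s => by simp [hu, h0, m0])
    (fun s => by simp [hu, hH0, mH]) um
  set N : ℝ → ℝ := shearPart L H χ with hN
  have cN : Continuous N := cm.sub continuous_const
  have hnm := integral_shearPart hL hH cχ
  have ndiv : ∀ y ∈ Ioo 0 H, HasDerivWithinAt N (PeriodicChannel.xmean L χ₂ y) (Ioi y) y := fun y hy => by
    have := (hm.hasDerivWithinAt_snd (x := 0) (Ioo_subset_Icc_self hy)).hasDerivAt
      (Icc_mem_nhds hy.1 hy.2)
    exact (this.sub_const _).hasDerivWithinAt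
  -- The average of χ along the channel takes the same value at both walls, so it counts as periodic
  -- in x₂ with period H. Hence the constant (2π/H)² for the shear part.
  have w := wirtinger_periodic_gap hH cN cm2 ndiv (by simp [hN, shearPart, m0, mH]) hnm
  have bes := bessel_periodic hH cN
  have besle := bessel_periodic_le hH cN
  set γ := ∫ x in (0 : ℝ)..H, N x * Real.cos (2 * Real.pi / H * x) with hγ
  set θ := ∫ x in (0 : ℝ)..H, N x * Real.sin (2 * Real.pi / H * x) with hθ
  have iN : ∫ x : ℝ × ℝ, N x.2 ^ 2 ∂(channelMeasure L H) = L * ∫ y in (0 : ℝ)..H, N y ^ 2 :=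
    integral_channel_snd hL hH (b := fun y => N y ^ 2) (by fun_prop)
  have iM : ∫ x : ℝ × ℝ, PeriodicChannel.xmean L χ₂ x.2 ^ 2 ∂(channelMeasure L H) =
      L * ∫ y in (0 : ℝ)..H, PeriodicChannel.xmean L χ₂ y ^ 2 :=
    integral_channel_snd hL hH (b := fun y => PeriodicChannel.xmean L χ₂ y ^ 2) (by fun_prop)
  have iNs : ∫ x : ℝ × ℝ, (N x.2 - shearMode H (2 / H * γ) (2 / H * θ) x) ^ 2 ∂(channelMeasure L H) =
      L * ((∫ y in (0 : ℝ)..H, N y ^ 2) - 2 / H * (γ ^ 2 + θ ^ 2)) := by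
    rw [← bes]
    exact integral_channel_snd hL hH (b := fun y => (N y - (2 / H * γ * Real.cos (2 * Real.pi / H * y)
      + 2 / H * θ * Real.sin (2 * Real.pi / H * y))) ^ 2) (by fun_prop)
  have dec : ∀ x, χ x - channelMean L H χ = u x + N x.2 := fun x => by
    simp only [hu, hN, shearPart]; ring
  refine ⟨u, fun x => N x.2, cu, by fun_prop, A, B, 2 / H * γ, 2 / H * θ, dec, ?_, ?_⟩
  · simp_rw [dec]
    exact integral_sq_add_snd hL hH cu um cN
  · have split : ∫ x, χ₂ x ^ 2 ∂(channelMeasure L H) =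
        (∫ x, (χ₂ x - PeriodicChannel.xmean L χ₂ x.2) ^ 2 ∂(channelMeasure L H)) +
        ∫ x : ℝ × ℝ, PeriodicChannel.xmean L χ₂ x.2 ^ 2 ∂(channelMeasure L H) := by
      rw [← integral_sq_add_snd hL hH (u := fun x => χ₂ x - PeriodicChannel.xmean L χ₂ x.2) (by fun_prop)
        (fun y _ => integral_sub_xmean hL hH cχ2 y) cm2]
      congr 1; ext x; simp only [sub_add_cancel]
    rw [channel_add hL hH (f := fun x => χ₁ x ^ 2) (g := fun x => χ₂ x ^ 2) (by fun_prop) (by fun_prop),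
      split, iM, iN, iNs]
    rw [channel_add hL hH (f := fun x => χ₁ x ^ 2)
      (g := fun x => (χ₂ x - PeriodicChannel.xmean L χ₂ x.2) ^ 2) (by fun_prop) (by fun_prop)] at hAB
    have hgap : gapConst L H ≤ 3 * (2 * Real.pi / H) ^ 2 := by
      have : gapConst L H ≤ 3 * (Real.pi / H) ^ 2 := by
        unfold gapConst; exact mul_le_mul_of_nonneg_left (min_le_right _ _) (by norm_num)
      have h4 : (2 * Real.pi / H) ^ 2 = 4 * (Real.pi / H) ^ 2 := by ring
      rw [h4]; nlinarith [sq_nonneg (Real.pi / H)]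
    have t1 := mul_le_mul_of_nonneg_right hgap (sub_nonneg.2 besle)
    have w' : shearEigenvalue H * (∫ y in (0 : ℝ)..H, N y ^ 2) +
        gapConst L H * ((∫ y in (0 : ℝ)..H, N y ^ 2) - 2 / H * (γ ^ 2 + θ ^ 2)) ≤
        ∫ y in (0 : ℝ)..H, PeriodicChannel.xmean L χ₂ y ^ 2 := by
      have s1 : 6 * (2 * Real.pi / H) ^ 2 / H * (γ ^ 2 + θ ^ 2) =
        3 * (2 * Real.pi / H) ^ 2 * (2 / H * (γ ^ 2 + θ ^ 2)) := by ring
      rw [s1] at w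
      have : shearEigenvalue H = (2 * Real.pi / H) ^ 2 := rfl
      rw [this]
      linarith
    have := mul_le_mul_of_nonneg_left w' hL.le
    linarith

end

/-! ### The two-dimensional Sobolev inequality. -/

theorem channel_mono {L H : ℝ} {f g : ℝ × ℝ → ℝ} (hf : Continuous f) (hg : Continuous g)
    (h : ∀ x ∈ strip H, f x ≤ g x) :
    ∫ x, f x ∂(channelMeasure L H) ≤ ∫ x, g x ∂(channelMeasure L H) :=
  integral_mono_ae (integrable_channel L H hf) (integrable_channel L H hg) (ae_channelMeasure h)

/-- The quadratic polynomial t ↦ ∫(f - t g)² is nonnegative, so its discriminant is not positive. -/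
theorem channel_cauchy_schwarz {L H : ℝ} {f g : ℝ × ℝ → ℝ} (hf : Continuous f) (hg : Continuous g) :
    (∫ x, f x * g x ∂(channelMeasure L H)) ^ 2 ≤
      (∫ x, f x ^ 2 ∂(channelMeasure L H)) * ∫ x, g x ^ 2 ∂(channelMeasure L H) := by
  have h : ∀ t : ℝ, 0 ≤ (∫ x, g x ^ 2 ∂(channelMeasure L H)) * (t * t) +
      (-2 * ∫ x, f x * g x ∂(channelMeasure L H)) * t + ∫ x, f x ^ 2 ∂(channelMeasure L H) := fun t => by
    have e := channel_sq_sub_two (L := L) (H := H) hf hg (e₂ := fun _ => 0) continuous_const t 0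
    have : 0 ≤ ∫ x, (f x - (t * g x + 0 * 0)) ^ 2 ∂(channelMeasure L H) :=
      integral_nonneg fun x => sq_nonneg _
    rw [e] at this
    simp only [mul_zero, integral_zero, ne_eq, OfNat.ofNat_ne_zero, not_false_eq_true, zero_pow,
      sub_zero, add_zero] at this
    linarith
  have := discrim_le_zero h
  unfold discrim at this
  linarith

section
variable {L H : ℝ} (hL : 0 < L) (hH : 0 < H)
include hL hH

/-- The Ladyzhenskaya-type inequality behind the two-dimensional Sobolev embedding. -/
theorem integral_sq_le_mul_gradient {w w₁ w₂ : ℝ × ℝ → ℝ} (hw : HasGrad L H w w₁ w₂)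
    (h0 : ∀ s, w (s, 0) = 0) :
    ∫ x, w x ^ 2 ∂(channelMeasure L H) ≤ (∫ x, |w₂ x| ∂(channelMeasure L H)) *
      ((∫ x, |w₁ x| ∂(channelMeasure L H)) + H / L * ∫ x, |w₂ x| ∂(channelMeasure L H)) := by
  have cw := hw.cont
  have cw1 := hw.cont1
  have cw2 := hw.cont2
  have ii : ∀ {g : ℝ → ℝ} {a b : ℝ}, Continuous g → IntervalIntegrable g volume a b :=
    fun hg => hg.intervalIntegrable _ _
  set a : ℝ → ℝ := fun x => ∫ s in (0 : ℝ)..H, |w₂ (x, s)| with ha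
  set b₁ : ℝ → ℝ := fun y => ∫ s in (0 : ℝ)..L, |w₁ (s, y)| with hb₁
  set b₂ : ℝ → ℝ := fun y => ∫ s in (0 : ℝ)..L, |w (s, y)| with hb₂
  have ca : Continuous a := continuous_integral_snd (f := fun z => |w₂ z|) (by fun_prop) 0 H
  have cb1 : Continuous b₁ := continuous_integral_fst (f := fun z => |w₁ z|) (by fun_prop) 0 L
  have cb2 : Continuous b₂ := continuous_integral_fst (f := fun z => |w z|) (by fun_prop) 0 L
  have bound : ∀ {g : ℝ → ℝ} {T s t : ℝ}, Continuous g → 0 ≤ s → s ≤ t → t ≤ T →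
      |∫ z in s..t, g z| ≤ ∫ z in (0 : ℝ)..T, |g z| := fun {g T s t} hg hs hst htT => by
    refine (intervalIntegral.abs_integral_le_integral_abs hst).trans ?_
    exact intervalIntegral.integral_mono_interval hs hst htT (ae_of_all _ fun _ => abs_nonneg _)
      (ii (by fun_prop))
  -- w is bounded by a function of x₁ alone and, in `wb`, by a function of x₂ alone; the product of
  -- the two bounds integrates to a product.
  have wa : ∀ x, ∀ y ∈ Icc 0 H, |w (x, y)| ≤ a x := fun x y hy => by
    have ftc : ∫ s in (0 : ℝ)..y, w₂ (x, s) = w (x, y) - w (x, 0) := by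
      refine intervalIntegral.integral_eq_sub_of_hasDeriv_right_of_le hy.1
        (f := fun s => w (x, s)) (by fun_prop) (fun s hs => ?_) (ii (by fun_prop))
      exact ((hw.hasDerivWithinAt_snd (x := x) ⟨hs.1.le, hs.2.le.trans hy.2⟩).hasDerivAt
        (Icc_mem_nhds hs.1 (hs.2.trans_le hy.2))).hasDerivWithinAt
    rw [h0, sub_zero] at ftc
    rw [← ftc]
    exact bound (g := fun s => w₂ (x, s)) (by fun_prop) le_rfl hy.1 hy.2
  -- No vanishing is available along x₁, so the value is compared with all values on the same
  -- horizontal line and averaged. The average is absorbed in `J0` by the vanishing at the bottom.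
  have wb : ∀ y ∈ Icc 0 H, ∀ x ∈ Icc 0 L, |w (x, y)| ≤ b₁ y + 1 / L * b₂ y := fun y hy x hx => by
    have step : ∀ z ∈ Icc 0 L, |w (x, y)| ≤ |w (z, y)| + b₁ y := fun z hz => by
      have ftc : ∀ p q, ∫ s in p..q, w₁ (s, y) = w (q, y) - w (p, y) := fun p q =>
        intervalIntegral.integral_eq_sub_of_hasDerivAt (f := fun s => w (s, y))
          (fun s _ => hw.hasDerivAt_fst hy) (ii (by fun_prop))
      have hle : |w (x, y) - w (z, y)| ≤ b₁ y := by
        rcases le_total z x with h | h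
        · rw [← ftc]; exact bound (g := fun s => w₁ (s, y)) (by fun_prop) hz.1 h hx.2
        · rw [abs_sub_comm, ← ftc]; exact bound (g := fun s => w₁ (s, y)) (by fun_prop) hx.1 h hz.2
      have := abs_sub_abs_le_abs_sub (w (x, y)) (w (z, y))
      linarith
    have := intervalIntegral.integral_mono_on hL.le (ii continuous_const)
      (ii (g := fun z => |w (z, y)| + b₁ y) (by fun_prop)) step
    rw [intervalIntegral.integral_add (ii (by fun_prop)) (ii (by fun_prop))] at this
    simp only [intervalIntegral.integral_const, sub_zero, smul_eq_mul] at this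
    have h2 : L * |w (x, y)| ≤ L * (b₁ y + 1 / L * b₂ y) := by
      have : L * (b₁ y + 1 / L * b₂ y) = b₂ y + L * b₁ y := by field_simp; ring
      rw [this]; linarith
    exact le_of_mul_le_mul_left h2 hL
  have J1 : ∫ x, |w₁ x| ∂(channelMeasure L H) = ∫ y in (0 : ℝ)..H, b₁ y :=
    integral_channel_swap hL hH (f := fun z => |w₁ z|) (by fun_prop)
  have J2 : ∫ x, |w₂ x| ∂(channelMeasure L H) = ∫ x in (0 : ℝ)..L, a x :=
    integral_channel hL hH (f := fun z => |w₂ z|) (by fun_prop)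
  have J0 : ∫ y in (0 : ℝ)..H, b₂ y ≤ H * ∫ x in (0 : ℝ)..L, a x := by
    have : ∫ y in (0 : ℝ)..H, b₂ y = ∫ x in (0 : ℝ)..L, ∫ y in (0 : ℝ)..H, |w (x, y)| := by
      rw [← integral_channel hL hH (f := fun z => |w z|) (by fun_prop)]
      exact (integral_channel_swap hL hH (f := fun z => |w z|) (by fun_prop)).symm
    rw [this, ← intervalIntegral.integral_const_mul]
    refine intervalIntegral.integral_mono_on hL.le
      (ii (continuous_integral_snd (f := fun z => |w z|) (by fun_prop) 0 H)) (ii (by fun_prop)) fun x _ => ?_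
    have := intervalIntegral.integral_mono_on hH.le (ii (g := fun y => |w (x, y)|) (by fun_prop))
      (ii continuous_const) (wa x)
    simpa using this
  have a0 : ∀ x, 0 ≤ a x := fun x => intervalIntegral.integral_nonneg hH.le fun _ _ => abs_nonneg _
  have I0 : 0 ≤ ∫ x in (0 : ℝ)..L, a x := intervalIntegral.integral_nonneg hL.le fun _ _ => a0 _
  have main : ∫ x, w x ^ 2 ∂(channelMeasure L H) ≤
      (∫ x in (0 : ℝ)..L, a x) * ∫ y in (0 : ℝ)..H, (b₁ y + 1 / L * b₂ y) := by
    rw [← integral_channel_mul hL hH ca (b := fun y => b₁ y + 1 / L * b₂ y) (by fun_prop),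
      channelMeasure]
    have cc : Continuous (fun x : ℝ × ℝ => a x.1 * (b₁ x.2 + 1 / L * b₂ x.2)) := by fun_prop
    refine integral_mono_ae (integrable_channel L H (by fun_prop)) (integrable_channel L H cc) ?_
    refine (ae_restrict_iff' (measurableSet_Ioc.prod measurableSet_Ioo)).2 (ae_of_all _ fun x hx => ?_)
    have hx2 := Ioo_subset_Icc_self hx.2
    have hx1 := Ioc_subset_Icc_self hx.1
    simp only
    rw [← sq_abs, sq]
    exact mul_le_mul (wa x.1 x.2 hx2) (wb x.2 hx2 x.1 hx1) (abs_nonneg _) (a0 _)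
  rw [J1, J2]
  refine main.trans (mul_le_mul_of_nonneg_left ?_ I0)
  rw [intervalIntegral.integral_add (ii cb1) (ii (by fun_prop)), intervalIntegral.integral_const_mul]
  have := mul_le_mul_of_nonneg_left J0 (show 0 ≤ 1 / L by positivity)
  have e : H / L * ∫ x in (0 : ℝ)..L, a x = 1 / L * (H * ∫ x in (0 : ℝ)..L, a x) := by ring
  linarith

/-- Induction on n: the Ladyzhenskaya-type inequality for χ^(n+1), whose gradient is (n+1)χⁿ∇χ, and
Cauchy–Schwarz raise the exponent by 2 at the cost of one factor ∫|∇χ|². -/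
theorem sobolev_even (n : ℕ) : ∃ C : ℝ, 0 ≤ C ∧ ∀ χ χ₁ χ₂ : ℝ × ℝ → ℝ, HasGrad L H χ χ₁ χ₂ →
    (∀ s, χ (s, 0) = 0) → ∫ x, χ x ^ (2 * n) ∂(channelMeasure L H) ≤
      C * (∫ x, (χ₁ x ^ 2 + χ₂ x ^ 2) ∂(channelMeasure L H)) ^ n := by
  induction n with
  | zero => exact ⟨∫ x, 1 ∂(channelMeasure L H), integral_nonneg fun _ => zero_le_one, fun χ _ _ _ _ => by simp⟩
  | succ n ih =>
    obtain ⟨C, hC, ih⟩ := ih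
    refine ⟨(n + 1) ^ 2 * (1 + H / L) * C, by positivity, fun χ χ₁ χ₂ hχ h0 => ?_⟩
    have cχ := hχ.cont
    have cχ1 := hχ.cont1
    have cχ2 := hχ.cont2
    have gw : HasGrad L H (fun x => χ x ^ (n + 1)) (fun x => (n + 1) * χ x ^ n * χ₁ x)
        (fun x => (n + 1) * χ x ^ n * χ₂ x) :=
      hχ.comp (Φ := fun s => s ^ (n + 1)) (Φ' := fun s => (n + 1) * s ^ n)
        (fun s => by simpa using hasDerivAt_pow (n + 1) s) (by fun_prop)
    have key := integral_sq_le_mul_gradient hL hH gw (fun s => by simp [h0])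
    set I := ∫ x, χ x ^ (2 * n) ∂(channelMeasure L H) with hI
    set G := ∫ x, (χ₁ x ^ 2 + χ₂ x ^ 2) ∂(channelMeasure L H) with hG
    have hG0 : 0 ≤ G := integral_nonneg fun x => by positivity
    have hI0 : 0 ≤ I := integral_nonneg fun x => by simp only [pow_mul]; positivity
    have cs : ∀ v : ℝ × ℝ → ℝ, Continuous v → (∀ x, v x ^ 2 ≤ χ₁ x ^ 2 + χ₂ x ^ 2) →
        (∫ x, |(n + 1) * χ x ^ n * v x| ∂(channelMeasure L H)) ^ 2 ≤ (n + 1) ^ 2 * (I * G) := by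
      intro v hv hvle
      have e : ∀ x, |(n + 1) * χ x ^ n * v x| = (n + 1) * (|χ x ^ n| * |v x|) := fun x => by
        rw [abs_mul, abs_mul, abs_of_nonneg (by positivity : (0:ℝ) ≤ n + 1)]; ring
      simp_rw [e]
      rw [integral_const_mul, mul_pow]
      refine mul_le_mul_of_nonneg_left ?_ (by positivity)
      refine (channel_cauchy_schwarz (f := fun x => |χ x ^ n|) (g := fun x => |v x|) (by fun_prop)
        (by fun_prop)).trans ?_
      have e1 : ∫ x, |χ x ^ n| ^ 2 ∂(channelMeasure L H) = I := by
        rw [hI]; congr 1; ext x; rw [sq_abs, ← pow_mul, mul_comm]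
      rw [e1]
      refine mul_le_mul_of_nonneg_left ?_ hI0
      exact channel_mono (by fun_prop) (by fun_prop) fun x _ => by rw [sq_abs]; exact hvle x
    have c1 := cs χ₁ cχ1 fun x => by nlinarith [sq_nonneg (χ₂ x)]
    have c2 := cs χ₂ cχ2 fun x => by nlinarith [sq_nonneg (χ₁ x)]
    set J1 := ∫ x, |(n + 1) * χ x ^ n * χ₁ x| ∂(channelMeasure L H)
    set J2 := ∫ x, |(n + 1) * χ x ^ n * χ₂ x| ∂(channelMeasure L H)
    have e2 : ∫ x, χ x ^ (2 * (n + 1)) ∂(channelMeasure L H) =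
        ∫ x, (χ x ^ (n + 1)) ^ 2 ∂(channelMeasure L H) := by
      congr 1; ext x; rw [← pow_mul, mul_comm]
    rw [e2]
    have hJ : J1 * J2 ≤ (n + 1) ^ 2 * (I * G) := by nlinarith [sq_nonneg (J1 - J2)]
    have hHL : 0 ≤ H / L := by positivity
    calc _ ≤ J2 * (J1 + H / L * J2) := key
      _ = J1 * J2 + H / L * J2 ^ 2 := by ring
      _ ≤ (n + 1) ^ 2 * (I * G) + H / L * ((n + 1) ^ 2 * (I * G)) :=
        add_le_add hJ (mul_le_mul_of_nonneg_left c2 hHL)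
      _ = (n + 1) ^ 2 * (1 + H / L) * (I * G) := by ring
      _ ≤ (n + 1) ^ 2 * (1 + H / L) * (C * G ^ n * G) := by
        refine mul_le_mul_of_nonneg_left (mul_le_mul_of_nonneg_right (ih χ χ₁ χ₂ hχ h0) hG0) (by positivity)
      _ = _ := by ring

/-- Hölder's inequality and `sobolev_even`. As n grows, r tends to 1, which is what makes every p >
1 admissible in the end. -/
theorem sobolev_dual {n : ℕ} (hn : n ≠ 0) {r : ℝ} (hr : r.HolderConjugate (2 * n)) :
    ∃ C : ℝ, 0 ≤ C ∧ ∀ χ χ₁ χ₂ f : ℝ × ℝ → ℝ, HasGrad L H χ χ₁ χ₂ →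
    (∀ s, χ (s, 0) = 0) → Continuous f → |∫ x, f x * χ x ∂(channelMeasure L H)| ≤
      C * (∫ x, |f x| ^ r ∂(channelMeasure L H)) ^ (1 / r) *
        √(∫ x, (χ₁ x ^ 2 + χ₂ x ^ 2) ∂(channelMeasure L H)) := by
  obtain ⟨C, hC, h⟩ := sobolev_even hL hH n
  refine ⟨C ^ (1 / (2 * n : ℝ)), by positivity, fun χ χ₁ χ₂ f hχ h0 hf => ?_⟩
  have cχ := hχ.cont
  set G := ∫ x, (χ₁ x ^ 2 + χ₂ x ^ 2) ∂(channelMeasure L H) with hG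
  have hG0 : 0 ≤ G := integral_nonneg fun x => by positivity
  have mem : ∀ (g : ℝ × ℝ → ℝ) (s : ℝ), Continuous g →
      MemLp (fun x => |g x|) (ENNReal.ofReal s) (channelMeasure L H) := fun g s hg => by
    obtain ⟨K, hK⟩ := ((isCompact_Icc (a := (0:ℝ)) (b := L)).prod
      (isCompact_Icc (a := (0:ℝ)) (b := H))).exists_bound_of_continuousOn
      (f := fun x => |g x|) (by fun_prop)
    refine MemLp.of_bound (Continuous.aestronglyMeasurable (by fun_prop)) K ?_
    refine (ae_restrict_iff' (measurableSet_Ioc.prod measurableSet_Ioo)).2 (ae_of_all _ fun x hx => ?_)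
    exact hK x ⟨Ioc_subset_Icc_self hx.1, Ioo_subset_Icc_self hx.2⟩
  have hol := integral_mul_le_Lp_mul_Lq_of_nonneg (μ := channelMeasure L H) hr
    (f := fun x => |f x|) (g := fun x => |χ x|) (ae_of_all _ fun _ => abs_nonneg _)
    (ae_of_all _ fun _ => abs_nonneg _) (mem f _ hf) (mem χ _ cχ)
  have e1 : ∫ x, |χ x| ^ (2 * n : ℝ) ∂(channelMeasure L H) = ∫ x, χ x ^ (2 * n) ∂(channelMeasure L H) := by
    congr 1; ext x
    have : ((2 * n : ℝ)) = ((2 * n : ℕ) : ℝ) := by push_cast; ring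
    rw [this, Real.rpow_natCast, pow_mul, sq_abs, ← pow_mul]
  rw [e1] at hol
  have hI0 : 0 ≤ ∫ x, χ x ^ (2 * n) ∂(channelMeasure L H) :=
    integral_nonneg fun x => by simp only [pow_mul]; positivity
  have e2 : (∫ x, χ x ^ (2 * n) ∂(channelMeasure L H)) ^ (1 / (2 * n : ℝ)) ≤
      C ^ (1 / (2 * n : ℝ)) * √G := by
    refine (Real.rpow_le_rpow hI0 (h χ χ₁ χ₂ hχ h0) (by positivity)).trans_eq ?_
    rw [Real.mul_rpow hC (by positivity), ← Real.rpow_natCast, ← Real.rpow_mul hG0,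
      Real.sqrt_eq_rpow]
    congr 2
    have : (n : ℝ) ≠ 0 := by exact_mod_cast hn
    field_simp
  calc |∫ x, f x * χ x ∂(channelMeasure L H)| ≤ ∫ x, |f x * χ x| ∂(channelMeasure L H) :=
        abs_integral_le_integral_abs
    _ = ∫ x, |f x| * |χ x| ∂(channelMeasure L H) := by simp_rw [abs_mul]
    _ ≤ _ := hol
    _ ≤ (∫ x, |f x| ^ r ∂(channelMeasure L H)) ^ (1 / r) * (C ^ (1 / (2 * n : ℝ)) * √G) :=
        mul_le_mul_of_nonneg_left e2 (Real.rpow_nonneg (integral_nonneg fun x => Real.rpow_nonneg (abs_nonneg _) _) _)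
    _ = _ := by ring

end

/-! ### The extremal modes and the first eigenvalue. -/

section modes

theorem hasDerivAt_trig (A B k s : ℝ) :
    HasDerivAt (fun s => A * Real.cos (k * s) + B * Real.sin (k * s))
      ((B * k) * Real.cos (k * s) + (-A * k) * Real.sin (k * s)) s := by
  have h1 : HasDerivAt (fun s : ℝ => k * s) k s := by simpa using (hasDerivAt_id s).const_mul k
  refine ((h1.cos.const_mul A).add (h1.sin.const_mul B)).congr_deriv ?_
  ring

theorem trig_period {L : ℝ} (hL : 0 < L) (A B s : ℝ) :
    A * Real.cos (2 * Real.pi / L * (s + L)) + B * Real.sin (2 * Real.pi / L * (s + L)) =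
      A * Real.cos (2 * Real.pi / L * s) + B * Real.sin (2 * Real.pi / L * s) := by
  have : 2 * Real.pi / L * (s + L) = 2 * Real.pi / L * s + 2 * Real.pi := by field_simp
  rw [this, Real.cos_add_two_pi, Real.sin_add_two_pi]

theorem HasGrad.trig_fst {L H : ℝ} (hL : 0 < L) (A B : ℝ) :
    HasGrad L H (fun x => A * Real.cos (2 * Real.pi / L * x.1) + B * Real.sin (2 * Real.pi / L * x.1))
      (fun x => (B * (2 * Real.pi / L)) * Real.cos (2 * Real.pi / L * x.1) +
        (-A * (2 * Real.pi / L)) * Real.sin (2 * Real.pi / L * x.1)) (fun _ => 0) :=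
  HasGrad.of_fst (a := fun s => A * Real.cos (2 * Real.pi / L * s) + B * Real.sin (2 * Real.pi / L * s))
    (a' := fun s => (B * (2 * Real.pi / L)) * Real.cos (2 * Real.pi / L * s) +
        (-A * (2 * Real.pi / L)) * Real.sin (2 * Real.pi / L * s)) (by fun_prop)
    (fun s => hasDerivAt_trig A B _ s) (fun s => trig_period hL A B s)

theorem HasGrad.trig_snd (L H A B k : ℝ) :
    HasGrad L H (fun x => A * Real.cos (k * x.2) + B * Real.sin (k * x.2)) (fun _ => 0)
      (fun x => (B * k) * Real.cos (k * x.2) + (-A * k) * Real.sin (k * x.2)) :=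
  HasGrad.of_snd (a := fun s => A * Real.cos (k * s) + B * Real.sin (k * s))
    (a' := fun s => (B * k) * Real.cos (k * s) + (-A * k) * Real.sin (k * s)) (by fun_prop)
    (by fun_prop) (fun s _ => (hasDerivAt_trig A B _ s).hasDerivWithinAt)

theorem exists_hasHess_waveMode {L H : ℝ} (hL : 0 < L) (A B : ℝ) : ∃ f₁ f₂ f₁₁ f₁₂ f₂₁ f₂₂,
    HasHess L H (waveMode L H A B) f₁ f₂ f₁₁ f₁₂ f₂₁ f₂₂ ∧
    ∀ x, -(f₁₁ x + f₂₂ x) = waveEigenvalue L H * waveMode L H A B x := by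
  set k := 2 * Real.pi / L with hk
  set κ := Real.pi / H with hκ
  have S : ∀ a b : ℝ, HasGrad L H (fun x => a * Real.cos (κ * x.2) + b * Real.sin (κ * x.2)) (fun _ => 0)
      (fun x => (b * κ) * Real.cos (κ * x.2) + (-a * κ) * Real.sin (κ * x.2)) :=
    fun a b => HasGrad.trig_snd L H a b κ
  have P := fun a b => HasGrad.trig_fst (H := H) hL a b
  rw [← hk] at P
  have h0 := (S 0 1).mul (P A B)
  have h1 := (S 0 1).mul (P (B * k) (-A * k))
  have h2 := (S (1 * κ) (-0 * κ)).mul (P A B)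
  have e0 : (fun x : ℝ × ℝ => (0 * Real.cos (κ * x.2) + 1 * Real.sin (κ * x.2)) *
    (A * Real.cos (k * x.1) + B * Real.sin (k * x.1))) = waveMode L H A B := by
    ext x; simp [waveMode, ← hk, ← hκ]
  rw [e0] at h0
  refine ⟨_, _, _, _, _, _, ⟨h0.congr_grad ?_ ?_, h1, h2⟩, ?_⟩
  · ext x; ring
  · ext x; ring
  · intro x; simp only [waveMode, waveEigenvalue, ← hk, ← hκ]; ring

theorem exists_hasHess_shearMode (L H C D : ℝ) : ∃ f₁ f₂ f₁₁ f₁₂ f₂₁ f₂₂,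
    HasHess L H (shearMode H C D) f₁ f₂ f₁₁ f₁₂ f₂₁ f₂₂ ∧
    ∀ x, -(f₁₁ x + f₂₂ x) = shearEigenvalue H * shearMode H C D x := by
  refine ⟨_, _, _, _, _, _, ⟨HasGrad.trig_snd L H C D (2 * Real.pi / H), HasGrad.const L H 0,
    HasGrad.trig_snd L H _ _ (2 * Real.pi / H)⟩, fun x => ?_⟩
  simp only [shearMode, shearEigenvalue]; ring

end modes

section
variable {L H : ℝ} (hL : 0 < L) (hH : 0 < H)
include hL hH

theorem isC2_waveMode (A B : ℝ) : IsC2 L H (waveMode L H A B) := by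
  refine ⟨fun x _ => ?_, ContDiff.contDiffOn (by unfold waveMode; fun_prop)⟩
  simp only [waveMode]; rw [trig_period hL]

theorem isC2_shearMode (C D : ℝ) : IsC2 L H (shearMode H C D) :=
  ⟨fun _ _ => rfl, ContDiff.contDiffOn (by unfold shearMode; fun_prop)⟩

theorem neg_lap_waveMode (A B : ℝ) {x : ℝ × ℝ} (hx : x ∈ strip H) :
    -lap (waveMode L H A B) x = waveEigenvalue L H * waveMode L H A B x := by
  obtain ⟨_, _, _, _, _, _, h, e⟩ := exists_hasHess_waveMode (H := H) hL A B
  rw [h.lap_eq hx, e]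

theorem integral_trig_fst (A B : ℝ) : ∫ x in (0 : ℝ)..L, (A * Real.cos (2 * Real.pi / L * x) +
    B * Real.sin (2 * Real.pi / L * x)) = 0 := by
  rw [intervalIntegral.integral_add (Continuous.intervalIntegrable (by fun_prop) _ _)
    (Continuous.intervalIntegrable (by fun_prop) _ _), intervalIntegral.integral_const_mul,
    intervalIntegral.integral_const_mul, integral_cos_period hL, integral_sin_period hL]
  simp

theorem integral_waveMode_fst (A B y : ℝ) : ∫ x in (0 : ℝ)..L, waveMode L H A B (x, y) = 0 := by
  unfold waveMode
  simp only
  rw [intervalIntegral.integral_const_mul, integral_trig_fst hL hH, mul_zero]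

theorem integral_waveMode (A B : ℝ) : ∫ x, waveMode L H A B x ∂(channelMeasure L H) = 0 := by
  rw [integral_channel_swap hL hH (by fun_prop)]
  simp [integral_waveMode_fst hL hH]

theorem waveMode_zero (A B s : ℝ) : waveMode L H A B (s, 0) = 0 := by simp [waveMode]

theorem waveMode_top (A B s : ℝ) : waveMode L H A B (s, H) = 0 := by
  have : Real.pi / H * H = Real.pi := by field_simp
  simp [waveMode, this]

theorem waveMode_mem_eigenspace (A B : ℝ) : waveMode L H A B ∈ eigenspace L H (waveEigenvalue L H) :=
  ⟨isC2_waveMode hL hH A B, fun _ hx => neg_lap_waveMode hL hH A B hx,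
    ⟨0, fun s => ⟨waveMode_zero hL hH A B s, waveMode_top hL hH A B s⟩⟩, integral_waveMode hL hH A B⟩

theorem waveMode_zero_zero : waveMode L H 0 0 = fun _ => 0 := by ext x; simp [waveMode]

/-- Supplies the eigenfunction component when the first eigenvalue is strictly below
`waveEigenvalue` and the solution turns out to be a pure shear flow. -/
theorem waveMode_zero_mem_eigenspace (Λ : ℝ) : waveMode L H 0 0 ∈ eigenspace L H Λ := by
  have h := waveMode_mem_eigenspace hL hH 0 0
  refine ⟨h.1, fun x hx => ?_, h.2.2⟩
  rw [h.2.1 x hx, waveMode_zero_zero hL hH]; simp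

theorem shearMode_mem_eigenspace (C D : ℝ) : shearMode H C D ∈ eigenspace L H (shearEigenvalue H) := by
  refine ⟨isC2_shearMode hL hH C D, fun x hx => ?_, ⟨C, fun s => ?_⟩, ?_⟩
  · obtain ⟨_, _, _, _, _, _, h, e⟩ := exists_hasHess_shearMode L H C D
    rw [h.lap_eq hx, e]
  · have : 2 * Real.pi / H * H = 2 * Real.pi := by field_simp
    simp [shearMode, this]
  · unfold shearMode
    rw [integral_channel_snd hL hH (b := fun s => C * Real.cos (2 * Real.pi / H * s) +
      D * Real.sin (2 * Real.pi / H * s)) (by fun_prop), integral_trig_fst hH hL, mul_zero]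

/-- A nonnegative continuous function on the channel whose integral vanishes is zero. -/
theorem eq_zero_of_integral_eq_zero {f : ℝ × ℝ → ℝ} (hf : Continuous f) (hp : ∀ x y, f (x + L, y) = f (x, y))
    (h0 : ∀ x, 0 ≤ f x) (hi : ∫ x, f x ∂(channelMeasure L H) ≤ 0) :
    ∀ x ∈ closedStrip H, f x = 0 := by
  have hi' : ∫ x, f x ∂(channelMeasure L H) = 0 := le_antisymm hi (integral_nonneg h0)
  rw [integral_eq_zero_iff_of_nonneg h0 (integrable_channel L H hf)] at hi'
  have h1 : f =ᵐ[volume.restrict (Ioo 0 L ×ˢ Ioo 0 H)] 0 :=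
    ae_mono (Measure.restrict_mono (Set.prod_mono Ioo_subset_Ioc_self le_rfl) le_rfl) hi'
  have h2 : EqOn f 0 (Ioo 0 L ×ˢ Ioo 0 H) :=
    Measure.eqOn_open_of_ae_eq h1 (isOpen_Ioo.prod isOpen_Ioo) hf.continuousOn continuousOn_const
  have h3 : EqOn f 0 (closure (Ioo 0 L ×ˢ Ioo 0 H)) := h2.closure hf continuous_const
  rw [closure_prod_eq, closure_Ioo hL.ne, closure_Ioo hH.ne] at h3
  intro x hx
  obtain ⟨z, hz, hz'⟩ := Function.Periodic.exists_mem_Ico₀ (f := fun s => f (s, x.2))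
    (fun s => hp s x.2) hL x.1
  have : f x = f (z, x.2) := hz'
  rw [this]
  exact h3 ⟨Ico_subset_Icc_self hz, hx.2⟩

/-- Zero mean and the equation force the total flux of ∇u through the walls to vanish. As u has the
same constant c on both walls, the boundary terms of Green's identity cancel and ∫|∇u|² = Λ∫u². The
function u - c vanishes on the walls and has mean -c, so `channel_gap` applied to it bounds ∫u²
itself. -/
theorem le_of_isEigenvalue {Λ : ℝ} (h : IsEigenvalue L H Λ) :
    min (waveEigenvalue L H) (shearEigenvalue H) ≤ Λ := by
  obtain ⟨u, ⟨hu, heq, ⟨c, hc⟩, hint⟩, x0, hx0, hne⟩ := h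
  obtain ⟨u₁, u₂, u₁₁, u₁₂, u₂₁, u₂₂, hh⟩ := hu.exists_hasHess hH
  set v : ℝ × ℝ → ℝ := fun x => u (clamp H x) with hv
  have cv := hh.grad.cont
  have hvu : ∀ x ∈ closedStrip H, v x = u x := fun x hx => by simp only [hv, clamp_of_mem hx]
  have heq' : ∀ x ∈ strip H, -(u₁₁ x + u₂₂ x) = Λ * v x := fun x hx => by
    rw [← hh.lap_eq hx, lap_congr (fun z hz => hvu z (strip_subset H hz)) hx, heq x hx,
      hvu x (strip_subset H hx)]
  have v0 : ∀ s, v (s, 0) = c := fun s => by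
    rw [hvu _ ⟨mem_univ _, le_rfl, hH.le⟩]; exact (hc s).1
  have vH : ∀ s, v (s, H) = c := fun s => by
    rw [hvu _ ⟨mem_univ _, hH.le, le_rfl⟩]; exact (hc s).2
  have vint : ∫ x, v x ∂(channelMeasure L H) = 0 := by
    rw [← hint]
    exact integral_congr_ae (ae_channelMeasure fun x hx => hvu x (strip_subset H hx))
  have flux := integral_divergence hL hH hh.grad1 hh.grad2
  have flux0 : ∫ x, (u₁₁ x + u₂₂ x) ∂(channelMeasure L H) = 0 := by
    have : ∫ x, (u₁₁ x + u₂₂ x) ∂(channelMeasure L H) = ∫ x, -Λ * v x ∂(channelMeasure L H) :=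
      integral_congr_ae (ae_channelMeasure fun x hx => by have := heq' x hx; simp only; linarith)
    rw [this, integral_const_mul, vint, mul_zero]
  rw [flux0] at flux
  have gr := green hL hH hh.grad hh v0 vH
  rw [← mul_sub, ← flux, mul_zero, add_zero] at gr
  have e1 : ∫ x, v x * (-(u₁₁ x + u₂₂ x)) ∂(channelMeasure L H) =
      Λ * ∫ x, v x ^ 2 ∂(channelMeasure L H) := by
    rw [← integral_const_mul]
    exact integral_congr_ae (ae_channelMeasure fun x hx => by simp only [heq' x hx]; ring)
  rw [e1] at gr
  have gχ : HasGrad L H (fun x => v x - c) u₁ u₂ :=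
    (hh.grad.sub (HasGrad.const L H c)).congr_grad (by simp) (by simp)
  obtain ⟨a, n, _, _, A, B, C, D, dec, hsq, hgap⟩ := channel_gap hL hH gχ (fun s => by simp [v0])
    (fun s => by simp [vH])
  have hmean : channelMean L H (fun x => v x - c) = -c := by
    unfold channelMean
    rw [integral_sub (integrable_channel L H cv) (integrable_const _), vint]
    have : (∫ _, c ∂(channelMeasure L H)) = L * H * c := by
      have := integral_channel_snd hL hH (continuous_const (y := c))
      rw [this]; simp; ring
    rw [this]; field_simp; ring
  rw [hmean] at hsq
  simp only [sub_neg_eq_add, sub_add_cancel] at hsq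
  have hV : 0 < ∫ x, v x ^ 2 ∂(channelMeasure L H) := by
    by_contra hcon
    have := eq_zero_of_integral_eq_zero hL hH (f := fun x => v x ^ 2) (by fun_prop)
      (fun x y => by simp only [hh.grad.per]) (fun x => sq_nonneg _) (not_lt.1 hcon) x0 hx0
    rw [hvu x0 hx0] at this
    exact hne (by simpa using this)
  have gr' : ∫ x, (u₁ x ^ 2 + u₂ x ^ 2) ∂(channelMeasure L H) = Λ * ∫ x, v x ^ 2 ∂(channelMeasure L H) := by
    rw [← gr]; congr 1; ext x; ring
  rw [gr'] at hgap
  have n1 : ∀ w : ℝ × ℝ → ℝ, 0 ≤ ∫ x, w x ^ 2 ∂(channelMeasure L H) := fun w => integral_nonneg fun x => sq_nonneg _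
  have hg := gapConst_pos hL hH
  have a1 := mul_nonneg hg.le (n1 fun x => a x - waveMode L H A B x)
  have a2 := mul_nonneg hg.le (n1 fun x => n x - shearMode H C D x)
  have b1 := mul_le_mul_of_nonneg_right (min_le_left (waveEigenvalue L H) (shearEigenvalue H)) (n1 a)
  have b2 := mul_le_mul_of_nonneg_right (min_le_right (waveEigenvalue L H) (shearEigenvalue H)) (n1 n)
  have : min (waveEigenvalue L H) (shearEigenvalue H) * ∫ x, v x ^ 2 ∂(channelMeasure L H) ≤
      Λ * ∫ x, v x ^ 2 ∂(channelMeasure L H) := by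
    rw [hsq] at hgap ⊢
    rw [mul_add]
    linarith
  exact le_of_mul_le_mul_right this hV

theorem isEigenvalue_wave : IsEigenvalue L H (waveEigenvalue L H) := by
  refine ⟨waveMode L H 1 0, waveMode_mem_eigenspace hL hH 1 0, (0, H / 2), ⟨mem_univ _, by positivity, by
    simp only; linarith⟩, ?_⟩
  have : Real.pi / H * (H / 2) = Real.pi / 2 := by field_simp
  simp [waveMode, this]

theorem isEigenvalue_shear : IsEigenvalue L H (shearEigenvalue H) := by
  refine ⟨shearMode H 1 0, shearMode_mem_eigenspace hL hH 1 0, (0, 0), ⟨mem_univ _, le_rfl, hH.le⟩, ?_⟩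
  simp [shearMode]

theorem firstEigenvalue_eq : firstEigenvalue L H = min (waveEigenvalue L H) (shearEigenvalue H) := by
  refine IsLeast.csInf_eq ⟨?_, fun Λ h => le_of_isEigenvalue hL hH h⟩
  rcases min_choice (waveEigenvalue L H) (shearEigenvalue H) with h | h <;> rw [h]
  · exact isEigenvalue_wave hL hH
  · exact isEigenvalue_shear hL hH

theorem firstEigenvalue_pos : 0 < firstEigenvalue L H := by
  rw [firstEigenvalue_eq hL hH, waveEigenvalue, shearEigenvalue]; positivity

end

/-! ### Solutions of the stream equation: a wave plus a shear flow. -/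

/-- `g` is nondecreasing and `Λ`-Lipschitz on `I`. -/
def SlopeBound (g : ℝ → ℝ) (I : Set ℝ) (Λ : ℝ) : Prop :=
  ∀ a ∈ I, ∀ b ∈ I, a ≤ b → 0 ≤ g b - g a ∧ g b - g a ≤ Λ * (b - a)

theorem slopeBound_of_deriv {g : ℝ → ℝ} (hg : Differentiable ℝ g) {I : Set ℝ} (hI : I.OrdConnected)
    {Λ : ℝ} (h : ∀ s ∈ I, 0 ≤ deriv g s ∧ deriv g s ≤ Λ) : SlopeBound g I Λ := by
  intro a ha b hb hab
  have hsub : Icc a b ⊆ I := hI.out ha hb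
  have hint : interior (Icc a b) ⊆ Icc a b := interior_subset
  have h1 := (convex_Icc a b).mul_sub_le_image_sub_of_le_deriv hg.continuous.continuousOn
    hg.differentiableOn (C := 0) (fun x hx => (h x (hsub (hint hx))).1) a ⟨le_rfl, hab⟩ b ⟨hab, le_rfl⟩ hab
  have h2 := (convex_Icc a b).image_sub_le_mul_sub_of_deriv_le hg.continuous.continuousOn
    hg.differentiableOn (C := Λ) (fun x hx => (h x (hsub (hint hx))).2) a ⟨le_rfl, hab⟩ b ⟨hab, le_rfl⟩ hab
  exact ⟨by linarith, h2⟩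

theorem SlopeBound.mul_le {g : ℝ → ℝ} {I : Set ℝ} {Λ : ℝ} (h : SlopeBound g I Λ) {a b : ℝ}
    (ha : a ∈ I) (hb : b ∈ I) : (b - a) * (g b - g a) ≤ Λ * (b - a) ^ 2 := by
  rcases le_total a b with hab | hab
  · have := (h a ha b hb hab).2
    nlinarith
  · have := (h b hb a ha hab).2
    nlinarith

/-- The stream function in the moving frame, extended to the plane. -/
def relStream (H lam : ℝ) (ψ : ℝ × ℝ → ℝ) (x : ℝ × ℝ) : ℝ := ψ (clamp H x) - lam * (clamp H x).2

/-- The values of the stream function in the moving frame. -/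
def relRange (H lam : ℝ) (ψ : ℝ × ℝ → ℝ) : Set ℝ := (fun x => ψ x - lam * x.2) '' closedStrip H

theorem channel_sub {L H : ℝ} {f g : ℝ × ℝ → ℝ} (hf : Continuous f) (hg : Continuous g) :
    ∫ x, (f x - g x) ∂(channelMeasure L H) =
      (∫ x, f x ∂(channelMeasure L H)) - ∫ x, g x ∂(channelMeasure L H) :=
  integral_sub (integrable_channel L H hf) (integrable_channel L H hg)

section
variable {L H : ℝ} (hL : 0 < L) (hH : 0 < H)
include hL hH

theorem relStream_mem (lam : ℝ) (ψ : ℝ × ℝ → ℝ) (x : ℝ × ℝ) :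
    relStream H lam ψ x ∈ relRange H lam ψ := ⟨_, clamp_mem hH x, rfl⟩

theorem continuous_relStream (lam : ℝ) {ψ : ℝ × ℝ → ℝ} (hψ : IsC2 L H ψ) :
    Continuous (relStream H lam ψ) :=
  (continuous_comp_clamp hH hψ.2.continuousOn).sub
    (continuous_const.mul (continuous_clamp H).snd)

theorem ordConnected_relRange (lam : ℝ) {ψ : ℝ × ℝ → ℝ} (hψ : IsC2 L H ψ) :
    (relRange H lam ψ).OrdConnected := by
  have hc : IsPreconnected (closedStrip H) :=
    (convex_univ.prod (convex_Icc (0:ℝ) H)).isPreconnected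
  exact (hc.image _ (hψ.2.continuousOn.sub (by fun_prop))).ordConnected

/-- An average lies between the extreme values on its line, and the range of the relative stream
function is an interval by connectedness. Thus the slope bound on g may be used at the averaged
value. -/
theorem xmean_relStream_mem (lam : ℝ) {ψ : ℝ × ℝ → ℝ} (hψ : IsC2 L H ψ) (y : ℝ) :
    xmean L (relStream H lam ψ) y ∈ relRange H lam ψ := by
  have cφ := continuous_relStream hL hH lam hψ
  have ne : (Icc 0 L).Nonempty := ⟨0, le_rfl, hL.le⟩
  have cf : Continuous (fun x => relStream H lam ψ (x, y)) := by fun_prop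
  obtain ⟨a, -, ha⟩ := isCompact_Icc.exists_isMinOn ne cf.continuousOn
  obtain ⟨b, -, hb⟩ := isCompact_Icc.exists_isMaxOn ne cf.continuousOn
  refine (ordConnected_relRange hL hH lam hψ).out (relStream_mem hL hH lam ψ (a, y))
    (relStream_mem hL hH lam ψ (b, y)) ⟨?_, ?_⟩
  · have := intervalIntegral.integral_mono_on hL.le (continuous_const.intervalIntegrable (μ := volume) _ _)
      (cf.intervalIntegrable _ _) (fun x hx => ha hx)
    simp only [intervalIntegral.integral_const, sub_zero, smul_eq_mul] at this
    unfold xmean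
    rw [one_div, ← div_eq_inv_mul, le_div_iff₀ hL]
    linarith
  · have := intervalIntegral.integral_mono_on hL.le (cf.intervalIntegrable _ _)
      (continuous_const.intervalIntegrable (μ := volume) _ _) (fun x hx => hb hx)
    simp only [intervalIntegral.integral_const, sub_zero, smul_eq_mul] at this
    unfold xmean
    rw [one_div, ← div_eq_inv_mul, div_le_iff₀ hL]
    linarith

theorem slopeBound_relRange {g : ℝ → ℝ} (hg : ContDiff ℝ 1 g) {lam Λ : ℝ} {ψ : ℝ × ℝ → ℝ}
    (hψ : IsC2 L H ψ) (hg' : ∀ x ∈ closedStrip H,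
      0 ≤ deriv g (ψ x - lam * x.2) ∧ deriv g (ψ x - lam * x.2) ≤ Λ) :
    SlopeBound g (relRange H lam ψ) Λ := by
  refine slopeBound_of_deriv (hg.differentiable one_ne_zero) (ordConnected_relRange hL hH lam hψ) ?_
  rintro s ⟨x, hx, rfl⟩
  exact hg' x hx

/-- Solutions of the stream equation are superpositions of a wave in the first eigenspace and a
shear flow. -/
theorem stream_decomposition {g : ℝ → ℝ} (hg : ContDiff ℝ 1 g) {lam : ℝ} {ψ : ℝ × ℝ → ℝ}
    (hψ : SolvesStreamEquation L H g lam ψ) (hg' : ∀ x ∈ closedStrip H,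
      0 ≤ deriv g (ψ x - lam * x.2) ∧ deriv g (ψ x - lam * x.2) ≤ firstEigenvalue L H) :
    ∃ A B : ℝ, waveMode L H A B ∈ firstEigenspace L H ∧
      ∀ x ∈ closedStrip H, ψ x = waveMode L H A B x + xmean L (fun z => ψ (clamp H z)) x.2 := by
  obtain ⟨hC2, heq, ⟨a, ha⟩, ⟨b, hb⟩⟩ := hψ
  have slope := slopeBound_relRange hL hH hg hC2 hg'
  set Λ := firstEigenvalue L H with hΛ
  obtain ⟨p₁, p₂, p₁₁, p₁₂, p₂₁, p₂₂, hh⟩ := hC2.exists_hasHess hH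
  set v : ℝ × ℝ → ℝ := fun x => ψ (clamp H x) with hv
  have cv := hh.grad.cont
  have cp1 := hh.grad.cont1
  have cp2 := hh.grad.cont2
  have hvψ : ∀ x ∈ closedStrip H, v x = ψ x := fun x hx => by simp only [hv, clamp_of_mem hx]
  have v0 : ∀ s, v (s, 0) = a := fun s => by rw [hvψ _ ⟨mem_univ _, le_rfl, hH.le⟩]; exact ha s
  have vH : ∀ s, v (s, H) = b := fun s => by rw [hvψ _ ⟨mem_univ _, hH.le, le_rfl⟩]; exact hb s
  have hm := hh.grad.xmean hL hH
  have cm : Continuous (xmean L v) := continuous_xmean cv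
  have cm2 : Continuous (xmean L p₂) := continuous_xmean cp2
  have m0 : xmean L v 0 = a := by simp [xmean, v0]; field_simp
  have mH : xmean L v H = b := by simp [xmean, vH]; field_simp
  set u : ℝ × ℝ → ℝ := fun x => v x - xmean L v x.2 with hu
  have gu : HasGrad L H u p₁ (fun x => p₂ x - xmean L p₂ x.2) := (hh.grad.sub hm).congr_grad (by simp) rfl
  have cu := gu.cont
  have cu2 := gu.cont2
  have um : ∀ y ∈ Icc 0 H, ∫ x in (0 : ℝ)..L, u (x, y) = 0 := fun y _ => integral_sub_xmean hL hH cv y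
  have u2m : ∀ y ∈ Icc 0 H, ∫ x in (0 : ℝ)..L, (fun z => p₂ z - xmean L p₂ z.2) (x, y) = 0 :=
    fun y _ => integral_sub_xmean hL hH cp2 y
  have u0 : ∀ s, u (s, 0) = 0 := fun s => by simp [hu, v0, m0]
  have uH : ∀ s, u (s, H) = 0 := fun s => by simp [hu, vH, mH]
  obtain ⟨A, B, hAB⟩ := wave_gap hL hH gu u0 uH um
  have gr := green hL hH gu hh u0 uH
  simp only [zero_mul, sub_self, add_zero] at gr
  set φm : ℝ → ℝ := fun y => xmean L v y - lam * max 0 (min H y) with hφm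
  have cφm : Continuous φm := by fun_prop
  have φm_mem : ∀ y, φm y ∈ relRange H lam ψ := fun y => by
    have := xmean_relStream_mem hL hH lam hC2 y
    have e : xmean L (relStream H lam ψ) y = φm y := by
      have : ∀ x : ℝ, relStream H lam ψ (x, y) = v (x, y) - lam * max 0 (min H y) := fun x => rfl
      simp only [xmean, this, hφm]
      rw [intervalIntegral.integral_sub (Continuous.intervalIntegrable (by fun_prop) _ _) (by simp)]
      simp
      field_simp
    rwa [e] at this
  have cg : Continuous g := hg.continuous
  have c11 := hh.grad1.cont1
  have c22 := hh.grad2.cont2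
  have e1 : ∫ x, u x * (-(p₁₁ x + p₂₂ x)) ∂(channelMeasure L H) ≤
      Λ * ∫ x, u x ^ 2 ∂(channelMeasure L H) := by
    -- Subtracting g at the averaged relative stream function is free, because u is orthogonal to
    -- functions of x₂; afterwards the slope bound makes the integrand at most Λu².
    have z := integral_mul_snd_eq_zero hL hH cu um (b := fun y => g (φm y)) (by fun_prop)
    have e2 : ∫ x, u x * (-(p₁₁ x + p₂₂ x)) ∂(channelMeasure L H) =
        ∫ x, u x * (-(p₁₁ x + p₂₂ x) - g (φm x.2)) ∂(channelMeasure L H) := by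
      simp only [mul_sub]
      rw [channel_sub (f := fun x => u x * (-(p₁₁ x + p₂₂ x))) (g := fun x => u x * g (φm x.2))
        (by fun_prop) (by fun_prop), z, sub_zero]
    rw [e2, ← integral_const_mul]
    refine channel_mono (cu.mul ((hh.grad1.cont1.add hh.grad2.cont2).neg.sub (by fun_prop)))
      (by fun_prop) fun x hx => ?_
    have hx' := strip_subset H hx
    rw [← hh.lap_eq hx, lap_congr (fun z hz => hvψ z (strip_subset H hz)) hx, heq x hx]
    have h1 := slope.mul_le (φm_mem x.2) (b := ψ x - lam * x.2) ⟨x, hx', rfl⟩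
    have h2 : ψ x - lam * x.2 - φm x.2 = u x := by
      simp only [hφm, hu, hvψ x hx']
      rw [min_eq_right hx'.2.2, max_eq_right hx'.2.1]; ring
    rwa [h2] at h1
  -- ∇u differs from ∇ψ by a function of x₂ orthogonal to ∂₂u, so ∫|∇u|² = ∫∇u·∇ψ, the left side of
  -- Green's identity `gr`.
  have e3 : ∫ x, (p₁ x ^ 2 + (p₂ x - xmean L p₂ x.2) ^ 2) ∂(channelMeasure L H) =
      ∫ x, (p₁ x * p₁ x + (p₂ x - xmean L p₂ x.2) * p₂ x) ∂(channelMeasure L H) := by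
    have z := integral_mul_snd_eq_zero hL hH (u := fun z => p₂ z - xmean L p₂ z.2) (by fun_prop) u2m cm2
    have : ∀ x, p₁ x * p₁ x + (p₂ x - xmean L p₂ x.2) * p₂ x =
        (p₁ x ^ 2 + (p₂ x - xmean L p₂ x.2) ^ 2) + (p₂ x - xmean L p₂ x.2) * xmean L p₂ x.2 := fun x => by ring
    simp_rw [this]
    rw [channel_add hL hH (f := fun x => p₁ x ^ 2 + (p₂ x - xmean L p₂ x.2) ^ 2)
      (g := fun x => (p₂ x - xmean L p₂ x.2) * xmean L p₂ x.2) (by fun_prop) (by fun_prop), z, add_zero]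
  rw [e3, gr] at hAB
  have key := hAB.trans e1
  have U0 : 0 ≤ ∫ x, u x ^ 2 ∂(channelMeasure L H) := integral_nonneg fun x => sq_nonneg _
  have W0 : 0 ≤ ∫ x, (u x - waveMode L H A B x) ^ 2 ∂(channelMeasure L H) := integral_nonneg fun x => sq_nonneg _
  have hΛle : Λ ≤ waveEigenvalue L H := by rw [hΛ, firstEigenvalue_eq hL hH]; exact min_le_left _ _
  have hgap := gapConst_pos hL hH
  have uper : ∀ x y, u (x + L, y) = u (x, y) := gu.per
  have dec : ∀ x ∈ closedStrip H, ψ x = u x + xmean L v x.2 := fun x hx => by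
    simp only [hu, hvψ x hx]; ring
  -- At equality the surplus term forces u to be the wave mode. Below it, the strict inequality
  -- between the constants forces u = 0.
  rcases eq_or_lt_of_le hΛle with hE | hlt
  · refine ⟨A, B, ?_, fun x hx => ?_⟩
    · rw [firstEigenspace, ← hΛ, hE]; exact waveMode_mem_eigenspace hL hH A B
    · rw [hE] at key
      have wper : ∀ x y, waveMode L H A B (x + L, y) = waveMode L H A B (x, y) := fun x y => by
        simp only [waveMode]; rw [trig_period hL]
      have := eq_zero_of_integral_eq_zero hL hH (f := fun x => (u x - waveMode L H A B x) ^ 2)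
        (by fun_prop) (fun x y => by simp only [uper, wper]) (fun x => sq_nonneg _) (by
          by_contra hcon
          have := mul_pos hgap (not_le.1 hcon)
          linarith) x hx
      have h3 : u x = waveMode L H A B x := sub_eq_zero.1 (by simpa using this)
      rw [dec x hx, h3]
  · refine ⟨0, 0, waveMode_zero_mem_eigenspace hL hH _, fun x hx => ?_⟩
    have := eq_zero_of_integral_eq_zero hL hH (f := fun x => u x ^ 2)
        (by fun_prop) (fun x y => by simp only [uper]) (fun x => sq_nonneg _) (by
          by_contra hcon
          have h1 := mul_pos (sub_pos.2 hlt) (not_le.1 hcon)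
          have h2 := mul_nonneg hgap.le W0
          linarith) x hx
    have h3 : u x = 0 := by simpa using this
    rw [dec x hx, h3, waveMode_zero_zero hL hH]

end

/-! ### Regularity in space-time and the vorticity equation. -/

theorem pd1_congr {H : ℝ} {f g : ℝ × ℝ → ℝ} (h : ∀ x ∈ strip H, f x = g x) {x : ℝ × ℝ}
    (hx : x ∈ strip H) : pd1 f x = pd1 g x := by
  unfold pd1; congr 1; ext s; exact h (s, x.2) ⟨mem_univ _, hx.2⟩

theorem pd2_congr {H : ℝ} {f g : ℝ × ℝ → ℝ} (h : ∀ x ∈ strip H, f x = g x) {x : ℝ × ℝ}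
    (hx : x ∈ strip H) : pd2 f x = pd2 g x := by
  unfold pd2
  refine Filter.EventuallyEq.deriv_eq ?_
  filter_upwards [isOpen_Ioo.mem_nhds hx.2] with s hs
  exact h (x.1, s) ⟨mem_univ _, hs⟩

/-- The closed strip at all times. -/
def timeStrip (H : ℝ) : Set (ℝ × (ℝ × ℝ)) := univ ×ˢ closedStrip H

theorem uniqueDiffOn_timeStrip {H : ℝ} (hH : 0 < H) : UniqueDiffOn ℝ (timeStrip H) :=
  uniqueDiffOn_univ.prod (uniqueDiffOn_closedStrip hH)

theorem timeStrip_subset_closure {H : ℝ} (hH : 0 < H) :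
    timeStrip H ⊆ closure (interior (timeStrip H)) := by
  have : Convex ℝ (timeStrip H) := convex_univ.prod (convex_univ.prod (convex_Icc (0 : ℝ) H))
  rw [this.closure_interior_eq_closure_of_nonempty_interior]
  · exact subset_closure
  · refine ⟨(0, (0, H / 2)), mem_interior_iff_mem_nhds.2 ?_⟩
    refine prod_mem_nhds univ_mem (prod_mem_nhds univ_mem (Icc_mem_nhds ?_ ?_)) <;> linarith

/-- The directional derivative in space and time, one-sided at the boundary. -/
noncomputable def timeStripDeriv (H : ℝ) (e : ℝ × (ℝ × ℝ)) (F : ℝ × (ℝ × ℝ) → ℝ)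
    (q : ℝ × (ℝ × ℝ)) : ℝ := fderivWithin ℝ F (timeStrip H) q e

theorem contDiffOn_timeStripDeriv {H : ℝ} (hH : 0 < H) {F : ℝ × (ℝ × ℝ) → ℝ} {n : WithTop ℕ∞}
    (hf : ContDiffOn ℝ (n + 1) F (timeStrip H)) (e : ℝ × (ℝ × ℝ)) :
    ContDiffOn ℝ n (timeStripDeriv H e F) (timeStrip H) :=
  (hf.fderivWithin (uniqueDiffOn_timeStrip hH) le_rfl).clm_apply contDiffOn_const

/-- Symmetry of second derivatives persists up to the boundary because every point of the closed
strip is a limit of interior points. -/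
theorem timeStripDeriv_comm {H : ℝ} (hH : 0 < H) {F : ℝ × (ℝ × ℝ) → ℝ}
    (hf : ContDiffOn ℝ 2 F (timeStrip H)) (e e' : ℝ × (ℝ × ℝ)) {q : ℝ × (ℝ × ℝ)}
    (hq : q ∈ timeStrip H) :
    timeStripDeriv H e (timeStripDeriv H e' F) q = timeStripDeriv H e' (timeStripDeriv H e F) q := by
  have hu := uniqueDiffOn_timeStrip hH
  have hd : DifferentiableWithinAt ℝ (fderivWithin ℝ F (timeStrip H)) (timeStrip H) q :=
    ((hf.fderivWithin (m := 1) hu (by norm_num [one_add_one_eq_two])) q hq).differentiableWithinAt one_ne_zero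
  have key : ∀ a b : ℝ × (ℝ × ℝ), timeStripDeriv H a (timeStripDeriv H b F) q =
      fderivWithin ℝ (fderivWithin ℝ F (timeStrip H)) (timeStrip H) q a b := fun a b => by
    have : timeStripDeriv H b F = fun z => fderivWithin ℝ F (timeStrip H) z b := rfl
    rw [this, timeStripDeriv, fderivWithin_clm_apply (hu q hq) hd (differentiableWithinAt_const b)]
    simp
  rw [key, key]
  exact ((hf q hq).isSymmSndFDerivWithinAt (by simp) hu (timeStrip_subset_closure hH hq) hq) e e'

theorem timeStripDeriv_periodic {L H : ℝ} {F : ℝ × (ℝ × ℝ) → ℝ}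
    (hF : ∀ t, IsPeriodic L H (fun x => F (t, x))) (e : ℝ × (ℝ × ℝ)) (t : ℝ) :
    IsPeriodic L H (fun x => timeStripDeriv H e F (t, x)) := by
  intro x hx
  have hset : ((0 : ℝ), (L, (0 : ℝ))) +ᵥ timeStrip H = timeStrip H := by
    ext z
    rw [mem_vadd_set_iff_neg_vadd_mem]
    simp [timeStrip, closedStrip]
  have h1 := fderivWithin_comp_add_right (𝕜 := ℝ) (f := F) (s := timeStrip H) (x := (t, x))
    ((0 : ℝ), (L, (0 : ℝ)))
  rw [hset] at h1
  have hz : ∀ z ∈ timeStrip H, F (z + ((0 : ℝ), (L, (0 : ℝ)))) = F z := fun z hz => by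
    have := hF z.1 z.2 hz.2
    simp only at this
    rw [show F z = F (z.1, z.2) from rfl, ← this]; congr 1; ext <;> simp
  have h2 : fderivWithin ℝ (fun z => F (z + ((0 : ℝ), (L, (0 : ℝ))))) (timeStrip H) (t, x) =
      fderivWithin ℝ F (timeStrip H) (t, x) :=
    fderivWithin_congr hz (hz _ ⟨mem_univ _, hx⟩)
  have h3 : (t, x) + ((0 : ℝ), (L, (0 : ℝ))) = (t, (x.1 + L, x.2)) := by ext <;> simp
  rw [h3, h2] at h1
  simp only [timeStripDeriv, h1]

/-- `F` is jointly continuous, with jointly continuous time derivative `Fₜ`. -/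
structure HasTimeDeriv (F Fₜ : ℝ → ℝ × ℝ → ℝ) : Prop where
  cont : Continuous (fun q : ℝ × (ℝ × ℝ) => F q.1 q.2)
  contT : Continuous (fun q : ℝ × (ℝ × ℝ) => Fₜ q.1 q.2)
  deriv : ∀ t x, HasDerivAt (fun τ => F τ x) (Fₜ t x) t

theorem continuous_clamp_snd (H : ℝ) : Continuous (fun q : ℝ × (ℝ × ℝ) => (q.1, clamp H q.2)) :=
  continuous_fst.prodMk ((continuous_clamp H).comp continuous_snd)

theorem hasTimeDeriv_of_contDiffOn {H : ℝ} (hH : 0 < H) {F : ℝ × (ℝ × ℝ) → ℝ}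
    (hF : ContDiffOn ℝ 1 F (timeStrip H)) :
    HasTimeDeriv (fun t x => F (t, clamp H x))
      (fun t x => timeStripDeriv H (1, 0) F (t, clamp H x)) where
  cont := hF.continuousOn.comp_continuous (continuous_clamp_snd H) fun q => ⟨mem_univ _, clamp_mem hH _⟩
  contT := (contDiffOn_timeStripDeriv hH (n := 0) (by simpa using hF) _).continuousOn.comp_continuous
    (continuous_clamp_snd H) fun q => ⟨mem_univ _, clamp_mem hH _⟩
  deriv t x := by
    have hq : (t, clamp H x) ∈ timeStrip H := ⟨mem_univ _, clamp_mem hH _⟩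
    have h1 := ((hF _ hq).differentiableWithinAt one_ne_zero).hasFDerivWithinAt
    have h2 : HasDerivWithinAt (fun τ : ℝ => (τ, clamp H x)) ((1 : ℝ), (0 : ℝ × ℝ)) univ t :=
      ((hasDerivAt_id t).prodMk (hasDerivAt_const t (clamp H x))).hasDerivWithinAt
    have := h1.comp_hasDerivWithinAt t h2
      (fun s _ => show (s, clamp H x) ∈ timeStrip H from ⟨mem_univ _, clamp_mem hH _⟩)
    simpa [Function.comp_def, timeStripDeriv] using this

theorem hasGrad_slice {L H : ℝ} (hH : 0 < H) {F : ℝ × (ℝ × ℝ) → ℝ}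
    (hF : ContDiffOn ℝ 1 F (timeStrip H)) (hp : ∀ t, IsPeriodic L H (fun x => F (t, x))) (t : ℝ) :
    HasGrad L H (fun x => F (t, clamp H x)) (fun x => timeStripDeriv H (0, (1, 0)) F (t, clamp H x))
      (fun x => timeStripDeriv H (0, (0, 1)) F (t, clamp H x)) := by
  have cc : Continuous (fun x : ℝ × ℝ => (t, clamp H x)) := continuous_const.prodMk (continuous_clamp H)
  have cd := fun e => (contDiffOn_timeStripDeriv hH (n := 0) (by simpa using hF) e).continuousOn.comp_continuous
    cc fun x => ⟨mem_univ _, clamp_mem hH _⟩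
  refine ⟨hF.continuousOn.comp_continuous cc fun x => ⟨mem_univ _, clamp_mem hH _⟩, cd _, cd _,
    fun x y => hp t _ (clamp_mem hH (x, y)), fun x hx => ?_⟩
  have hq : (t, x) ∈ timeStrip H := ⟨mem_univ _, hx⟩
  have h1 := ((hF _ hq).differentiableWithinAt one_ne_zero).hasFDerivWithinAt
  have h2 : HasFDerivWithinAt (fun z : ℝ × ℝ => (t, z)) (ContinuousLinearMap.inr ℝ ℝ (ℝ × ℝ))
      (closedStrip H) x := (hasFDerivAt_prodMk_right t x).hasFDerivWithinAt
  have h3 := h1.comp x h2 (fun z hz => show (t, z) ∈ timeStrip H from ⟨mem_univ _, hz⟩)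
  have h4 := h3.congr (f₁ := fun x => F (t, clamp H x)) (fun z hz => by
    simp only [Function.comp_apply, clamp_of_mem hz]) (by simp only [Function.comp_apply, clamp_of_mem hx])
  refine h4.congr_fderiv ?_
  rw [clamp_of_mem hx]
  ext <;> simp [timeStripDeriv]

/-- The mixed second derivatives of a function with gradient `(a, b)` agree. -/
theorem curl_eq_of_hasFDerivAt {L H : ℝ} {p a a₁ a₂ b b₁ b₂ : ℝ × ℝ → ℝ}
    (hp : ∀ x ∈ strip H, HasFDerivAt p
      (a x • ContinuousLinearMap.fst ℝ ℝ ℝ + b x • ContinuousLinearMap.snd ℝ ℝ ℝ) x)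
    (ha : HasGrad L H a a₁ a₂) (hb : HasGrad L H b b₁ b₂) {x : ℝ × ℝ} (hx : x ∈ strip H) :
    a₂ x = b₁ x := by
  have h1 : ∀ᶠ y in 𝓝 x, HasFDerivAt p
      (a y • ContinuousLinearMap.fst ℝ ℝ ℝ + b y • ContinuousLinearMap.snd ℝ ℝ ℝ) y := by
    filter_upwards [(isOpen_strip H).mem_nhds hx] with y hy using hp y hy
  have h2 := ((ha.hasFDerivAt hx).smul_const (ContinuousLinearMap.fst ℝ ℝ ℝ)).add
    ((hb.hasFDerivAt hx).smul_const (ContinuousLinearMap.snd ℝ ℝ ℝ))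
  have := second_derivative_symmetric_of_eventually h1 h2 (0, 1) (1, 0)
  simpa using this

theorem HasTimeDeriv.hasDerivAt_integral {L H : ℝ} {F Fₜ : ℝ → ℝ × ℝ → ℝ} (h : HasTimeDeriv F Fₜ)
    (t : ℝ) : HasDerivAt (fun τ => ∫ x, F τ x ∂(channelMeasure L H))
      (∫ x, Fₜ t x ∂(channelMeasure L H)) t := by
  have cF := h.cont
  have cT := h.contT
  obtain ⟨K, hK⟩ := ((isCompact_Icc (a := t - 1) (b := t + 1)).prod ((isCompact_Icc (a := (0:ℝ)) (b := L)).prod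
      (isCompact_Icc (a := (0:ℝ)) (b := H)))).exists_bound_of_continuousOn cT.continuousOn
  refine (hasDerivAt_integral_of_dominated_loc_of_deriv_le (μ := channelMeasure L H)
    (F := F) (F' := Fₜ) (bound := fun _ => K) (s := Icc (t - 1) (t + 1))
    (Icc_mem_nhds (by linarith) (by linarith)) ?_ ?_ ?_ ?_ ?_ ?_).2
  · exact Eventually.of_forall fun τ =>
      (show Continuous (F τ) from cF.comp (continuous_const.prodMk continuous_id)).aestronglyMeasurable
  · exact integrable_channel L H (cF.comp (continuous_const.prodMk continuous_id))
  · exact (show Continuous (Fₜ t) from cT.comp (continuous_const.prodMk continuous_id)).aestronglyMeasurable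
  · refine (ae_restrict_iff' (measurableSet_Ioc.prod measurableSet_Ioo)).2 (ae_of_all _ fun x hx τ hτ => ?_)
    exact hK (τ, x) ⟨hτ, Ioc_subset_Icc_self hx.1, Ioo_subset_Icc_self hx.2⟩
  · exact integrable_const _
  · exact ae_of_all _ fun x τ _ => h.deriv τ x

theorem HasTimeDeriv.integral_const {L H : ℝ} {F Fₜ : ℝ → ℝ × ℝ → ℝ} (h : HasTimeDeriv F Fₜ)
    (h0 : ∀ t, ∫ x, Fₜ t x ∂(channelMeasure L H) = 0) (s t : ℝ) :
    ∫ x, F s x ∂(channelMeasure L H) = ∫ x, F t x ∂(channelMeasure L H) :=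
  is_const_of_deriv_eq_zero (fun τ => (h.hasDerivAt_integral τ).differentiableAt)
    (fun τ => by rw [(h.hasDerivAt_integral τ).deriv, h0]) s t

/-- The data of an Euler flow used in the proof of its conservation laws, extended to the plane:
velocity, vorticity, pressure and their first derivatives. -/
structure FlowData (L H : ℝ) (v₁ v₂ v₁t v₂t v₁₁ v₁₂ v₂₁ v₂₂ ω ωt ω₁ ω₂ P P₁ P₂ : ℝ → ℝ × ℝ → ℝ) :
    Prop where
  time1 : HasTimeDeriv v₁ v₁t
  time2 : HasTimeDeriv v₂ v₂t
  timeω : HasTimeDeriv ω ωt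
  grad1 : ∀ t, HasGrad L H (v₁ t) (v₁₁ t) (v₁₂ t)
  grad2 : ∀ t, HasGrad L H (v₂ t) (v₂₁ t) (v₂₂ t)
  gradω : ∀ t, HasGrad L H (ω t) (ω₁ t) (ω₂ t)
  gradP : ∀ t, HasGrad L H (P t) (P₁ t) (P₂ t)
  vort : ∀ t, ∀ x ∈ strip H, ω t x = v₂₁ t x - v₁₂ t x
  divFree : ∀ t, ∀ x ∈ strip H, v₁₁ t x + v₂₂ t x = 0
  momentum1 : ∀ t, ∀ x ∈ strip H,
    v₁t t x + v₁ t x * v₁₁ t x + v₂ t x * v₁₂ t x = -P₁ t x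
  momentum2 : ∀ t, ∀ x ∈ strip H,
    v₂t t x + v₁ t x * v₂₁ t x + v₂ t x * v₂₂ t x = -P₂ t x
  transport : ∀ t, ∀ x ∈ strip H, ωt t x = -(v₁ t x * ω₁ t x + v₂ t x * ω₂ t x)
  bottom : ∀ t s, v₂ t (s, 0) = 0
  top : ∀ t s, v₂ t (s, H) = 0

theorem timeStripDeriv_sub {H : ℝ} (hH : 0 < H) {F G : ℝ × (ℝ × ℝ) → ℝ}
    (hF : ContDiffOn ℝ 1 F (timeStrip H)) (hG : ContDiffOn ℝ 1 G (timeStrip H)) (e : ℝ × (ℝ × ℝ))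
    {q : ℝ × (ℝ × ℝ)} (hq : q ∈ timeStrip H) :
    timeStripDeriv H e (fun q => F q - G q) q = timeStripDeriv H e F q - timeStripDeriv H e G q := by
  unfold timeStripDeriv
  rw [fderivWithin_fun_sub (uniqueDiffOn_timeStrip hH q hq) ((hF q hq).differentiableWithinAt one_ne_zero)
    ((hG q hq).differentiableWithinAt one_ne_zero)]
  rfl

theorem IsEulerFlow.exists_flowData {L H : ℝ} (hH : 0 < H) {v : ℝ → ℝ × ℝ → ℝ × ℝ}
    (hv : IsEulerFlow L H v) : ∃ v₁ v₂ v₁t v₂t v₁₁ v₁₂ v₂₁ v₂₂ ω ωt ω₁ ω₂ P P₁ P₂,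
    FlowData L H v₁ v₂ v₁t v₂t v₁₁ v₁₂ v₂₁ v₂₂ ω ωt ω₁ ω₂ P P₁ P₂ ∧
    ∀ t, ∀ x ∈ strip H, vorticity (v t) x = ω t x := by
  obtain ⟨hper, hsm, ⟨P, hPper, hPsm, hmom⟩, hdiv, himp⟩ := hv
  set V₁ : ℝ × (ℝ × ℝ) → ℝ := fun q => (v q.1 q.2).1 with hV₁
  set V₂ : ℝ × (ℝ × ℝ) → ℝ := fun q => (v q.1 q.2).2 with hV₂
  have s1 : ContDiffOn ℝ 2 V₁ (timeStrip H) := contDiff_fst.comp_contDiffOn hsm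
  have s2 : ContDiffOn ℝ 2 V₂ (timeStrip H) := contDiff_snd.comp_contDiffOn hsm
  have o : ∀ {F : ℝ × (ℝ × ℝ) → ℝ}, ContDiffOn ℝ 2 F (timeStrip H) → ContDiffOn ℝ 1 F (timeStrip H) :=
    fun h => h.of_le (by norm_num)
  have d : ∀ {F : ℝ × (ℝ × ℝ) → ℝ}, ContDiffOn ℝ 2 F (timeStrip H) → ∀ e,
      ContDiffOn ℝ 1 (timeStripDeriv H e F) (timeStrip H) := fun h e =>
    contDiffOn_timeStripDeriv hH (n := 1) (by simpa [one_add_one_eq_two] using h) e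
  have p1 : ∀ t, IsPeriodic L H (fun x => V₁ (t, x)) := fun t x hx => by
    simp only [hV₁]; rw [hper t x hx]
  have p2 : ∀ t, IsPeriodic L H (fun x => V₂ (t, x)) := fun t x hx => by
    simp only [hV₂]; rw [hper t x hx]
  set et : ℝ × (ℝ × ℝ) := (1, 0) with het
  set e1 : ℝ × (ℝ × ℝ) := (0, (1, 0)) with he1
  set e2 : ℝ × (ℝ × ℝ) := (0, (0, 1)) with he2
  set W : ℝ × (ℝ × ℝ) → ℝ := fun q => timeStripDeriv H e1 V₂ q - timeStripDeriv H e2 V₁ q with hW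
  have sW : ContDiffOn ℝ 1 W (timeStrip H) := (d s2 e1).sub (d s1 e2)
  have pW : ∀ t, IsPeriodic L H (fun x => W (t, x)) := fun t x hx => by
    simp only [hW]
    have a := timeStripDeriv_periodic p2 e1 t x hx
    have b := timeStripDeriv_periodic p1 e2 t x hx
    simp only at a b
    rw [a, b]
  have c : ∀ {x : ℝ × ℝ}, x ∈ strip H → clamp H x = x := fun hx => clamp_of_mem (strip_subset H hx)
  have g1 := hasGrad_slice hH (o s1) p1
  have g2 := hasGrad_slice hH (o s2) p2
  have gW := hasGrad_slice hH sW pW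
  have gP := fun t => hasGrad_of_contDiffOn hH (hPper t) (hPsm t)
  have t1 := hasTimeDeriv_of_contDiffOn hH (o s1)
  have t2 := hasTimeDeriv_of_contDiffOn hH (o s2)
  -- the derivatives of the statement are those of the extended fields
  have ev1 : ∀ t, ∀ x ∈ strip H, (v t x).1 = V₁ (t, clamp H x) := fun t x hx => by rw [c hx]
  have ev2 : ∀ t, ∀ x ∈ strip H, (v t x).2 = V₂ (t, clamp H x) := fun t x hx => by rw [c hx]
  have a11 : ∀ t, ∀ x ∈ strip H, pd1 (fun y => (v t y).1) x = timeStripDeriv H e1 V₁ (t, clamp H x) :=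
    fun t x hx => by rw [pd1_congr (ev1 t) hx]; exact (g1 t).pd1_eq (strip_subset H hx)
  have a12 : ∀ t, ∀ x ∈ strip H, pd2 (fun y => (v t y).1) x = timeStripDeriv H e2 V₁ (t, clamp H x) :=
    fun t x hx => by rw [pd2_congr (ev1 t) hx]; exact (g1 t).pd2_eq hx
  have a21 : ∀ t, ∀ x ∈ strip H, pd1 (fun y => (v t y).2) x = timeStripDeriv H e1 V₂ (t, clamp H x) :=
    fun t x hx => by rw [pd1_congr (ev2 t) hx]; exact (g2 t).pd1_eq (strip_subset H hx)
  have a22 : ∀ t, ∀ x ∈ strip H, pd2 (fun y => (v t y).2) x = timeStripDeriv H e2 V₂ (t, clamp H x) :=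
    fun t x hx => by rw [pd2_congr (ev2 t) hx]; exact (g2 t).pd2_eq hx
  have b1 : ∀ t, ∀ x ∈ strip H, deriv (fun τ => (v τ x).1) t = timeStripDeriv H et V₁ (t, clamp H x) :=
    fun t x hx => by
      have := (t1.deriv t x).deriv
      rw [← this]; simp only [c hx, hV₁]
  have b2 : ∀ t, ∀ x ∈ strip H, deriv (fun τ => (v τ x).2) t = timeStripDeriv H et V₂ (t, clamp H x) :=
    fun t x hx => by
      have := (t2.deriv t x).deriv
      rw [← this]; simp only [c hx, hV₂]
  have q1 : ∀ t, ∀ x ∈ strip H, pd1 (P t) x = stripDeriv H (1, 0) (P t) (clamp H x) :=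
    fun t x hx => by
      rw [pd1_congr (g := fun x => P t (clamp H x)) (fun z hz => by rw [c hz]) hx]
      exact (gP t).pd1_eq (strip_subset H hx)
  have q2 : ∀ t, ∀ x ∈ strip H, pd2 (P t) x = stripDeriv H (0, 1) (P t) (clamp H x) :=
    fun t x hx => by
      rw [pd2_congr (g := fun x => P t (clamp H x)) (fun z hz => by rw [c hz]) hx]
      exact (gP t).pd2_eq hx
  have m1 : ∀ t, ∀ x ∈ strip H, timeStripDeriv H et V₁ (t, clamp H x) +
      V₁ (t, clamp H x) * timeStripDeriv H e1 V₁ (t, clamp H x) +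
      V₂ (t, clamp H x) * timeStripDeriv H e2 V₁ (t, clamp H x) = -stripDeriv H (1, 0) (P t) (clamp H x) :=
    fun t x hx => by
      have := (hmom t x hx).1
      rw [b1 t x hx, a11 t x hx, a12 t x hx, q1 t x hx, ev1 t x hx, ev2 t x hx] at this
      exact this
  have m2 : ∀ t, ∀ x ∈ strip H, timeStripDeriv H et V₂ (t, clamp H x) +
      V₁ (t, clamp H x) * timeStripDeriv H e1 V₂ (t, clamp H x) +
      V₂ (t, clamp H x) * timeStripDeriv H e2 V₂ (t, clamp H x) = -stripDeriv H (0, 1) (P t) (clamp H x) :=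
    fun t x hx => by
      have := (hmom t x hx).2
      rw [b2 t x hx, a21 t x hx, a22 t x hx, q2 t x hx, ev1 t x hx, ev2 t x hx] at this
      exact this
  have dv : ∀ t, ∀ x ∈ strip H, timeStripDeriv H e1 V₁ (t, clamp H x) +
      timeStripDeriv H e2 V₂ (t, clamp H x) = 0 := fun t x hx => by
    rw [← a11 t x hx, ← a22 t x hx]; exact hdiv t x hx
  refine ⟨fun t x => V₁ (t, clamp H x), fun t x => V₂ (t, clamp H x), _, _, _, _, _, _,
    fun t x => W (t, clamp H x), _, _, _, fun t x => P t (clamp H x), _, _,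
    ⟨t1, t2, hasTimeDeriv_of_contDiffOn hH sW, g1, g2, gW, gP, fun t x _ => rfl, dv, m1, m2, ?_, ?_, ?_⟩, ?_⟩
  · intro t x hx
    have gt1 := hasGrad_slice (L := L) hH (d s1 et) (timeStripDeriv_periodic p1 et) t
    have gt2 := hasGrad_slice (L := L) hH (d s2 et) (timeStripDeriv_periodic p2 et) t
    have g11 := hasGrad_slice (L := L) hH (d s1 e1) (timeStripDeriv_periodic p1 e1) t
    have g12 := hasGrad_slice (L := L) hH (d s1 e2) (timeStripDeriv_periodic p1 e2) t
    have g21 := hasGrad_slice (L := L) hH (d s2 e1) (timeStripDeriv_periodic p2 e1) t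
    have g22 := hasGrad_slice (L := L) hH (d s2 e2) (timeStripDeriv_periodic p2 e2) t
    have R1 := ((gt1.add ((g1 t).mul g11)).add ((g2 t).mul g12)).neg
    have R2 := ((gt2.add ((g1 t).mul g21)).add ((g2 t).mul g22)).neg
    -- The pressure is only assumed C¹, but the momentum equations identify its gradient with the C¹
    -- fields of `R1` and `R2`, so its mixed second derivatives exist and agree.
    have curl := curl_eq_of_hasFDerivAt (p := fun x => P t (clamp H x)) (fun z hz => by
      have hP := (gP t).hasFDerivAt hz
      rw [show stripDeriv H (1, 0) (P t) (clamp H z) = _ from (neg_eq_iff_eq_neg.2 (m1 t z hz)).symm.trans rfl,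
        show stripDeriv H (0, 1) (P t) (clamp H z) = _ from (neg_eq_iff_eq_neg.2 (m2 t z hz)).symm.trans rfl] at hP
      exact hP) R1 R2 hx
    have hq : (t, clamp H x) ∈ timeStrip H := ⟨mem_univ _, clamp_mem hH x⟩
    have hdvx := dv t x hx
    simp only [hW]
    rw [timeStripDeriv_sub hH (d s2 e1) (d s1 e2) et hq, timeStripDeriv_sub hH (d s2 e1) (d s1 e2) _ hq,
      timeStripDeriv_sub hH (d s2 e1) (d s1 e2) _ hq, timeStripDeriv_comm hH s2 et e1 hq,
      timeStripDeriv_comm hH s1 et e2 hq]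
    rw [← he1, ← he2] at curl ⊢
    have k1 := timeStripDeriv_comm hH s1 e1 e2 hq
    have k2 := timeStripDeriv_comm hH s2 e1 e2 hq
    rw [← k1, k2] at curl
    -- The curl of the advection term contains ω div v; incompressibility removes it and leaves pure
    -- transport.
    have hd2 : timeStripDeriv H e2 V₂ (t, clamp H x) = - timeStripDeriv H e1 V₁ (t, clamp H x) := by linarith
    rw [hd2] at curl
    linear_combination curl
  · intro t s
    have : clamp H (s, 0) = (s, 0) := clamp_of_mem ⟨mem_univ _, le_rfl, hH.le⟩
    simp only [this]; exact (himp t s).1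
  · intro t s
    have : clamp H (s, H) = (s, H) := clamp_of_mem ⟨mem_univ _, hH.le, le_rfl⟩
    simp only [this]; exact (himp t s).2
  · intro t x hx
    rw [vorticity, a21 t x hx, a12 t x hx]

/-! ### Conservation laws. -/

theorem channel_congr {L H : ℝ} {f g : ℝ × ℝ → ℝ} (h : ∀ x ∈ strip H, f x = g x) :
    ∫ x, f x ∂(channelMeasure L H) = ∫ x, g x ∂(channelMeasure L H) :=
  integral_congr_ae (ae_channelMeasure h)

theorem exists_channel_bound (L H : ℝ) {f : ℝ × ℝ → ℝ} (hf : Continuous f) :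
    ∃ K, 0 ≤ K ∧ ∀ x ∈ Icc 0 L ×ˢ Icc 0 H, |f x| ≤ K := by
  obtain ⟨K, hK⟩ := ((isCompact_Icc (a := (0:ℝ)) (b := L)).prod
    (isCompact_Icc (a := (0:ℝ)) (b := H))).exists_bound_of_continuousOn hf.continuousOn
  exact ⟨max K 0, le_max_right _ _, fun x hx => (hK x hx).trans (le_max_left _ _)⟩

theorem ae_channelMeasure_cell {L H : ℝ} {P : ℝ × ℝ → Prop}
    (h : ∀ x ∈ Icc 0 L ×ˢ Icc 0 H, P x) : ∀ᵐ x ∂(channelMeasure L H), P x :=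
  (ae_restrict_iff' (measurableSet_Ioc.prod measurableSet_Ioo)).2
    (ae_of_all _ fun _ hx => h _ ⟨Ioc_subset_Icc_self hx.1, Ioo_subset_Icc_self hx.2⟩)

/-- If all polynomial moments of two functions on the channel agree, so do all continuous ones. -/
theorem integral_comp_eq_of_polynomial {L H : ℝ} {a b : ℝ × ℝ → ℝ} (ha : Continuous a) (hb : Continuous b)
    (h : ∀ p : Polynomial ℝ, ∫ x, p.eval (a x) ∂(channelMeasure L H) =
      ∫ x, p.eval (b x) ∂(channelMeasure L H)) {Φ : ℝ → ℝ} (hΦ : Continuous Φ) :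
    ∫ x, Φ (a x) ∂(channelMeasure L H) = ∫ x, Φ (b x) ∂(channelMeasure L H) := by
  obtain ⟨K, -, hK⟩ := exists_channel_bound L H ha
  obtain ⟨K', -, hK'⟩ := exists_channel_bound L H hb
  set R := max K K' with hR
  set M := (channelMeasure L H).real univ with hM
  have hM0 : 0 ≤ M := measureReal_nonneg
  have close : ∀ ε > 0, |(∫ x, Φ (a x) ∂(channelMeasure L H)) - ∫ x, Φ (b x) ∂(channelMeasure L H)| ≤
      2 * (ε * M) := by
    intro ε hε
    -- Weierstrass approximation on an interval containing the ranges of both functions. Merely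
    -- continuous integrands are needed later, since truncations and powers of absolute values are
    -- not differentiable.
    obtain ⟨p, hp⟩ := exists_polynomial_near_of_continuousOn (-R) R Φ hΦ.continuousOn ε hε
    have est : ∀ c : ℝ × ℝ → ℝ, Continuous c → (∀ x ∈ Icc 0 L ×ˢ Icc 0 H, |c x| ≤ R) →
        |(∫ x, Φ (c x) ∂(channelMeasure L H)) - ∫ x, p.eval (c x) ∂(channelMeasure L H)| ≤ ε * M := by
      intro c hc hcR
      have cp : Continuous (fun x => p.eval (c x)) := p.continuous.comp hc
      rw [← integral_sub (integrable_channel L H (by fun_prop)) (integrable_channel L H cp)]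
      have hb : ∀ᵐ x ∂(channelMeasure L H), ‖Φ (c x) - p.eval (c x)‖ ≤ ε :=
        ae_channelMeasure_cell fun x hx => ?_
      · exact norm_integral_le_of_norm_le_const hb
      rw [Real.norm_eq_abs, abs_sub_comm]
      exact (hp _ (abs_le.1 (hcR x hx))).le
    have h1 := est a ha fun x hx => (hK x hx).trans (le_max_left _ _)
    have h2 := est b hb fun x hx => (hK' x hx).trans (le_max_right _ _)
    rw [h p] at h1
    rw [abs_le] at *
    constructor <;> linarith
  have : |(∫ x, Φ (a x) ∂(channelMeasure L H)) - ∫ x, Φ (b x) ∂(channelMeasure L H)| ≤ 0 := by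
    refine le_of_forall_pos_le_add fun η hη => ?_
    have := close (η / (2 * (M + 1))) (by positivity)
    have h3 : 2 * (η / (2 * (M + 1)) * M) ≤ η := by
      rw [show 2 * (η / (2 * (M + 1)) * M) = η * (M / (M + 1)) by field_simp]
      exact mul_le_of_le_one_right hη.le ((div_le_one (by positivity)).2 (by linarith))
    linarith
  exact sub_eq_zero.1 (abs_nonpos_iff.1 this)

namespace FlowData
variable {L H : ℝ} {v₁ v₂ v₁t v₂t v₁₁ v₁₂ v₂₁ v₂₂ ω ωt ω₁ ω₂ P P₁ P₂ : ℝ → ℝ × ℝ → ℝ}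
  (hL : 0 < L) (hH : 0 < H)
  (D : FlowData L H v₁ v₂ v₁t v₂t v₁₁ v₁₂ v₂₁ v₂₂ ω ωt ω₁ ω₂ P P₁ P₂)
include hL hH D

/-- The time derivative of Φ(ω) is -div(vΦ(ω)), and no flux passes through the walls. -/
theorem integral_comp_vorticity_of_hasDerivAt {Φ Φ' : ℝ → ℝ} (hΦ : ∀ s, HasDerivAt Φ (Φ' s) s)
    (hΦ' : Continuous Φ') (s t : ℝ) :
    ∫ x, Φ (ω s x) ∂(channelMeasure L H) = ∫ x, Φ (ω t x) ∂(channelMeasure L H) := by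
  have cΦ : Continuous Φ := continuous_iff_continuousAt.2 fun s => (hΦ s).continuousAt
  refine HasTimeDeriv.integral_const (F := fun t x => Φ (ω t x)) (Fₜ := fun t x => Φ' (ω t x) * ωt t x)
    ⟨cΦ.comp D.timeω.cont, (hΦ'.comp D.timeω.cont).mul D.timeω.contT,
      fun t x => (hΦ _).comp t (D.timeω.deriv t x)⟩ (fun t => ?_) s t
  have h := integral_divergence hL hH ((D.grad1 t).mul ((D.gradω t).comp hΦ hΦ'))
    ((D.grad2 t).mul ((D.gradω t).comp hΦ hΦ'))
  simp only [D.bottom, D.top, zero_mul, intervalIntegral.integral_zero, sub_zero] at h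
  rw [← neg_eq_zero, ← h, ← integral_neg]
  refine channel_congr fun x hx => ?_
  rw [D.transport t x hx]
  have := D.divFree t x hx
  linear_combination (-Φ (ω t x)) * this

/-- Conservation of the distribution of the vorticity. -/
theorem integral_comp_vorticity {Φ : ℝ → ℝ} (hΦ : Continuous Φ) (s t : ℝ) :
    ∫ x, Φ (ω s x) ∂(channelMeasure L H) = ∫ x, Φ (ω t x) ∂(channelMeasure L H) :=
  integral_comp_eq_of_polynomial (D.gradω s).cont (D.gradω t).cont
    (fun p => D.integral_comp_vorticity_of_hasDerivAt hL hH (fun s => p.hasDerivAt s)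
      p.derivative.continuous s t) hΦ

/-- After an integration by parts the rate of change is ∫v₂ω, and v₂ω = ∂₁((v₂² - v₁²)/2) - ∂₂(v₁v₂)
for an incompressible field; v₂ vanishes on the walls. -/
theorem integral_snd_mul_vorticity (s t : ℝ) :
    ∫ x, x.2 * ω s x ∂(channelMeasure L H) = ∫ x, x.2 * ω t x ∂(channelMeasure L H) := by
  have cω := D.timeω.cont
  have cωt := D.timeω.contT
  refine HasTimeDeriv.integral_const (F := fun t x => x.2 * ω t x) (Fₜ := fun t x => x.2 * ωt t x)
    ⟨by fun_prop, by fun_prop, fun t x => (D.timeω.deriv t x).const_mul _⟩ (fun t => ?_) s t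
  have gy : HasGrad L H (fun x => x.2) (fun _ => 0) (fun _ => 1) :=
    HasGrad.of_snd (a := id) (a' := fun _ => 1) continuous_id continuous_const
      (fun y _ => hasDerivWithinAt_id y _)
  have sq := ((D.grad2 t).mul (D.grad2 t)).sub ((D.grad1 t).mul (D.grad1 t))
  have h := integral_divergence hL hH
    ((sq.const_mul (1 / 2)).sub (((D.grad1 t).mul (D.gradω t)).mul gy))
    (((D.grad1 t).mul (D.grad2 t)).neg.sub (((D.grad2 t).mul (D.gradω t)).mul gy))
  simp only [D.bottom, D.top, zero_mul, mul_zero, neg_zero, intervalIntegral.integral_zero, sub_zero] at h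
  rw [← h]
  refine channel_congr fun x hx => ?_
  rw [D.transport t x hx]
  have h1 := D.divFree t x hx
  have h2 := D.vort t x hx
  linear_combination (v₁ t x + ω t x * x.2) * h1 + v₂ t x * h2

/-- The first momentum equation in divergence form. Periodicity of the pressure is essential: it
excludes a mean pressure gradient along the channel. -/
theorem integral_velocity (s t : ℝ) :
    ∫ x, v₁ s x ∂(channelMeasure L H) = ∫ x, v₁ t x ∂(channelMeasure L H) := by
  refine HasTimeDeriv.integral_const D.time1 (fun t => ?_) s t
  have h := integral_divergence hL hH (((D.grad1 t).mul (D.grad1 t)).add (D.gradP t))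
    ((D.grad1 t).mul (D.grad2 t))
  simp only [D.bottom, D.top, mul_zero, intervalIntegral.integral_zero, sub_zero] at h
  rw [← neg_eq_zero, ← h, ← integral_neg]
  refine channel_congr fun x hx => ?_
  have h1 := D.divFree t x hx
  have h2 := D.momentum1 t x hx
  linear_combination -h2 - v₁ t x * h1

/-- The energy flux is (|v|² + 2P)v, which is tangent to the walls. -/
theorem integral_energy (s t : ℝ) :
    ∫ x, (v₁ s x ^ 2 + v₂ s x ^ 2) ∂(channelMeasure L H) =
      ∫ x, (v₁ t x ^ 2 + v₂ t x ^ 2) ∂(channelMeasure L H) := by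
  have c1 := D.time1.cont
  have c2 := D.time2.cont
  have c1t := D.time1.contT
  have c2t := D.time2.contT
  refine HasTimeDeriv.integral_const (F := fun t x => v₁ t x ^ 2 + v₂ t x ^ 2)
    (Fₜ := fun t x => 2 * v₁ t x * v₁t t x + 2 * v₂ t x * v₂t t x)
    ⟨by fun_prop, by fun_prop, fun t x => ?_⟩ (fun t => ?_) s t
  · have h1 := ((D.time1.deriv t x).pow 2).add ((D.time2.deriv t x).pow 2)
    simp only [Nat.cast_ofNat, Nat.add_one_sub_one, pow_one] at h1
    exact h1
  have sq := (((D.grad1 t).mul (D.grad1 t)).add ((D.grad2 t).mul (D.grad2 t))).add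
    ((D.gradP t).const_mul 2)
  have h := integral_divergence hL hH ((D.grad1 t).mul sq) ((D.grad2 t).mul sq)
  simp only [D.bottom, D.top, zero_mul, intervalIntegral.integral_zero, sub_zero] at h
  rw [← neg_eq_zero, ← h, ← integral_neg]
  refine channel_congr fun x hx => ?_
  have h1 := D.divFree t x hx
  have h2 := D.momentum1 t x hx
  have h3 := D.momentum2 t x hx
  linear_combination (-2 * v₁ t x) * h2 + (-2 * v₂ t x) * h3 -
    (v₁ t x * v₁ t x + v₂ t x * v₂ t x + 2 * P t x) * h1

end FlowData

/-! ### Stream functions and the perturbation of the steady flow. -/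

theorem convex_closedStrip (H : ℝ) : Convex ℝ (closedStrip H) := convex_univ.prod (convex_Icc 0 H)

theorem closedStrip_subset_closure {H : ℝ} (hH : 0 < H) : closedStrip H ⊆ closure (strip H) := by
  rw [strip, closure_prod_eq, closure_univ, closure_Ioo hH.ne]; rfl

theorem HasGrad.eq_of_grad_fst_zero {L H : ℝ} {f f₁ f₂ : ℝ × ℝ → ℝ} (h : HasGrad L H f f₁ f₂) {y : ℝ}
    (hy : y ∈ Icc 0 H) (h0 : ∀ s, f₁ (s, y) = 0) (s t : ℝ) : f (s, y) = f (t, y) :=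
  is_const_of_deriv_eq_zero (f := fun s => f (s, y))
    (fun _ => (h.hasDerivAt_fst hy).differentiableAt)
    (fun s => (h.hasDerivAt_fst hy).deriv.trans (h0 s)) s t

theorem HasGrad.sub_eq_of_grad_snd_eq {L H : ℝ} {f f₁ f₂ : ℝ × ℝ → ℝ} (h : HasGrad L H f f₁ f₂)
    {s t : ℝ} (h0 : ∀ y, f₂ (s, y) = f₂ (t, y)) {y : ℝ} (hy : y ∈ Icc 0 H) :
    f (s, y) - f (t, y) = f (s, 0) - f (t, 0) := by
  have hd : ∀ z ∈ Icc 0 H, HasDerivWithinAt (fun z => f (s, z) - f (t, z)) 0 (Icc 0 H) z := by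
    intro z hz
    have := (h.hasDerivWithinAt_snd (x := s) hz).sub (h.hasDerivWithinAt_snd (x := t) hz)
    rw [h0 z, sub_self] at this
    exact this
  refine constant_of_derivWithin_zero (f := fun z => f (s, z) - f (t, z)) (a := 0) (b := H)
    (fun z hz => (hd z hz).differentiableWithinAt) (fun z hz => ?_) y hy
  exact (hd z ⟨hz.1, hz.2.le⟩).derivWithin (uniqueDiffOn_Icc (hz.1.trans_lt hz.2) z ⟨hz.1, hz.2.le⟩)

/-- A divergence-free field that is tangent to the boundary has a stream function. -/
theorem exists_stream {L H : ℝ} (hH : 0 < H) {v₁ v₂ v₁₁ v₁₂ v₂₁ v₂₂ : ℝ × ℝ → ℝ}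
    (h1 : HasGrad L H v₁ v₁₁ v₁₂) (h2 : HasGrad L H v₂ v₂₁ v₂₂)
    (hdiv : ∀ x ∈ strip H, v₁₁ x + v₂₂ x = 0) (hbot : ∀ s, v₂ (s, 0) = 0) (htop : ∀ s, v₂ (s, H) = 0) :
    ∃ Ψ : ℝ × ℝ → ℝ, HasHess L H Ψ (fun x => -v₂ x) v₁ (fun x => -v₂₁ x) (fun x => -v₂₂ x) v₁₁ v₁₂ ∧
      (∀ s, Ψ (s, 0) = 0) ∧ ∃ k, ∀ s, Ψ (s, H) = k := by
  have hdiv' : ∀ x ∈ closedStrip H, v₁₁ x + v₂₂ x = 0 := fun x hx => by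
    have hcl : IsClosed {x | v₁₁ x + v₂₂ x = 0} :=
      isClosed_eq (h1.cont1.add h2.cont2) continuous_const
    exact hcl.closure_subset_iff.2 hdiv (closedStrip_subset_closure hH hx)
  set fs := ContinuousLinearMap.fst ℝ ℝ ℝ
  set sn := ContinuousLinearMap.snd ℝ ℝ ℝ
  -- Poincaré's lemma on the convex closed strip: the 1-form -v₂dx₁ + v₁dx₂ is closed because div v
  -- = 0.
  obtain ⟨f, hf⟩ := (convex_closedStrip H).exists_forall_hasFDerivWithinAt_of_hasFDerivWithinAt_symmetric
    (𝕜 := ℝ) (ω := fun x => (-v₂ x) • fs + v₁ x • sn)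
    (dω := fun x => (-(v₂₁ x • fs + v₂₂ x • sn)).smulRight fs + (v₁₁ x • fs + v₁₂ x • sn).smulRight sn)
    (fun x hx => ((h2.hasFDeriv x hx).neg.smul_const fs).add ((h1.hasFDeriv x hx).smul_const sn))
    (fun a ha x _ y _ => by
      simp [fs, sn]
      linear_combination (x.1 * y.2 - y.1 * x.2) * hdiv' a ha)
  have hfc : ContinuousOn f (closedStrip H) := fun x hx => (hf x hx).continuousWithinAt
  set Ψ : ℝ × ℝ → ℝ := fun x => f (clamp H x) - f (0, 0) with hΨ
  have m0 : (0 : ℝ) ∈ Icc 0 H := ⟨le_rfl, hH.le⟩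
  have mH : H ∈ Icc 0 H := ⟨hH.le, le_rfl⟩
  have hder : ∀ x ∈ closedStrip H, HasFDerivWithinAt Ψ ((-v₂ x) • fs + v₁ x • sn) (closedStrip H) x := by
    intro x hx
    refine ((hf x hx).sub_const (f (0, 0))).congr (fun y hy => ?_) ?_
    · simp only [hΨ]; rw [clamp_of_mem hy]
    · simp only [hΨ]; rw [clamp_of_mem hx]
  have cΨ : Continuous Ψ := (continuous_comp_clamp hH hfc).sub continuous_const
  -- Period 0 makes the periodicity requirement vacuous, so the gradient lemmas apply before
  -- periodicity with period L is known.
  have gΨ : HasGrad 0 H Ψ (fun x => -v₂ x) v₁ :=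
    ⟨cΨ, h2.cont.neg, h1.cont, fun x y => by rw [add_zero], hder⟩
  have b0 : ∀ s, Ψ (s, 0) = 0 := fun s => by
    rw [gΨ.eq_of_grad_fst_zero m0 (fun s => by rw [hbot, neg_zero]) s 0]
    simp only [hΨ]
    rw [clamp_of_mem (x := (0, 0)) ⟨mem_univ _, m0⟩, sub_self]
  have bH : ∀ s, Ψ (s, H) = Ψ (0, H) := fun s =>
    gΨ.eq_of_grad_fst_zero mH (fun s => by rw [htop, neg_zero]) s 0
  -- ∂₂Ψ = v₁ is periodic and Ψ vanishes on the bottom wall, so Ψ is periodic as well.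
  have per : ∀ x y, Ψ (x + L, y) = Ψ (x, y) := by
    have per' : ∀ x, ∀ y ∈ Icc 0 H, Ψ (x + L, y) = Ψ (x, y) := fun x y hy => by
      have := gΨ.sub_eq_of_grad_snd_eq (s := x + L) (t := x) (fun y => h1.per x y) hy
      rw [b0, b0, sub_self] at this
      exact sub_eq_zero.1 this
    intro x y
    have key : ∀ x, Ψ (x, y) = Ψ (clamp H (x, y)) := fun x => by
      simp only [hΨ]; rw [clamp_of_mem (clamp_mem hH _)]
    rw [key, key x]
    exact per' x _ (clamp_mem hH (x, y)).2
  exact ⟨Ψ, ⟨⟨cΨ, h2.cont.neg, h1.cont, per, hder⟩, h2.neg, h1⟩, b0, _, bH⟩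

theorem hasGrad_snd (L H : ℝ) : HasGrad L H (fun x => x.2) (fun _ => 0) (fun _ => 1) :=
  HasGrad.of_snd (a := id) (a' := fun _ => 1) continuous_id continuous_const
    (fun y _ => hasDerivWithinAt_id y _)

theorem HasGrad.integral_grad_snd {L H : ℝ} (hL : 0 < L) (hH : 0 < H) {f f₁ f₂ : ℝ × ℝ → ℝ}
    (h : HasGrad L H f f₁ f₂) : ∫ x, f₂ x ∂(channelMeasure L H) =
      (∫ x in (0 : ℝ)..L, f (x, H)) - ∫ x in (0 : ℝ)..L, f (x, 0) := by
  simpa using integral_divergence hL hH (HasGrad.const L H 0) h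

/-- The perturbation of a steady flow by an Euler flow: the vorticity `ω`, the stream function `χ` of
the perturbation (up to a uniform flow), and the conservation laws. Here `ωb` is the vorticity and `φ`
the relative stream function of the steady flow. -/
structure Perturbation (L H : ℝ) (ωb φ : ℝ × ℝ → ℝ) (ω χ χ₁ χ₂ : ℝ → ℝ × ℝ → ℝ) : Prop where
  cont : Continuous fun q : ℝ × (ℝ × ℝ) => ω q.1 q.2
  casimir : ∀ Φ : ℝ → ℝ, Continuous Φ → ∀ s t,
    ∫ x, Φ (ω s x) ∂(channelMeasure L H) = ∫ x, Φ (ω t x) ∂(channelMeasure L H)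
  momentum : ∀ s t, ∫ x, x.2 * ω s x ∂(channelMeasure L H) = ∫ x, x.2 * ω t x ∂(channelMeasure L H)
  grad : ∀ t, HasGrad L H (χ t) (χ₁ t) (χ₂ t)
  bottom : ∀ t s, χ t (s, 0) = 0
  top : ∀ t s, χ t (s, H) = 0
  dirichlet : ∀ t, ∫ x, (χ₁ t x ^ 2 + χ₂ t x ^ 2) ∂(channelMeasure L H) =
    ∫ x, (ω t x - ωb x) * χ t x ∂(channelMeasure L H)
  energy : ∀ s t, 1 / 2 * (∫ x, (χ₁ s x ^ 2 + χ₂ s x ^ 2) ∂(channelMeasure L H)) +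
      (∫ x, (ω s x - ωb x) * φ x ∂(channelMeasure L H)) =
    1 / 2 * (∫ x, (χ₁ t x ^ 2 + χ₂ t x ^ 2) ∂(channelMeasure L H)) +
      ∫ x, (ω t x - ωb x) * φ x ∂(channelMeasure L H)

namespace FlowData
variable {L H : ℝ} {v₁ v₂ v₁t v₂t v₁₁ v₁₂ v₂₁ v₂₂ ω ωt ω₁ ω₂ P P₁ P₂ : ℝ → ℝ × ℝ → ℝ}
  {f f₁ f₂ f₁₁ f₁₂ f₂₁ f₂₂ ωb : ℝ × ℝ → ℝ}
  (hL : 0 < L) (hH : 0 < H)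
  (D : FlowData L H v₁ v₂ v₁t v₂t v₁₁ v₁₂ v₂₁ v₂₂ ω ωt ω₁ ω₂ P P₁ P₂)
include hL hH D

/-- The difference of the two stream functions is constant on each wall. Subtracting c x₂, with c
the difference of the mean horizontal velocities, and a constant makes it vanish on both; c does not
depend on time because the mean velocity is conserved. The energy law follows by expanding |v|²
around the steady flow plus the uniform flow: the boundary terms involve only circulations along the
walls, which are conserved too. -/
theorem exists_perturbation (hf : HasHess L H f f₁ f₂ f₁₁ f₁₂ f₂₁ f₂₂) {a b : ℝ}
    (ha : ∀ s, f (s, 0) = a) (hb : ∀ s, f (s, H) = b)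
    (hω : Continuous ωb) (hωb : ∀ x ∈ strip H, ωb x = -(f₁₁ x + f₂₂ x)) (lam : ℝ) :
    ∃ χ χ₁ χ₂, Perturbation L H ωb (fun x => f x - lam * x.2) ω χ χ₁ χ₂ := by
  set c := ((∫ x, v₁ 0 x ∂(channelMeasure L H)) - ∫ x, f₂ x ∂(channelMeasure L H)) / (L * H) with hc
  have hcm : (∫ x, v₁ 0 x ∂(channelMeasure L H)) - (∫ x, f₂ x ∂(channelMeasure L H)) = c * (L * H) := by
    rw [hc]; field_simp
  have ic : ∫ _, c ∂(channelMeasure L H) = c * (L * H) := by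
    rw [integral_channel hL hH continuous_const]
    simp; ring
  have ex : ∀ t, ∃ χ : ℝ × ℝ → ℝ, HasHess L H χ (fun x => -v₂ t x - f₁ x) (fun x => v₁ t x - f₂ x - c)
      (fun x => -v₂₁ t x - f₁₁ x) (fun x => -v₂₂ t x - f₁₂ x) (fun x => v₁₁ t x - f₂₁ x)
      (fun x => v₁₂ t x - f₂₂ x) ∧ (∀ s, χ (s, 0) = 0) ∧ ∀ s, χ (s, H) = 0 := by
    intro t
    obtain ⟨Ψ, hΨ, h0, k, hk⟩ := exists_stream hH (D.grad1 t) (D.grad2 t) (D.divFree t) (D.bottom t) (D.top t)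
    have gχ := ((hΨ.grad.sub hf.grad).sub ((hasGrad_snd L H).const_mul c)).add (HasGrad.const L H a)
    have g1 : HasGrad L H (fun x => -v₂ t x - f₁ x) (fun x => -v₂₁ t x - f₁₁ x)
        (fun x => -v₂₂ t x - f₁₂ x) := hΨ.grad1.sub hf.grad1
    have g2 : HasGrad L H (fun x => v₁ t x - f₂ x - c) (fun x => v₁₁ t x - f₂₁ x)
        (fun x => v₁₂ t x - f₂₂ x) := by
      simpa using (hΨ.grad2.sub hf.grad2).sub (HasGrad.const L H c)
    have gχ' := gχ.congr_grad (g₁ := fun x => -v₂ t x - f₁ x) (g₂ := fun x => v₁ t x - f₂ x - c)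
      (by ext x; ring) (by ext x; ring)
    refine ⟨_, ⟨gχ', g1, g2⟩, fun s => ?_, ?_⟩
    · simp only; rw [h0, ha]; ring
    -- By the choice of c the vertical derivative has zero integral, so the constant values on the
    -- two walls coincide.
    · have key := gχ'.integral_grad_snd hL hH
      simp only [h0, hk, ha, hb] at key
      rw [channel_sub (f := fun x => v₁ t x - f₂ x) (g := fun _ => c)
        ((D.grad1 t).cont.sub hf.grad.cont2) continuous_const, channel_sub (D.grad1 t).cont hf.grad.cont2,
        D.integral_velocity hL hH t 0, ic, hcm, sub_self] at key
      simp only [intervalIntegral.integral_const, smul_eq_mul] at key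
      have key2 : L * (k - b - c * H + a) = 0 := by linear_combination -key
      intro s
      simp only [hk, hb]
      exact (mul_eq_zero.1 key2).resolve_left hL.ne'
  choose χ hχ hχ0 hχH using ex
  have cq : ∀ t, Continuous (fun x => ω t x - ωb x) := fun t => (D.gradω t).cont.sub hω
  have hq : ∀ t, ∀ x ∈ strip H, -((-v₂₁ t x - f₁₁ x) + (v₁₂ t x - f₂₂ x)) = ω t x - ωb x := fun t x hx => by
    rw [hωb x hx, D.vort t x hx]; ring
  have grn : ∀ t {w w₁ w₂ : ℝ × ℝ → ℝ}, HasGrad L H w w₁ w₂ → ∀ {a b : ℝ}, (∀ s, w (s, 0) = a) →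
      (∀ s, w (s, H) = b) →
      ∫ x, (w₁ x * (-v₂ t x - f₁ x) + w₂ x * (v₁ t x - f₂ x - c)) ∂(channelMeasure L H) =
      (∫ x, (ω t x - ωb x) * w x ∂(channelMeasure L H)) +
      (b * (∫ x in (0 : ℝ)..L, (v₁ t (x, H) - f₂ (x, H) - c)) -
        a * ∫ x in (0 : ℝ)..L, (v₁ t (x, 0) - f₂ (x, 0) - c)) := by
    intro t w w₁ w₂ hw a b ha hb
    rw [green hL hH hw (hχ t) ha hb]
    congr 1
    refine channel_congr fun x hx => ?_
    rw [hq t x hx, mul_comm]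
  have mean0 : ∀ t, ∫ x, (v₁ t x - f₂ x - c) ∂(channelMeasure L H) = 0 := fun t => by
    rw [(hχ t).grad.integral_grad_snd hL hH]; simp [hχ0, hχH]
  refine ⟨χ, fun t x => -v₂ t x - f₁ x, fun t x => v₁ t x - f₂ x - c, D.timeω.cont,
    fun Φ hΦ => D.integral_comp_vorticity hL hH hΦ, D.integral_snd_mul_vorticity hL hH,
    fun t => (hχ t).grad, hχ0, hχH, fun t => ?_, fun s t => ?_⟩
  · have := grn t (hχ t).grad (hχ0 t) (hχH t)
    simp only [zero_mul, sub_zero, add_zero] at this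
    rw [← this]
    refine integral_congr_ae (ae_of_all _ fun x => ?_)
    simp only; ring
  · have iω : ∀ s t, ∫ x, (ω s x - ωb x) ∂(channelMeasure L H) = ∫ x, (ω t x - ωb x) ∂(channelMeasure L H) := by
      intro s t
      rw [channel_sub (D.gradω s).cont hω, channel_sub (D.gradω t).cont hω]
      have := D.integral_comp_vorticity hL hH continuous_id s t
      simp only [id] at this
      rw [this]
    have iy : ∀ s t, ∫ x, (ω s x - ωb x) * x.2 ∂(channelMeasure L H) =
        ∫ x, (ω t x - ωb x) * x.2 ∂(channelMeasure L H) := by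
      have e : ∀ t, ∫ x, (ω t x - ωb x) * x.2 ∂(channelMeasure L H) =
          (∫ x, x.2 * ω t x ∂(channelMeasure L H)) - ∫ x, x.2 * ωb x ∂(channelMeasure L H) := fun t => by
        rw [← channel_sub (f := fun x => x.2 * ω t x) (g := fun x => x.2 * ωb x)
          (continuous_snd.mul (D.gradω t).cont) (continuous_snd.mul hω)]
        refine integral_congr_ae (ae_of_all _ fun x => ?_)
        simp only; ring
      intro s t
      rw [e, e, D.integral_snd_mul_vorticity hL hH s t]
    -- Green's identity tested with x₂ and, in `by0`, with 1. It expresses the wall circulations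
    -- through the momentum and the total vorticity, hence they are constant in time.
    have by1 : ∀ t, (∫ x, (ω t x - ωb x) * x.2 ∂(channelMeasure L H)) +
        H * (∫ x in (0 : ℝ)..L, (v₁ t (x, H) - f₂ (x, H) - c)) = 0 := fun t => by
      have := grn t (hasGrad_snd L H) (a := 0) (b := H) (fun _ => rfl) (fun _ => rfl)
      simp only [zero_mul, one_mul, zero_add, sub_zero] at this
      rw [← this, mean0]
    have by0 : ∀ t, (∫ x, (ω t x - ωb x) ∂(channelMeasure L H)) +
        ((∫ x in (0 : ℝ)..L, (v₁ t (x, H) - f₂ (x, H) - c)) -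
          ∫ x in (0 : ℝ)..L, (v₁ t (x, 0) - f₂ (x, 0) - c)) = 0 := fun t => by
      have := grn t (HasGrad.const L H 1) (a := 1) (b := 1) (fun _ => rfl) (fun _ => rfl)
      simp only [zero_mul, one_mul, zero_add, mul_one, integral_zero] at this
      rw [← this]
    have en : ∀ t, (∫ x, (v₁ t x ^ 2 + v₂ t x ^ 2) ∂(channelMeasure L H)) =
        (∫ x, ((-v₂ t x - f₁ x) ^ 2 + (v₁ t x - f₂ x - c) ^ 2) ∂(channelMeasure L H)) +
        2 * ((∫ x, (ω t x - ωb x) * f x ∂(channelMeasure L H)) +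
          (b * (∫ x in (0 : ℝ)..L, (v₁ t (x, H) - f₂ (x, H) - c)) -
            a * ∫ x in (0 : ℝ)..L, (v₁ t (x, 0) - f₂ (x, 0) - c))) +
        (∫ x, (f₁ x ^ 2 + (f₂ x + c) ^ 2) ∂(channelMeasure L H)) := by
      intro t
      have c1 := (D.grad1 t).cont
      have c2 := (D.grad2 t).cont
      have k1 := hf.grad.cont1
      have k2 := hf.grad.cont2
      rw [← grn t hf.grad ha hb]
      have z := mean0 t
      rw [← integral_const_mul]
      have z2 : ∫ x, 2 * c * (v₁ t x - f₂ x - c) ∂(channelMeasure L H) = 0 := by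
        rw [integral_const_mul, z, mul_zero]
      rw [← add_zero (∫ x, (f₁ x ^ 2 + (f₂ x + c) ^ 2) ∂(channelMeasure L H)), ← z2,
        ← integral_add, ← integral_add, ← integral_add]
      · refine integral_congr_ae (ae_of_all _ fun x => ?_)
        simp only; ring
      all_goals
        refine integrable_channel L H ?_
        fun_prop
    have sp : ∀ t, ∫ x, (ω t x - ωb x) * (f x - lam * x.2) ∂(channelMeasure L H) =
        (∫ x, (ω t x - ωb x) * f x ∂(channelMeasure L H)) -
        lam * ∫ x, (ω t x - ωb x) * x.2 ∂(channelMeasure L H) := fun t => by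
      rw [← integral_const_mul, ← channel_sub (f := fun x => (ω t x - ωb x) * f x)
        (g := fun x => lam * ((ω t x - ωb x) * x.2)) ((cq t).mul hf.grad.cont)
        (((cq t).mul continuous_snd).const_mul lam)]
      refine integral_congr_ae (ae_of_all _ fun x => ?_)
      simp only; ring
    rw [sp, sp]
    have e1 := en s
    have e2 := en t
    have e3 := D.integral_energy hL hH s t
    have b1s := by1 s
    have b1t := by1 t
    have b0s := by0 s
    have b0t := by0 t
    have i1 := iω s t
    have i2 := iy s t
    generalize (∫ x in (0 : ℝ)..L, (v₁ s (x, H) - f₂ (x, H) - c)) = X1 at *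
    generalize (∫ x in (0 : ℝ)..L, (v₁ t (x, H) - f₂ (x, H) - c)) = X2 at *
    generalize (∫ x in (0 : ℝ)..L, (v₁ s (x, 0) - f₂ (x, 0) - c)) = Y1 at *
    generalize (∫ x in (0 : ℝ)..L, (v₁ t (x, 0) - f₂ (x, 0) - c)) = Y2 at *
    have hX : X1 = X2 := by
      have : H * (X1 - X2) = 0 := by linear_combination b1s - b1t - i2
      exact sub_eq_zero.1 ((mul_eq_zero.1 this).resolve_left hH.ne')
    have hY : Y1 = Y2 := by linear_combination i1 - b0s + b0t + hX
    rw [hX, hY] at e1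
    linear_combination (e3 - e1 + e2) / 2 - lam * i2

end FlowData

theorem IsEulerFlow.exists_perturbation {L H : ℝ} (hL : 0 < L) (hH : 0 < H) {g : ℝ → ℝ}
    (hg : Continuous g) {lam : ℝ} {ψ : ℝ × ℝ → ℝ} (hψ : SolvesStreamEquation L H g lam ψ)
    {v : ℝ → ℝ × ℝ → ℝ × ℝ} (hv : IsEulerFlow L H v) :
    ∃ ω χ χ₁ χ₂, Perturbation L H (fun x => g (relStream H lam ψ x)) (relStream H lam ψ) ω χ χ₁ χ₂ ∧
      ∀ t, ∀ x ∈ strip H, vorticity (v t) x = ω t x := by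
  obtain ⟨v₁, v₂, v₁t, v₂t, v₁₁, v₁₂, v₂₁, v₂₂, ω, ωt, ω₁, ω₂, P, P₁, P₂, D, hω⟩ := hv.exists_flowData hH
  have cφ := continuous_relStream hL hH lam hψ.1
  obtain ⟨hC2, heq, ⟨a, ha⟩, b, hb⟩ := hψ
  obtain ⟨f₁, f₂, f₁₁, f₁₂, f₂₁, f₂₂, hf⟩ := hC2.exists_hasHess hH
  have m0 : ∀ s, ((s, 0) : ℝ × ℝ) ∈ closedStrip H := fun s => ⟨mem_univ _, le_rfl, hH.le⟩
  have mH : ∀ s, ((s, H) : ℝ × ℝ) ∈ closedStrip H := fun s => ⟨mem_univ _, hH.le, le_rfl⟩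
  obtain ⟨χ, χ₁, χ₂, hχ⟩ := D.exists_perturbation hL hH hf (a := a) (b := b)
    (fun s => by rw [clamp_of_mem (m0 s), ha]) (fun s => by rw [clamp_of_mem (mH s), hb])
    (ωb := fun x => g (relStream H lam ψ x)) (hg.comp cφ) (fun x hx => by
      have hcx := clamp_of_mem (strip_subset H hx)
      rw [← hf.lap_eq hx, lap_congr (g := ψ) (fun z hz => by rw [clamp_of_mem (strip_subset H hz)]) hx,
        heq x hx]
      simp only [relStream, hcx]) lam
  refine ⟨ω, χ, χ₁, χ₂, ?_, hω⟩
  have e : ∀ w : ℝ × ℝ → ℝ, ∫ x, w x * (ψ (clamp H x) - lam * x.2) ∂(channelMeasure L H) =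
      ∫ x, w x * relStream H lam ψ x ∂(channelMeasure L H) := fun w =>
    channel_congr fun x hx => by simp only [relStream, clamp_of_mem (strip_subset H hx)]
  exact { hχ with energy := fun s t => by rw [← e, ← e]; exact hχ.energy s t }

/-! ### Truncation of the vorticity and a Legendre transform. -/

/-- Truncation of a real number to `[-M, M]`. -/
def clip (M s : ℝ) : ℝ := max (-M) (min M s)

theorem continuous_clip (M : ℝ) : Continuous (clip M) := by unfold clip; fun_prop

theorem abs_clip_le {M : ℝ} (hM : 0 ≤ M) (s : ℝ) : |clip M s| ≤ M :=
  abs_le.2 ⟨le_max_left _ _, max_le (by linarith) (min_le_left _ _)⟩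

theorem clip_of_abs_le {M s : ℝ} (h : |s| ≤ M) : clip M s = s := by
  have := abs_le.1 h
  rw [clip, min_eq_right this.2, max_eq_right this.1]

theorem abs_clip_sub_clip_le (M s t : ℝ) : |clip M s - clip M t| ≤ |s - t| := by
  unfold clip
  refine (abs_max_sub_max_le_max _ _ _ _).trans (max_le (by simp) ?_)
  exact (abs_min_sub_min_le_max _ _ _ _).trans (max_le (by simp) le_rfl)

/-- `clip M s` is the point of [-M, M] nearest to s. -/
theorem abs_sub_clip_le {M : ℝ} (s : ℝ) {w : ℝ} (h : |w| ≤ M) : |s - clip M s| ≤ |s - w| := by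
  obtain ⟨h1, h2⟩ := abs_le.1 h
  unfold clip
  rcases le_total M s with hs | hs
  · rw [min_eq_left hs, max_eq_right (by linarith), abs_of_nonneg (by linarith)]
    exact (by linarith : s - M ≤ s - w).trans (le_abs_self _)
  · rw [min_eq_right hs]
    rcases le_total (-M) s with hs' | hs'
    · rw [max_eq_right hs', sub_self, abs_zero]; exact abs_nonneg _
    · rw [max_eq_left hs', abs_of_nonpos (by linarith)]
      exact (by linarith : -(s - -M) ≤ -(s - w)).trans (neg_le_abs _)

theorem le_of_hasDerivAt_mul_sub_nonneg {f f' : ℝ → ℝ} (hf : ∀ x, HasDerivAt f (f' x) x) {a : ℝ}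
    (h : ∀ x, 0 ≤ f' x * (x - a)) (x : ℝ) : f a ≤ f x := by
  rcases lt_trichotomy a x with hx | rfl | hx
  · obtain ⟨c, hc, h1⟩ := exists_hasDerivAt_eq_slope f f' hx
      (fun y _ => (hf y).continuousAt.continuousWithinAt) (fun y _ => hf y)
    have : 0 ≤ f' c := nonneg_of_mul_nonneg_left (h c) (by linarith [hc.1])
    rw [h1] at this
    have := mul_nonneg this (sub_nonneg.2 hx.le)
    rw [div_mul_cancel₀ _ (sub_ne_zero.2 hx.ne')] at this
    linarith
  · exact le_rfl
  · obtain ⟨c, hc, h1⟩ := exists_hasDerivAt_eq_slope f f' hx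
      (fun y _ => (hf y).continuousAt.continuousWithinAt) (fun y _ => hf y)
    have : f' c ≤ 0 := by
      by_contra hcon
      have := mul_neg_of_pos_of_neg (not_le.1 hcon) (sub_neg.2 hc.2)
      linarith [h c]
    rw [h1] at this
    have := mul_nonpos_of_nonpos_of_nonneg this (sub_nonneg.2 hx.le)
    rw [div_mul_cancel₀ _ (sub_ne_zero.2 hx.ne')] at this
    linarith

theorem SlopeBound.mul_sub_bounds {γ : ℝ → ℝ} {Λ : ℝ} (h : SlopeBound γ univ Λ) (a b : ℝ) :
    0 ≤ (γ b - γ a) * (b - a) ∧ 0 ≤ (Λ * (b - a) - (γ b - γ a)) * (b - a) := by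
  rcases le_total a b with hab | hab
  · have := h a (mem_univ _) b (mem_univ _) hab
    exact ⟨mul_nonneg this.1 (sub_nonneg.2 hab), mul_nonneg (by linarith) (sub_nonneg.2 hab)⟩
  · have := h b (mem_univ _) a (mem_univ _) hab
    exact ⟨mul_nonneg_of_nonpos_of_nonpos (by linarith) (by linarith),
      mul_nonneg_of_nonpos_of_nonpos (by linarith) (by linarith)⟩

/-- A truncated Legendre transform: a Lipschitz function `F` that is uniformly convex along the
graph of a nondecreasing function with slopes at most `Λ`. -/
theorem exists_legendre {γ : ℝ → ℝ} (hγ : Continuous γ) {Λ : ℝ} (hΛ : 0 < Λ)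
    (hs : SlopeBound γ univ Λ) (M R : ℝ) (hM : 0 ≤ M) (hR : 0 ≤ R) :
    ∃ F : ℝ → ℝ, ∃ T, 0 ≤ T ∧ (∀ s t, |F s - F t| ≤ T * |s - t|) ∧
      ∀ a s, |a| ≤ R → |γ a| ≤ M → |s| ≤ M →
        F (γ a) + a * (s - γ a) + (s - γ a) ^ 2 / (2 * Λ) ≤ F s := by
  set G : ℝ → ℝ := fun τ => ∫ σ in (0 : ℝ)..τ, γ σ with hG
  have hG' : ∀ τ, HasDerivAt G (γ τ) τ := fun τ =>
    intervalIntegral.integral_hasDerivAt_right (hγ.intervalIntegrable _ _)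
      (hγ.stronglyMeasurableAtFilter _ _) hγ.continuousAt
  have cG : Continuous G := continuous_iff_continuousAt.2 fun τ => (hG' τ).continuousAt
  have low : ∀ a τ, G a + γ a * (τ - a) ≤ G τ := by
    intro a τ
    have := le_of_hasDerivAt_mul_sub_nonneg (f := fun x => G x - γ a * x) (f' := fun x => γ x - γ a)
      (a := a) (fun x => by
        have := (hG' x).sub ((hasDerivAt_id x).const_mul (γ a)); rw [mul_one] at this; exact this)
      (fun x => (hs.mul_sub_bounds a x).1) τ
    linarith
  have up : ∀ a τ, G τ ≤ G a + γ a * (τ - a) + Λ / 2 * (τ - a) ^ 2 := by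
    intro a τ
    have := le_of_hasDerivAt_mul_sub_nonneg
      (f := fun x => Λ / 2 * (x - a) ^ 2 + γ a * x - G x)
      (f' := fun x => Λ * (x - a) - (γ x - γ a))
      (a := a) (fun x => by
        have := (((((hasDerivAt_id x).sub_const a).pow 2).const_mul (Λ / 2)).add
          ((hasDerivAt_id x).const_mul (γ a))).sub (hG' x)
        refine this.congr_deriv ?_
        simp; ring)
      (fun x => (hs.mul_sub_bounds a x).2) τ
    simp only [sub_self] at this
    linarith
  -- The supremum defining F runs over [-T, T] only, so F is finite and T-Lipschitz. T is just large
  -- enough to contain the competitor a + (s - γ a)/Λ used at the end.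
  set T := R + 2 * M / Λ with hT
  have hT0 : 0 ≤ T := by positivity
  have cpt : ∀ s, BddAbove ((fun τ => s * τ - G τ) '' Icc (-T) T) := fun s =>
    (isCompact_Icc.image (by fun_prop)).bddAbove
  have ne : ∀ s, ((fun τ => s * τ - G τ) '' Icc (-T) T).Nonempty := fun s =>
    (nonempty_Icc.2 (by linarith)).image _
  set F : ℝ → ℝ := fun s => sSup ((fun τ => s * τ - G τ) '' Icc (-T) T) with hF
  have leF : ∀ s, ∀ τ ∈ Icc (-T) T, s * τ - G τ ≤ F s := fun s τ hτ =>
    le_csSup (cpt s) ⟨τ, hτ, rfl⟩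
  have lip : ∀ s t, F s - F t ≤ T * |s - t| := by
    intro s t
    rw [sub_le_iff_le_add]
    refine csSup_le (ne s) ?_
    rintro _ ⟨τ, hτ, rfl⟩
    have h1 := leF t τ hτ
    have h2 : (s - t) * τ ≤ T * |s - t| := by
      calc (s - t) * τ ≤ |(s - t) * τ| := le_abs_self _
        _ = |τ| * |s - t| := by rw [abs_mul, mul_comm]
        _ ≤ T * |s - t| := by gcongr; exact abs_le.2 hτ
    simp only
    linarith
  refine ⟨F, T, hT0, fun s t => abs_le.2 ⟨?_, lip s t⟩, ?_⟩
  · have := lip t s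
    rw [abs_sub_comm] at this
    linarith
  intro a s ha hga hs'
  have h1 : F (γ a) ≤ γ a * a - G a := by
    refine csSup_le (ne _) ?_
    rintro _ ⟨τ, -, rfl⟩
    have := low a τ
    simp only; linarith
  -- This point optimizes the quadratic upper bound of G at a, and inserting it yields the gain (s -
  -- γ a)²/(2Λ).
  have hτ : a + (s - γ a) / Λ ∈ Icc (-T) T := by
    rw [mem_Icc, ← abs_le]
    refine (abs_add_le _ _).trans (add_le_add ha ?_)
    rw [abs_div, abs_of_pos hΛ]
    gcongr
    exact (abs_sub _ _).trans (by linarith)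
  have h2 := leF s _ hτ
  have h3 := up a (a + (s - γ a) / Λ)
  have e1 : γ a * (a + (s - γ a) / Λ - a) + Λ / 2 * (a + (s - γ a) / Λ - a) ^ 2 =
    γ a * (s - γ a) / Λ + (s - γ a) ^ 2 / (2 * Λ) := by field_simp; ring
  have e2 : s * (a + (s - γ a) / Λ) = γ a * a + a * (s - γ a) + γ a * (s - γ a) / Λ +
    2 * ((s - γ a) ^ 2 / (2 * Λ)) := by field_simp; ring
  linarith

/-- A function with slopes in `[0, Λ]` on an interval extends to one on the line. -/
theorem SlopeBound.extend {g : ℝ → ℝ} {α β Λ : ℝ} (hαβ : α ≤ β) (hΛ : 0 ≤ Λ)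
    (h : SlopeBound g (Icc α β) Λ) : SlopeBound (fun s => g (max α (min β s))) univ Λ := by
  intro a _ b _ hab
  have hm : ∀ s, max α (min β s) ∈ Icc α β := fun s =>
    ⟨le_max_left _ _, max_le hαβ (min_le_left _ _)⟩
  have hle : max α (min β a) ≤ max α (min β b) := max_le_max le_rfl (min_le_min le_rfl hab)
  have h1 := h _ (hm a) _ (hm b) hle
  refine ⟨h1.1, h1.2.trans (mul_le_mul_of_nonneg_left ?_ hΛ)⟩
  have := (abs_max_sub_max_le_max α (min β b) α (min β a)).trans
    (max_le (by simp) ((abs_min_sub_min_le_max β b β a).trans (max_le (by simp) le_rfl)))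
  rw [abs_of_nonneg (sub_nonneg.2 hab)] at this
  exact (le_abs_self _).trans this

theorem channel_mono_cell {L H : ℝ} {f g : ℝ × ℝ → ℝ} (hf : Continuous f) (hg : Continuous g)
    (h : ∀ x ∈ Icc 0 L ×ˢ Icc 0 H, f x ≤ g x) :
    ∫ x, f x ∂(channelMeasure L H) ≤ ∫ x, g x ∂(channelMeasure L H) :=
  integral_mono_ae (integrable_channel L H hf) (integrable_channel L H hg) (ae_channelMeasure_cell h)

theorem abs_channel_mul_le {L H K : ℝ} {f g : ℝ × ℝ → ℝ} (hf : Continuous f) (hg : Continuous g)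
    (h : ∀ x ∈ Icc 0 L ×ˢ Icc 0 H, |g x| ≤ K) :
    |∫ x, f x * g x ∂(channelMeasure L H)| ≤ K * ∫ x, |f x| ∂(channelMeasure L H) := by
  rw [← integral_const_mul]
  refine (abs_integral_le_integral_abs).trans (channel_mono_cell (by fun_prop) (by fun_prop) fun x hx => ?_)
  rw [abs_mul, mul_comm]
  exact mul_le_mul_of_nonneg_right (h x hx) (abs_nonneg _)

namespace Perturbation
variable {L H : ℝ} (hL : 0 < L) (hH : 0 < H) {ωb φ : ℝ × ℝ → ℝ} {ω χ χ₁ χ₂ : ℝ → ℝ × ℝ → ℝ}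
  (P : Perturbation L H ωb φ ω χ χ₁ χ₂)
  (hωb : Continuous ωb) {M : ℝ} (hM : ∀ x ∈ Icc 0 L ×ˢ Icc 0 H, |ωb x| ≤ M)

include P in
theorem continuous_slice (t : ℝ) : Continuous (ω t) := P.cont.comp (Continuous.prodMk_right t)

include P in
theorem continuous_clip_slice (M t : ℝ) : Continuous fun x => clip M (ω t x) :=
  (continuous_clip M).comp (P.continuous_slice t)

include P hωb hM

/-- The left side is the integral of a continuous function of ω, hence equal to its value at time 0.
There `clip M` is a nearest-point projection and ω̄ takes values in [-M, M]. -/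
theorem integral_abs_sub_clip_rpow_le {s : ℝ} (hs : 0 ≤ s) (t : ℝ) :
    ∫ x, |ω t x - clip M (ω t x)| ^ s ∂(channelMeasure L H) ≤
      ∫ x, |ω 0 x - ωb x| ^ s ∂(channelMeasure L H) := by
  have cp : ∀ {f : ℝ × ℝ → ℝ}, Continuous f → Continuous fun x => |f x| ^ s := fun hf =>
    hf.abs.rpow_const fun _ => Or.inr hs
  have cc := continuous_clip M
  rw [P.casimir (fun z => |z - clip M z| ^ s)
    (((continuous_id.sub cc).abs).rpow_const fun _ => Or.inr hs) t 0]
  refine channel_mono_cell (cp ((P.continuous_slice 0).sub (P.continuous_clip_slice M 0)))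
    (cp ((P.continuous_slice 0).sub hωb)) fun x hx => ?_
  exact Real.rpow_le_rpow (abs_nonneg _) (abs_sub_clip_le _ (hM x hx)) hs

theorem integral_abs_sub_clip_le (t : ℝ) :
    ∫ x, |ω t x - clip M (ω t x)| ∂(channelMeasure L H) ≤
      ∫ x, |ω 0 x - ωb x| ∂(channelMeasure L H) := by
  simpa using P.integral_abs_sub_clip_rpow_le hωb hM zero_le_one t

/-- Conservation moves the left integral to time 0, where `clip M` does not increase the distance to
ω̄; the Lipschitz bound on f is needed only on [-M, M]. -/
theorem abs_integral_comp_clip_sub_le {f : ℝ → ℝ} {K : ℝ} (hf : Continuous f)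
    (hK : ∀ s t, |s| ≤ M → |t| ≤ M → |f s - f t| ≤ K * |s - t|) (t : ℝ) :
    |(∫ x, f (clip M (ω t x)) ∂(channelMeasure L H)) - ∫ x, f (ωb x) ∂(channelMeasure L H)| ≤
      |K| * ∫ x, |ω 0 x - ωb x| ∂(channelMeasure L H) := by
  have c0 := P.continuous_slice 0
  have cc := P.continuous_clip_slice M 0
  rw [P.casimir (fun z => f (clip M z)) (hf.comp (continuous_clip M)) t 0,
    ← channel_sub (f := fun x => f (clip M (ω 0 x))) (g := fun x => f (ωb x)) (hf.comp cc) (hf.comp hωb),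
    ← integral_const_mul]
  refine (abs_integral_le_integral_abs).trans (channel_mono_cell (by fun_prop) (by fun_prop) fun x hx => ?_)
  have hM0 : 0 ≤ M := (abs_nonneg _).trans (hM x hx)
  refine (hK _ _ (abs_clip_le hM0 _) (hM x hx)).trans ?_
  have := abs_clip_sub_clip_le M (ω 0 x) (ωb x)
  rw [clip_of_abs_le (hM x hx)] at this
  exact mul_le_mul (le_abs_self K) this (abs_nonneg _) (abs_nonneg _)

theorem abs_integral_clip_sub_le (t : ℝ) :
    |∫ x, (clip M (ω t x) - ωb x) ∂(channelMeasure L H)| ≤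
      ∫ x, |ω 0 x - ωb x| ∂(channelMeasure L H) := by
  rw [channel_sub (P.continuous_clip_slice M t) hωb]
  simpa using P.abs_integral_comp_clip_sub_le hωb hM (f := id) (K := 1) continuous_id
    (fun s t _ _ => by simp) t

/-- The momentum is conserved for ω, not for its truncation; the tail costs a second multiple of the
initial L¹ distance. -/
theorem abs_integral_snd_mul_clip_sub_le (t : ℝ) :
    |∫ x, x.2 * (clip M (ω t x) - ωb x) ∂(channelMeasure L H)| ≤
      2 * H * ∫ x, |ω 0 x - ωb x| ∂(channelMeasure L H) := by
  have c := fun t => P.continuous_slice t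
  have cc := P.continuous_clip_slice M t
  have hy : ∀ x ∈ Icc 0 L ×ˢ Icc 0 H, |x.2| ≤ H := fun x hx => by
    rw [abs_of_nonneg hx.2.1]; exact hx.2.2
  have e : ∫ x, x.2 * (clip M (ω t x) - ωb x) ∂(channelMeasure L H) =
      (∫ x, (ω 0 x - ωb x) * x.2 ∂(channelMeasure L H)) -
        ∫ x, (ω t x - clip M (ω t x)) * x.2 ∂(channelMeasure L H) := by
    have h := P.momentum t 0
    have c0 := c 0
    have ct := c t
    have e1 : ∫ x, (ω 0 x - ωb x) * x.2 ∂(channelMeasure L H) =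
        (∫ x, x.2 * ω 0 x ∂(channelMeasure L H)) - ∫ x, x.2 * ωb x ∂(channelMeasure L H) := by
      rw [← channel_sub (f := fun x => x.2 * ω 0 x) (g := fun x => x.2 * ωb x) (by fun_prop) (by fun_prop)]
      exact integral_congr_ae (ae_of_all _ fun x => by ring)
    rw [e1, ← h, ← channel_sub (f := fun x => x.2 * ω t x) (g := fun x => x.2 * ωb x) (by fun_prop) (by fun_prop),
      ← channel_sub (f := fun x => x.2 * ω t x - x.2 * ωb x)
      (g := fun x => (ω t x - clip M (ω t x)) * x.2) (by fun_prop) (by fun_prop)]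
    exact integral_congr_ae (ae_of_all _ fun x => by ring)
  rw [e]
  have h1 := abs_channel_mul_le (L := L) (f := fun x => ω 0 x - ωb x) (g := fun x => x.2)
    ((c 0).sub hωb) continuous_snd hy
  have h2 := abs_channel_mul_le (L := L) (f := fun x => ω t x - clip M (ω t x)) (g := fun x => x.2)
    ((c t).sub cc) continuous_snd hy
  refine (abs_sub _ _).trans ((add_le_add h1 h2).trans ?_)
  -- Positivity of H is not in scope here; for H ≤ 0 the channel is a null set.
  rcases le_total 0 H with hH | hH
  · have := mul_le_mul_of_nonneg_left (P.integral_abs_sub_clip_le hωb hM t) hH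
    linarith
  · have h0 : channelMeasure L H = 0 := by
      rw [channelMeasure, Ioo_eq_empty (by simpa using hH), prod_empty, Measure.restrict_empty]
    simp [h0]

end Perturbation

/-! ### The energy-Casimir estimate and the approximation by modes. -/

/-- The energy-Casimir estimate. -/
theorem exists_pseudoenergy_bound {L H : ℝ} (hL : 0 < L) (hH : 0 < H) {ωb φ : ℝ × ℝ → ℝ} {γ : ℝ → ℝ}
    {M Λ r : ℝ} {n : ℕ}
    (hωb : Continuous ωb) (hM0 : 0 ≤ M) (hM : ∀ x ∈ Icc 0 L ×ˢ Icc 0 H, |ωb x| ≤ M)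
    (hφ : Continuous φ) (hγ : Continuous γ) (hΛ : 0 < Λ) (hs : SlopeBound γ univ Λ)
    (hγφ : ∀ x ∈ Icc 0 L ×ˢ Icc 0 H, ωb x = γ (φ x)) (hn : n ≠ 0) (hr : r.HolderConjugate (2 * n)) :
    ∃ K, 0 ≤ K ∧ ∀ ω χ χ₁ χ₂, Perturbation L H ωb φ ω χ χ₁ χ₂ → ∀ d, 0 ≤ d → d ≤ 1 →
      ∫ x, |ω 0 x - ωb x| ∂(channelMeasure L H) ≤ d →
      (∫ x, |ω 0 x - ωb x| ^ r ∂(channelMeasure L H)) ^ (1 / r) ≤ d →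
      ∀ t, 1 / (2 * Λ) * (∫ x, (clip M (ω t x) - ωb x -
          Λ * (χ t x - channelMean L H (χ t))) ^ 2 ∂(channelMeasure L H)) +
        1 / 2 * ((∫ x, (χ₁ t x ^ 2 + χ₂ t x ^ 2) ∂(channelMeasure L H)) -
          Λ * ∫ x, (χ t x - channelMean L H (χ t)) ^ 2 ∂(channelMeasure L H)) ≤ K * d := by
  obtain ⟨R, hR0, hR⟩ := exists_channel_bound L H hφ
  obtain ⟨F, T, hT0, hFT, hF⟩ := exists_legendre hγ hΛ hs M R hM0 hR0
  obtain ⟨C, hC0, hC⟩ := sobolev_dual hL hH hn hr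
  have hr0 : 0 ≤ r := hr.nonneg
  have cF : Continuous F := by
    refine (LipschitzWith.of_dist_le_mul (K := ⟨T, hT0⟩) fun s t => ?_).continuous
    exact hFT s t
  set m₁ := (∫ _, |2 * M| ^ r ∂(channelMeasure L H)) ^ (1 / r) with hm₁
  set m₂ := (∫ _, |(1 : ℝ)| ^ r ∂(channelMeasure L H)) ^ (1 / r) with hm₂
  have rp0 : ∀ f : ℝ × ℝ → ℝ, 0 ≤ ∫ x, |f x| ^ r ∂(channelMeasure L H) := fun f =>
    integral_nonneg fun x => by positivity
  have hm₁0 : 0 ≤ m₁ := Real.rpow_nonneg (rp0 fun _ => _) _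
  have hm₂0 : 0 ≤ m₂ := Real.rpow_nonneg (rp0 fun _ => _) _
  -- A priori bound for ‖∇χ‖: the truncated part of the perturbation has L^r norm at most `m₁`, that
  -- of the constant 2M, and the tail has L^r norm at most d ≤ 1.
  set N₁ := C * (m₁ + 1) with hN₁
  have hN₁0 : 0 ≤ N₁ := by positivity
  -- One term per error: variation of the integral of F, initial energy pairing, tail against φ,
  -- tail against χ, and the mean of χ against the mean of the truncated perturbation.
  refine ⟨T + R + R + C * N₁ + 1 / (L * H) * (C * m₂ * N₁), by positivity, ?_⟩
  intro ω χ χ₁ χ₂ P d hd0 hd1 hd hdr t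
  have cω := P.continuous_slice
  have cc := P.continuous_clip_slice M
  have cχ := (P.grad t).cont
  have crp : ∀ {f : ℝ × ℝ → ℝ}, Continuous f → Continuous fun x => |f x| ^ r := fun hf =>
    hf.abs.rpow_const fun _ => Or.inr hr0
  set η : ℝ × ℝ → ℝ := fun x => clip M (ω t x) with hη
  have cη : Continuous η := cc t
  set μ := channelMean L H (χ t) with hμ
  -- the gradient is controlled
  set G : ℝ → ℝ := fun t => ∫ x, (χ₁ t x ^ 2 + χ₂ t x ^ 2) ∂(channelMeasure L H) with hG
  have hG0 : ∀ t, 0 ≤ G t := fun t => integral_nonneg fun x => by positivity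
  have hGs : ∀ t, √(G t) * √(G t) = G t := fun t => Real.mul_self_sqrt (hG0 t)
  have cancel : ∀ {K t}, 0 ≤ K → G t ≤ K * √(G t) → √(G t) ≤ K := by
    intro K t hK h
    rcases eq_or_lt_of_le (Real.sqrt_nonneg (G t)) with h0 | h0
    · rw [← h0]; exact hK
    · exact le_of_mul_le_mul_right ((hGs t).trans_le h) h0
  have hrt : |∫ x, (ω t x - η x) * χ t x ∂(channelMeasure L H)| ≤ C * d * √(G t) := by
    refine (hC _ _ _ (fun x => ω t x - η x) (P.grad t) (P.bottom t) ((cω t).sub cη)).trans ?_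
    gcongr
    refine le_trans (Real.rpow_le_rpow (rp0 _) ?_ (by have := hr.pos; positivity)) hdr
    exact P.integral_abs_sub_clip_rpow_le hωb hM hr0 t
  have hht : |∫ x, (η x - ωb x) * χ t x ∂(channelMeasure L H)| ≤ C * m₁ * √(G t) := by
    refine (hC _ _ _ (fun x => η x - ωb x) (P.grad t) (P.bottom t) (cη.sub hωb)).trans ?_
    gcongr
    refine Real.rpow_le_rpow (rp0 _) ?_ (by have := hr.pos; positivity)
    refine channel_mono_cell (crp (cη.sub hωb)) (by fun_prop) fun x hx => ?_
    refine Real.rpow_le_rpow (abs_nonneg _) ?_ hr0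
    rw [abs_of_nonneg (by linarith : 0 ≤ 2 * M)]
    exact (abs_sub _ _).trans (by linarith [abs_clip_le hM0 (ω t x), hM x hx])
  have dir : G t = (∫ x, (η x - ωb x) * χ t x ∂(channelMeasure L H)) +
      ∫ x, (ω t x - η x) * χ t x ∂(channelMeasure L H) := by
    have c := cω t
    rw [← channel_add hL hH (f := fun x => (η x - ωb x) * χ t x) (g := fun x => (ω t x - η x) * χ t x)
      (by fun_prop) (by fun_prop)]
    refine (P.dirichlet t).trans (integral_congr_ae (ae_of_all _ fun x => by ring))
  have hGt : √(G t) ≤ N₁ := by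
    refine cancel hN₁0 ?_
    have h1 := le_of_abs_le hrt
    have h2 := le_of_abs_le hht
    have h3 : C * d * √(G t) ≤ C * 1 * √(G t) := by gcongr
    rw [dir, hN₁] at *
    nlinarith
  have hrt' : |∫ x, (ω t x - η x) * χ t x ∂(channelMeasure L H)| ≤ C * N₁ * d := by
    refine hrt.trans ?_
    calc C * d * √(G t) ≤ C * d * N₁ := by gcongr
      _ = C * N₁ * d := by ring
  have hμb : |μ| ≤ 1 / (L * H) * (C * m₂ * N₁) := by
    rw [hμ, channelMean, abs_mul, abs_of_pos (by positivity : 0 < 1 / (L * H))]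
    gcongr
    have := hC _ _ _ (fun _ => 1) (P.grad t) (P.bottom t) continuous_const
    simp only [one_mul] at this
    refine this.trans ?_
    gcongr
  -- conservation of the energy
  have hE := P.energy t 0
  have hE0 : |∫ x, (ω 0 x - ωb x) * φ x ∂(channelMeasure L H)| ≤ R * d :=
    (abs_channel_mul_le ((cω 0).sub hωb) hφ hR).trans (mul_le_mul_of_nonneg_left hd hR0)
  have hEr : |∫ x, (ω t x - η x) * φ x ∂(channelMeasure L H)| ≤ R * d :=
    (abs_channel_mul_le ((cω t).sub cη) hφ hR).trans (by
      gcongr; exact (P.integral_abs_sub_clip_le hωb hM t).trans hd)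
  have hEs : ∫ x, (ω t x - ωb x) * φ x ∂(channelMeasure L H) =
      (∫ x, (η x - ωb x) * φ x ∂(channelMeasure L H)) +
      ∫ x, (ω t x - η x) * φ x ∂(channelMeasure L H) := by
    have c := cω t
    rw [← channel_add hL hH (f := fun x => (η x - ωb x) * φ x) (g := fun x => (ω t x - η x) * φ x)
      (by fun_prop) (by fun_prop)]
    exact integral_congr_ae (ae_of_all _ fun x => by ring)
  -- the Casimir functional
  have hF1 : (∫ x, F (η x) ∂(channelMeasure L H)) - ∫ x, F (ωb x) ∂(channelMeasure L H) ≤ T * d := by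
    have := (le_abs_self _).trans (P.abs_integral_comp_clip_sub_le hωb hM cF (fun s u _ _ => hFT s u) t)
    rw [abs_of_nonneg hT0] at this
    exact this.trans (by gcongr)
  have hF2 : (∫ x, F (ωb x) ∂(channelMeasure L H)) + (∫ x, (η x - ωb x) * φ x ∂(channelMeasure L H)) +
      1 / (2 * Λ) * (∫ x, (η x - ωb x) ^ 2 ∂(channelMeasure L H)) ≤ ∫ x, F (η x) ∂(channelMeasure L H) := by
    rw [← integral_const_mul, ← channel_add hL hH (f := fun x => F (ωb x)) (g := fun x => (η x - ωb x) * φ x)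
      (by fun_prop) (by fun_prop), ← channel_add hL hH (f := fun x => F (ωb x) + (η x - ωb x) * φ x)
      (g := fun x => 1 / (2 * Λ) * (η x - ωb x) ^ 2) (by fun_prop) (by fun_prop)]
    refine channel_mono_cell (by fun_prop) (by fun_prop) fun x hx => ?_
    have := hF (φ x) (η x) (hR x hx) (by rw [← hγφ x hx]; exact hM x hx) (abs_clip_le hM0 _)
    rw [← hγφ x hx] at this
    refine le_trans (le_of_eq ?_) this
    ring
  -- χ may be replaced by χ minus its mean, because the mean of the truncated perturbation is small
  -- by conservation. The inequality with `shearEigenvalue` needs zero mean.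
  have hmean : ∫ x, (η x - ωb x) * χ t x ∂(channelMeasure L H) =
      (∫ x, (η x - ωb x) * (χ t x - μ) ∂(channelMeasure L H)) +
        μ * ∫ x, (η x - ωb x) ∂(channelMeasure L H) := by
    rw [← integral_const_mul, ← channel_add hL hH (f := fun x => (η x - ωb x) * (χ t x - μ))
      (g := fun x => μ * (η x - ωb x)) (by fun_prop) (by fun_prop)]
    exact integral_congr_ae (ae_of_all _ fun x => by ring)
  have hmd : |μ * ∫ x, (η x - ωb x) ∂(channelMeasure L H)| ≤ 1 / (L * H) * (C * m₂ * N₁) * d := by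
    rw [abs_mul]
    exact mul_le_mul hμb ((P.abs_integral_clip_sub_le hωb hM t).trans hd) (abs_nonneg _) (by positivity)
  have hsq : ∫ x, (η x - ωb x - Λ * (χ t x - μ)) ^ 2 ∂(channelMeasure L H) =
      (∫ x, (η x - ωb x) ^ 2 ∂(channelMeasure L H)) -
      2 * Λ * (∫ x, (η x - ωb x) * (χ t x - μ) ∂(channelMeasure L H)) +
      Λ ^ 2 * ∫ x, (χ t x - μ) ^ 2 ∂(channelMeasure L H) := by
    rw [← integral_const_mul, ← integral_const_mul, ← channel_sub (f := fun x => (η x - ωb x) ^ 2)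
      (g := fun x => 2 * Λ * ((η x - ωb x) * (χ t x - μ))) (by fun_prop) (by fun_prop),
      ← channel_add hL hH (f := fun x => (η x - ωb x) ^ 2 - 2 * Λ * ((η x - ωb x) * (χ t x - μ)))
      (g := fun x => Λ ^ 2 * (χ t x - μ) ^ 2) (by fun_prop) (by fun_prop)]
    exact integral_congr_ae (ae_of_all _ fun x => by ring)
  rw [hsq]
  have e : 1 / (2 * Λ) * ((∫ x, (η x - ωb x) ^ 2 ∂(channelMeasure L H)) -
      2 * Λ * (∫ x, (η x - ωb x) * (χ t x - μ) ∂(channelMeasure L H)) +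
      Λ ^ 2 * ∫ x, (χ t x - μ) ^ 2 ∂(channelMeasure L H)) =
      1 / (2 * Λ) * (∫ x, (η x - ωb x) ^ 2 ∂(channelMeasure L H)) -
      (∫ x, (η x - ωb x) * (χ t x - μ) ∂(channelMeasure L H)) +
      Λ / 2 * ∫ x, (χ t x - μ) ^ 2 ∂(channelMeasure L H) := by field_simp
  rw [e]
  have hEt : 1 / 2 * G t + (∫ x, (ω t x - ωb x) * φ x ∂(channelMeasure L H)) =
    1 / 2 * G 0 + ∫ x, (ω 0 x - ωb x) * φ x ∂(channelMeasure L H) := hE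
  change _ + 1 / 2 * (G t - _) ≤ _
  rw [hEs] at hEt
  have a1 := (abs_le.1 hE0).2
  have a1' := (abs_le.1 hE0).1
  have a2 := (abs_le.1 hEr).2
  have a2' := (abs_le.1 hEr).1
  have a3 := (abs_le.1 hrt').2
  have a4 := (abs_le.1 hmd).2
  rw [hmean] at dir
  -- The kinetic energy of the initial perturbation enters with a favourable sign and is dropped.
  -- The remaining -½∫|∇χ|² is written as ½∫|∇χ|² - ∫|∇χ|², the latter being the pairing of the
  -- vorticity perturbation with χ, which completes the square.
  have a5 := hG0 0
  linarith

/-- Under the pseudo-energy bound, the bounded part of the vorticity perturbation is close to a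
combination of the lowest modes. -/
theorem exists_mode_approximation {L H : ℝ} (hL : 0 < L) (hH : 0 < H) {ωb φ : ℝ × ℝ → ℝ} {γ : ℝ → ℝ}
    {M Λ r : ℝ} {n : ℕ}
    (hωb : Continuous ωb) (hM0 : 0 ≤ M) (hM : ∀ x ∈ Icc 0 L ×ˢ Icc 0 H, |ωb x| ≤ M)
    (hφ : Continuous φ) (hγ : Continuous γ) (hΛ : 0 < Λ) (hs : SlopeBound γ univ Λ)
    (hγφ : ∀ x ∈ Icc 0 L ×ˢ Icc 0 H, ωb x = γ (φ x)) (hn : n ≠ 0) (hr : r.HolderConjugate (2 * n))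
    (hwave : Λ ≤ waveEigenvalue L H) (hshear : Λ ≤ shearEigenvalue H) :
    ∃ K, 0 ≤ K ∧ ∀ ω χ χ₁ χ₂, Perturbation L H ωb φ ω χ χ₁ χ₂ → ∀ d, 0 ≤ d → d ≤ 1 →
      ∫ x, |ω 0 x - ωb x| ∂(channelMeasure L H) ≤ d →
      (∫ x, |ω 0 x - ωb x| ^ r ∂(channelMeasure L H)) ^ (1 / r) ≤ d →
      ∀ t, ∃ A B C D : ℝ,
        ∫ x, (clip M (ω t x) - ωb x - waveMode L H A B x - shearMode H C D x) ^ 2 ∂(channelMeasure L H) ≤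
          K * d := by
  obtain ⟨K, hK0, hK⟩ := exists_pseudoenergy_bound hL hH hωb hM0 hM hφ hγ hΛ hs hγφ hn hr
  have hgap := gapConst_pos hL hH
  set c := gapConst L H with hc
  refine ⟨3 * (2 * Λ * K) + 3 * Λ ^ 2 * (2 * K / c) + 3 * Λ ^ 2 * (2 * K / c), by positivity, ?_⟩
  intro ω χ χ₁ χ₂ P d hd0 hd1 hd hdr t
  have key := hK ω χ χ₁ χ₂ P d hd0 hd1 hd hdr t
  obtain ⟨u, v, cu, cv, A, B, C, D, h1, h2, h3⟩ := channel_gap hL hH (P.grad t) (P.bottom t) (P.top t)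
  have cη := P.continuous_clip_slice M t
  have cχ := (P.grad t).cont
  -- The truncated perturbation is close to Λ(χ - mean), so its modes are Λ times those of χ.
  refine ⟨Λ * A, Λ * B, Λ * C, Λ * D, ?_⟩
  set μ := channelMean L H (χ t) with hμ
  have cw : Continuous (waveMode L H A B) := continuous_waveMode ..
  have cs : Continuous (shearMode H C D) := continuous_shearMode ..
  have n1 : 0 ≤ ∫ x, (clip M (ω t x) - ωb x - Λ * (χ t x - μ)) ^ 2 ∂(channelMeasure L H) :=
    integral_nonneg fun x => sq_nonneg _
  have n2 : 0 ≤ ∫ x, (u x - waveMode L H A B x) ^ 2 ∂(channelMeasure L H) := integral_nonneg fun x => sq_nonneg _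
  have n3 : 0 ≤ ∫ x, (v x - shearMode H C D x) ^ 2 ∂(channelMeasure L H) := integral_nonneg fun x => sq_nonneg _
  have n4 : 0 ≤ ∫ x, u x ^ 2 ∂(channelMeasure L H) := integral_nonneg fun x => sq_nonneg _
  have n5 : 0 ≤ ∫ x, v x ^ 2 ∂(channelMeasure L H) := integral_nonneg fun x => sq_nonneg _
  have cmp : ∫ x, (clip M (ω t x) - ωb x - waveMode L H (Λ * A) (Λ * B) x -
        shearMode H (Λ * C) (Λ * D) x) ^ 2 ∂(channelMeasure L H) ≤
      3 * (∫ x, (clip M (ω t x) - ωb x - Λ * (χ t x - μ)) ^ 2 ∂(channelMeasure L H)) +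
      3 * Λ ^ 2 * (∫ x, (u x - waveMode L H A B x) ^ 2 ∂(channelMeasure L H)) +
      3 * Λ ^ 2 * ∫ x, (v x - shearMode H C D x) ^ 2 ∂(channelMeasure L H) := by
    rw [← integral_const_mul, ← integral_const_mul, ← integral_const_mul,
      ← channel_add hL hH (f := fun x => 3 * (clip M (ω t x) - ωb x - Λ * (χ t x - μ)) ^ 2)
      (g := fun x => 3 * Λ ^ 2 * (u x - waveMode L H A B x) ^ 2) (by fun_prop) (by fun_prop),
      ← channel_add hL hH (f := fun x => 3 * (clip M (ω t x) - ωb x - Λ * (χ t x - μ)) ^ 2 +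
        3 * Λ ^ 2 * (u x - waveMode L H A B x) ^ 2)
      (g := fun x => 3 * Λ ^ 2 * (v x - shearMode H C D x) ^ 2) (by fun_prop) (by fun_prop)]
    refine channel_mono_cell ?_ (by fun_prop) fun x _ => ?_
    · have := continuous_waveMode L H (Λ * A) (Λ * B)
      have := continuous_shearMode H (Λ * C) (Λ * D)
      fun_prop
    rw [h1 x]
    have e1 : waveMode L H (Λ * A) (Λ * B) x = Λ * waveMode L H A B x := by unfold waveMode; ring
    have e2 : shearMode H (Λ * C) (Λ * D) x = Λ * shearMode H C D x := by unfold shearMode; ring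
    rw [e1, e2]
    generalize waveMode L H A B x = w
    generalize shearMode H C D x = s
    have : clip M (ω t x) - ωb x - Λ * w - Λ * s = (clip M (ω t x) - ωb x - Λ * (u x + v x)) +
      Λ * (u x - w) + Λ * (v x - s) := by ring
    rw [this]
    generalize clip M (ω t x) - ωb x - Λ * (u x + v x) = a
    have e3 : 3 * Λ ^ 2 * (u x - w) ^ 2 = 3 * (Λ * (u x - w)) ^ 2 := by ring
    have e4 : 3 * Λ ^ 2 * (v x - s) ^ 2 = 3 * (Λ * (v x - s)) ^ 2 := by ring
    rw [e3, e4]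
    generalize Λ * (u x - w) = b
    generalize Λ * (v x - s) = b'
    nlinarith [sq_nonneg (a - b), sq_nonneg (a - b'), sq_nonneg (b - b')]
  rw [h2] at key
  generalize (∫ x, (clip M (ω t x) - ωb x - Λ * (χ t x - μ)) ^ 2 ∂(channelMeasure L H)) = X1 at *
  generalize (∫ x, (u x - waveMode L H A B x) ^ 2 ∂(channelMeasure L H)) = X2 at *
  generalize (∫ x, (v x - shearMode H C D x) ^ 2 ∂(channelMeasure L H)) = X3 at *
  generalize (∫ x, u x ^ 2 ∂(channelMeasure L H)) = X4 at *
  generalize (∫ x, v x ^ 2 ∂(channelMeasure L H)) = X5 at *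
  have b1 : 0 ≤ 1 / (2 * Λ) * X1 := by positivity
  have b2 : 0 ≤ c * X2 := by positivity
  have b3 : 0 ≤ c * X3 := by positivity
  -- Λ is at most both eigenvalues, so both families of modes are kept without deciding which of
  -- them is extremal.
  have b4 : 0 ≤ (waveEigenvalue L H - Λ) * X4 := mul_nonneg (by linarith) n4
  have b5 : 0 ≤ (shearEigenvalue H - Λ) * X5 := mul_nonneg (by linarith) n5
  have k1 : X1 ≤ 2 * Λ * K * d := by
    have : 1 / (2 * Λ) * X1 ≤ K * d := by linarith
    rw [one_div, inv_mul_le_iff₀ (by positivity)] at this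
    linarith
  have k2 : X2 ≤ 2 * K / c * d := by
    have : c * X2 ≤ 2 * (K * d) := by linarith
    rw [div_mul_eq_mul_div, le_div_iff₀ hgap]
    linarith
  have k3 : X3 ≤ 2 * K / c * d := by
    have : c * X3 ≤ 2 * (K * d) := by linarith
    rw [div_mul_eq_mul_div, le_div_iff₀ hgap]
    linarith
  have l1 := mul_le_mul_of_nonneg_left k2 (by positivity : 0 ≤ 3 * Λ ^ 2)
  have l2 := mul_le_mul_of_nonneg_left k3 (by positivity : 0 ≤ 3 * Λ ^ 2)
  linarith

/-! ### Second and third moments of a wave plus a shear flow. -/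

theorem trig_half_period {T : ℝ} (hT : 0 < T) (A B s : ℝ) :
    A * Real.cos (2 * Real.pi / T * (s + T / 2)) + B * Real.sin (2 * Real.pi / T * (s + T / 2)) =
      -(A * Real.cos (2 * Real.pi / T * s) + B * Real.sin (2 * Real.pi / T * s)) := by
  have : 2 * Real.pi / T * (s + T / 2) = 2 * Real.pi / T * s + Real.pi := by field_simp
  rw [this, Real.cos_add_pi, Real.sin_add_pi]; ring

/-- The integrand changes sign under a shift by half a period. -/
theorem integral_trig_cube {T : ℝ} (hT : 0 < T) (A B : ℝ) : ∫ x in (0 : ℝ)..T,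
    (A * Real.cos (2 * Real.pi / T * x) + B * Real.sin (2 * Real.pi / T * x)) ^ 3 = 0 := by
  set f : ℝ → ℝ := fun x =>
    (A * Real.cos (2 * Real.pi / T * x) + B * Real.sin (2 * Real.pi / T * x)) ^ 3 with hf
  have per : Function.Periodic f T := fun x => by simp only [hf]; rw [trig_period hT]
  have h1 := per.intervalIntegral_add_eq (T / 2) 0
  rw [zero_add] at h1
  have h2 : ∫ x in (0 : ℝ)..T, f (x + T / 2) = ∫ x in (T / 2)..(T / 2 + T), f x := by
    rw [intervalIntegral.integral_comp_add_right, zero_add, add_comm]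
  have h3 : ∀ x, f (x + T / 2) = -f x := fun x => by
    simp only [hf]; rw [trig_half_period hT]; ring
  simp only [h3, intervalIntegral.integral_neg] at h2
  change ∫ x in (0 : ℝ)..T, f x = 0
  linarith

theorem integral_trig_sq {T : ℝ} (hT : 0 < T) (A B : ℝ) : ∫ x in (0 : ℝ)..T,
    (A * Real.cos (2 * Real.pi / T * x) + B * Real.sin (2 * Real.pi / T * x)) ^ 2 =
      T / 2 * (A ^ 2 + B ^ 2) := by
  have e : ∀ x : ℝ, (A * Real.cos (2 * Real.pi / T * x) + B * Real.sin (2 * Real.pi / T * x)) ^ 2 =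
    A ^ 2 * Real.cos (2 * Real.pi / T * x) ^ 2 + B ^ 2 * Real.sin (2 * Real.pi / T * x) ^ 2 +
    2 * A * B * (Real.cos (2 * Real.pi / T * x) * Real.sin (2 * Real.pi / T * x)) := fun x => by ring
  simp_rw [e]
  rw [intervalIntegral.integral_add (Continuous.intervalIntegrable (by fun_prop) _ _)
    (Continuous.intervalIntegrable (by fun_prop) _ _),
    intervalIntegral.integral_add (Continuous.intervalIntegrable (by fun_prop) _ _)
    (Continuous.intervalIntegrable (by fun_prop) _ _), intervalIntegral.integral_const_mul,
    intervalIntegral.integral_const_mul, intervalIntegral.integral_const_mul,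
    integral_cos_sq_period hT, integral_sin_sq_period hT, integral_cos_mul_sin_period hT]
  ring

theorem integral_snd_mul_cos {H : ℝ} (hH : 0 < H) :
    ∫ y in (0 : ℝ)..H, y * Real.cos (2 * Real.pi / H * y) = 0 := by
  set k := 2 * Real.pi / H with hk
  have hk0 : k ≠ 0 := by have := Real.pi_pos; positivity
  have hkH : k * H = 2 * Real.pi := by rw [hk]; field_simp
  have hd : ∀ y ∈ uIcc 0 H, HasDerivAt (fun y => y * Real.sin (k * y) / k + Real.cos (k * y) / k ^ 2)
      (y * Real.cos (k * y)) y := fun y _ => by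
    have h1 : HasDerivAt (fun s : ℝ => k * s) k y := by simpa using (hasDerivAt_id y).const_mul k
    refine ((((hasDerivAt_id y).mul h1.sin).div_const k).add (h1.cos.div_const (k ^ 2))).congr_deriv ?_
    simp only [id]; field_simp; ring
  rw [intervalIntegral.integral_eq_sub_of_hasDerivAt hd (Continuous.intervalIntegrable (by fun_prop) _ _),
    hkH]
  simp

/-- This value is nonzero while the corresponding integral with the cosine vanishes, so among the
four modes the momentum sees exactly the sine. -/
theorem integral_snd_mul_sin {H : ℝ} (hH : 0 < H) :
    ∫ y in (0 : ℝ)..H, y * Real.sin (2 * Real.pi / H * y) = -(H ^ 2 / (2 * Real.pi)) := by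
  set k := 2 * Real.pi / H with hk
  have hk0 : k ≠ 0 := by have := Real.pi_pos; positivity
  have hkH : k * H = 2 * Real.pi := by rw [hk]; field_simp
  have hd : ∀ y ∈ uIcc 0 H, HasDerivAt (fun y => -(y * Real.cos (k * y)) / k + Real.sin (k * y) / k ^ 2)
      (y * Real.sin (k * y)) y := fun y _ => by
    have h1 : HasDerivAt (fun s : ℝ => k * s) k y := by simpa using (hasDerivAt_id y).const_mul k
    refine ((((hasDerivAt_id y).mul h1.cos).neg.div_const k).add (h1.sin.div_const (k ^ 2))).congr_deriv ?_
    simp only [id]; field_simp; ring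
  rw [intervalIntegral.integral_eq_sub_of_hasDerivAt hd (Continuous.intervalIntegrable (by fun_prop) _ _),
    hkH, hk]
  simp
  field_simp

theorem integral_cos_cube_period {H : ℝ} (hH : 0 < H) :
    ∫ y in (0 : ℝ)..H, Real.cos (2 * Real.pi / H * y) ^ 3 = 0 := by
  simpa using integral_trig_cube hH 1 0

theorem integral_sin_half_sq_mul_cos {H : ℝ} (hH : 0 < H) :
    ∫ y in (0 : ℝ)..H, Real.sin (Real.pi / H * y) ^ 2 * Real.cos (2 * Real.pi / H * y) = -(H / 4) := by
  simp_rw [sin_half_sq]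
  have e : ∀ y : ℝ, (1 / 2 - Real.cos (2 * Real.pi / H * y) / 2) * Real.cos (2 * Real.pi / H * y) =
    1 / 2 * Real.cos (2 * Real.pi / H * y) - 1 / 2 * Real.cos (2 * Real.pi / H * y) ^ 2 := fun y => by ring
  simp_rw [e]
  rw [intervalIntegral.integral_sub (Continuous.intervalIntegrable (by fun_prop) _ _)
    (Continuous.intervalIntegrable (by fun_prop) _ _), intervalIntegral.integral_const_mul,
    intervalIntegral.integral_const_mul, integral_cos_period hH, integral_cos_sq_period hH]
  ring

section
variable {L H : ℝ} (hL : 0 < L) (hH : 0 < H)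
include hL hH

/-- Second moment of the superposition of a wave and a shear flow. -/
theorem integral_waveMode_add_sq {b : ℝ → ℝ} (hb : Continuous b) (A B : ℝ) :
    ∫ x, (waveMode L H A B x + b x.2) ^ 2 ∂(channelMeasure L H) =
      L * H / 4 * (A ^ 2 + B ^ 2) + L * ∫ y in (0 : ℝ)..H, b y ^ 2 := by
  set τ : ℝ → ℝ := fun x => A * Real.cos (2 * Real.pi / L * x) + B * Real.sin (2 * Real.pi / L * x) with hτ
  set s : ℝ → ℝ := fun y => Real.sin (Real.pi / H * y) with hs
  have cτ : Continuous τ := by fun_prop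
  have cs : Continuous s := by fun_prop
  have e : ∀ x : ℝ × ℝ, (waveMode L H A B x + b x.2) ^ 2 =
      τ x.1 ^ 2 * s x.2 ^ 2 + τ x.1 * (2 * (s x.2 * b x.2)) + b x.2 ^ 2 := fun x => by
    simp only [hτ, hs, waveMode]; ring
  simp_rw [e]
  rw [channel_add hL hH (f := fun x => τ x.1 ^ 2 * s x.2 ^ 2 + τ x.1 * (2 * (s x.2 * b x.2)))
    (g := fun x => b x.2 ^ 2) (by fun_prop) (by fun_prop),
    channel_add hL hH (f := fun x => τ x.1 ^ 2 * s x.2 ^ 2) (g := fun x => τ x.1 * (2 * (s x.2 * b x.2)))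
    (by fun_prop) (by fun_prop),
    integral_channel_mul hL hH (a := fun x => τ x ^ 2) (b := fun y => s y ^ 2) (by fun_prop) (by fun_prop),
    integral_channel_mul hL hH (a := τ) (b := fun y => 2 * (s y * b y)) (by fun_prop) (by fun_prop),
    integral_channel_snd hL hH (b := fun y => b y ^ 2) (by fun_prop)]
  simp only [hτ, hs]
  rw [integral_trig_sq hL, integral_trig_fst hL hH, integral_sin_half_sq hH]
  ring

/-- Third moment of the superposition of a wave and a shear flow. -/
theorem integral_waveMode_add_cube {b : ℝ → ℝ} (hb : Continuous b) (A B : ℝ) :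
    ∫ x, (waveMode L H A B x + b x.2) ^ 3 ∂(channelMeasure L H) =
      3 * L / 2 * (A ^ 2 + B ^ 2) * (∫ y in (0 : ℝ)..H, Real.sin (Real.pi / H * y) ^ 2 * b y) +
        L * ∫ y in (0 : ℝ)..H, b y ^ 3 := by
  set τ : ℝ → ℝ := fun x => A * Real.cos (2 * Real.pi / L * x) + B * Real.sin (2 * Real.pi / L * x) with hτ
  set s : ℝ → ℝ := fun y => Real.sin (Real.pi / H * y) with hs
  have cτ : Continuous τ := by fun_prop
  have cs : Continuous s := by fun_prop
  -- The odd powers of the harmonic in x₁ have zero average, so the moment depends on the wave only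
  -- through A² + B².
  have e : ∀ x : ℝ × ℝ, (waveMode L H A B x + b x.2) ^ 3 = τ x.1 ^ 3 * s x.2 ^ 3 +
      τ x.1 ^ 2 * (3 * (s x.2 ^ 2 * b x.2)) + τ x.1 * (3 * (s x.2 * b x.2 ^ 2)) + b x.2 ^ 3 := fun x => by
    simp only [hτ, hs, waveMode]; ring
  simp_rw [e]
  rw [channel_add hL hH (f := fun x => τ x.1 ^ 3 * s x.2 ^ 3 +
      τ x.1 ^ 2 * (3 * (s x.2 ^ 2 * b x.2)) + τ x.1 * (3 * (s x.2 * b x.2 ^ 2)))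
    (g := fun x => b x.2 ^ 3) (by fun_prop) (by fun_prop),
    channel_add hL hH (f := fun x => τ x.1 ^ 3 * s x.2 ^ 3 + τ x.1 ^ 2 * (3 * (s x.2 ^ 2 * b x.2)))
    (g := fun x => τ x.1 * (3 * (s x.2 * b x.2 ^ 2))) (by fun_prop) (by fun_prop),
    channel_add hL hH (f := fun x => τ x.1 ^ 3 * s x.2 ^ 3) (g := fun x => τ x.1 ^ 2 * (3 * (s x.2 ^ 2 * b x.2)))
    (by fun_prop) (by fun_prop),
    integral_channel_mul hL hH (a := fun x => τ x ^ 3) (b := fun y => s y ^ 3) (by fun_prop) (by fun_prop),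
    integral_channel_mul hL hH (a := fun x => τ x ^ 2) (b := fun y => 3 * (s y ^ 2 * b y)) (by fun_prop) (by fun_prop),
    integral_channel_mul hL hH (a := τ) (b := fun y => 3 * (s y * b y ^ 2)) (by fun_prop) (by fun_prop),
    integral_channel_snd hL hH (b := fun y => b y ^ 3) (by fun_prop)]
  simp only [hτ, hs]
  rw [integral_trig_sq hL, integral_trig_fst hL hH, integral_trig_cube hL, intervalIntegral.integral_const_mul]
  ring

end

section
variable {H : ℝ} (hH : 0 < H) {σ : ℝ → ℝ} (hσ : Continuous σ)
include hH hσ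

theorem integral_add_cos_sq (C : ℝ) :
    ∫ y in (0 : ℝ)..H, (σ y + C * Real.cos (2 * Real.pi / H * y)) ^ 2 = (∫ y in (0 : ℝ)..H, σ y ^ 2) +
      2 * C * (∫ y in (0 : ℝ)..H, σ y * Real.cos (2 * Real.pi / H * y)) + C ^ 2 * (H / 2) := by
  have e : ∀ y : ℝ, (σ y + C * Real.cos (2 * Real.pi / H * y)) ^ 2 = σ y ^ 2 +
      2 * C * (σ y * Real.cos (2 * Real.pi / H * y)) + C ^ 2 * Real.cos (2 * Real.pi / H * y) ^ 2 :=
    fun y => by ring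
  simp_rw [e]
  rw [intervalIntegral.integral_add (Continuous.intervalIntegrable (by fun_prop) _ _)
    (Continuous.intervalIntegrable (by fun_prop) _ _),
    intervalIntegral.integral_add (Continuous.intervalIntegrable (by fun_prop) _ _)
    (Continuous.intervalIntegrable (by fun_prop) _ _), intervalIntegral.integral_const_mul,
    intervalIntegral.integral_const_mul, integral_cos_sq_period hH]

theorem integral_add_cos_cube (C : ℝ) :
    ∫ y in (0 : ℝ)..H, (σ y + C * Real.cos (2 * Real.pi / H * y)) ^ 3 = (∫ y in (0 : ℝ)..H, σ y ^ 3) +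
      3 * C * (∫ y in (0 : ℝ)..H, σ y ^ 2 * Real.cos (2 * Real.pi / H * y)) +
      3 * C ^ 2 * (∫ y in (0 : ℝ)..H, σ y * Real.cos (2 * Real.pi / H * y) ^ 2) := by
  have e : ∀ y : ℝ, (σ y + C * Real.cos (2 * Real.pi / H * y)) ^ 3 = σ y ^ 3 +
      3 * C * (σ y ^ 2 * Real.cos (2 * Real.pi / H * y)) +
      3 * C ^ 2 * (σ y * Real.cos (2 * Real.pi / H * y) ^ 2) +
      C ^ 3 * Real.cos (2 * Real.pi / H * y) ^ 3 := fun y => by ring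
  simp_rw [e]
  rw [intervalIntegral.integral_add (Continuous.intervalIntegrable (by fun_prop) _ _)
    (Continuous.intervalIntegrable (by fun_prop) _ _),
    intervalIntegral.integral_add (Continuous.intervalIntegrable (by fun_prop) _ _)
    (Continuous.intervalIntegrable (by fun_prop) _ _),
    intervalIntegral.integral_add (Continuous.intervalIntegrable (by fun_prop) _ _)
    (Continuous.intervalIntegrable (by fun_prop) _ _), intervalIntegral.integral_const_mul,
    intervalIntegral.integral_const_mul, intervalIntegral.integral_const_mul, integral_cos_cube_period hH]
  ring

theorem integral_sin_sq_mul_add_cos (C : ℝ) :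
    ∫ y in (0 : ℝ)..H, Real.sin (Real.pi / H * y) ^ 2 * (σ y + C * Real.cos (2 * Real.pi / H * y)) =
      (∫ y in (0 : ℝ)..H, Real.sin (Real.pi / H * y) ^ 2 * σ y) - C * (H / 4) := by
  have e : ∀ y : ℝ, Real.sin (Real.pi / H * y) ^ 2 * (σ y + C * Real.cos (2 * Real.pi / H * y)) =
      Real.sin (Real.pi / H * y) ^ 2 * σ y +
      C * (Real.sin (Real.pi / H * y) ^ 2 * Real.cos (2 * Real.pi / H * y)) := fun y => by ring
  simp_rw [e]
  rw [intervalIntegral.integral_add (Continuous.intervalIntegrable (by fun_prop) _ _)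
    (Continuous.intervalIntegrable (by fun_prop) _ _), intervalIntegral.integral_const_mul,
    integral_sin_half_sq_mul_cos hH]
  ring

end

/-! ### Trapping by a polynomial, and rotations of the wave amplitude. -/

/-- A continuous curve that starts near `0` and along which a nonzero polynomial is small stays
near `0`. -/
theorem exists_trapping {P : Polynomial ℝ} (hP : P ≠ 0) {ε : ℝ} (hε : 0 < ε) :
    ∃ δ > 0, ∀ c : ℝ → ℝ, Continuous c → |c 0| ≤ δ → (∀ t, |P.eval (c t)| ≤ δ) → ∀ t, |c t| ≤ ε := by
  have hQ : P * P.comp (-Polynomial.X) ≠ 0 := by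
    refine mul_ne_zero hP fun h => hP ?_
    have := congrArg (fun q => q.comp (-Polynomial.X)) h
    simpa [Polynomial.comp_assoc] using this
  -- P(X)P(-X) has finitely many roots, so some e in (0, ε] has neither e nor -e as a root of P. A
  -- curve leaving [-ε, ε] would pass through e or -e, where |P| exceeds the chosen δ.
  obtain ⟨e, ⟨he0, heε⟩, he⟩ : ∃ e ∈ Ioc 0 ε, e ∉ (P * P.comp (-Polynomial.X)).rootSet ℝ :=
    (Ioc_infinite hε).exists_notMem_finite (Polynomial.rootSet_finite _ ℝ)
  rw [Polynomial.mem_rootSet_of_ne hQ] at he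
  simp only [map_mul, Polynomial.aeval_def, Polynomial.eval₂_id, Algebra.algebraMap_self,
    Polynomial.eval_comp, Polynomial.eval_neg, Polynomial.eval_X, mul_eq_zero, not_or] at he
  refine ⟨min (e / 2) (min (|P.eval e| / 2) (|P.eval (-e)| / 2)), by
    have h1 := abs_pos.2 he.1
    have h2 := abs_pos.2 he.2
    positivity, fun c hc h0 hPc t => ?_⟩
  by_contra hcon
  have hc0 : |c 0| ≤ e := (h0.trans (min_le_left _ _)).trans (by linarith)
  have hct : e ≤ |c t| := by linarith
  obtain ⟨s, hs⟩ := mem_range_of_exists_le_of_exists_ge hc.abs ⟨0, hc0⟩ ⟨t, hct⟩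
  have h1 := abs_pos.2 he.1
  have h2 := abs_pos.2 he.2
  have hs' := hPc s
  simp only at hs
  rcases abs_choice (c s) with h | h
  · have : c s = e := by rw [← h, hs]
    rw [this] at hs'
    have := hs'.trans ((min_le_right _ _).trans (min_le_left _ _))
    linarith
  · have : c s = -e := by rw [← hs, h, neg_neg]
    rw [this] at hs'
    have := hs'.trans ((min_le_right _ _).trans (min_le_right _ _))
    linarith

/-- Every plane vector is as close to a rotation of another as their lengths are. -/
theorem exists_rotation_near (a b a₀ b₀ : ℝ) : ∃ θ : ℝ,
    (a - (a₀ * Real.cos θ + b₀ * Real.sin θ)) ^ 2 + (b - (b₀ * Real.cos θ - a₀ * Real.sin θ)) ^ 2 ≤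
      |a ^ 2 + b ^ 2 - (a₀ ^ 2 + b₀ ^ 2)| := by
  -- With amplitudes encoded as a - ib, translation is multiplication by exp(iθ). Choosing θ to
  -- align the arguments leaves (‖z‖ - ‖w‖)², which is at most |‖z‖² - ‖w‖²|.
  set z : ℂ := ⟨a, -b⟩ with hz
  set w : ℂ := ⟨a₀, -b₀⟩ with hw
  refine ⟨z.arg - w.arg, ?_⟩
  set θ := z.arg - w.arg with hθ
  have hzs : ‖z‖ ^ 2 = a ^ 2 + b ^ 2 := by
    rw [Complex.sq_norm, Complex.normSq_apply]; simp only [hz]; ring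
  have hws : ‖w‖ ^ 2 = a₀ ^ 2 + b₀ ^ 2 := by
    rw [Complex.sq_norm, Complex.normSq_apply]; simp only [hw]; ring
  have e1 : z - w * Complex.exp (θ * Complex.I) = ((‖z‖ - ‖w‖ : ℝ) : ℂ) * Complex.exp (z.arg * Complex.I) := by
    have h1 := Complex.norm_mul_exp_arg_mul_I z
    have h2 := Complex.norm_mul_exp_arg_mul_I w
    have h3 : w * Complex.exp (θ * Complex.I) = ‖w‖ * Complex.exp (z.arg * Complex.I) := by
      conv_lhs => rw [← h2]
      rw [mul_assoc, ← Complex.exp_add, hθ]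
      congr 2
      push_cast; ring
    rw [h3]
    push_cast
    rw [sub_mul, h1]
  have e2 : (a - (a₀ * Real.cos θ + b₀ * Real.sin θ)) ^ 2 + (b - (b₀ * Real.cos θ - a₀ * Real.sin θ)) ^ 2 =
      ‖z - w * Complex.exp (θ * Complex.I)‖ ^ 2 := by
    rw [Complex.sq_norm, Complex.normSq_apply, Complex.exp_mul_I, ← Complex.ofReal_cos, ← Complex.ofReal_sin]
    generalize Real.cos θ = c
    generalize Real.sin θ = s
    simp [hz, hw]
    ring
  rw [e2, e1, norm_mul, Complex.norm_exp_ofReal_mul_I, mul_one, Complex.norm_real, Real.norm_eq_abs, sq_abs,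
    ← hzs, ← hws]
  have n1 := norm_nonneg z
  have n2 := norm_nonneg w
  have : ‖z‖ ^ 2 - ‖w‖ ^ 2 = (‖z‖ - ‖w‖) * (‖z‖ + ‖w‖) := by ring
  rw [this, abs_mul, ← sq_abs, sq, abs_of_nonneg (add_nonneg n1 n2)]
  refine mul_le_mul_of_nonneg_left ?_ (abs_nonneg _)
  rw [abs_le]
  constructor <;> linarith

theorem waveMode_shift {L : ℝ} (hL : 0 < L) (H A B θ : ℝ) (x : ℝ × ℝ) :
    waveMode L H A B (x.1 + θ * L / (2 * Real.pi), x.2) =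
      waveMode L H (A * Real.cos θ + B * Real.sin θ) (B * Real.cos θ - A * Real.sin θ) x := by
  have : 2 * Real.pi / L * (x.1 + θ * L / (2 * Real.pi)) = 2 * Real.pi / L * x.1 + θ := by
    have := Real.pi_pos; field_simp
  simp only [waveMode]
  rw [this, Real.cos_add, Real.sin_add]; ring

/-! ### Control of the amplitudes by nearly conserved moments. -/

section
variable {L H : ℝ} (hL : 0 < L) (hH : 0 < H)
include hL hH

theorem integral_channel_const (c : ℝ) : ∫ _, c ∂(channelMeasure L H) = c * (L * H) := by
  rw [integral_channel hL hH continuous_const]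
  simp; ring

theorem sq_integral_comp_sub_le {a b : ℝ × ℝ → ℝ} (ha : Continuous a) (hb : Continuous b) {Q K : ℝ}
    (haQ : ∀ x ∈ Icc 0 L ×ˢ Icc 0 H, |a x| ≤ Q) (hbQ : ∀ x ∈ Icc 0 L ×ˢ Icc 0 H, |b x| ≤ Q)
    {f : ℝ → ℝ} (hf : Continuous f) (hK : ∀ s t, |s| ≤ Q → |t| ≤ Q → |f s - f t| ≤ K * |s - t|) :
    ((∫ x, f (a x) ∂(channelMeasure L H)) - ∫ x, f (b x) ∂(channelMeasure L H)) ^ 2 ≤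
      K ^ 2 * (L * H) * ∫ x, (a x - b x) ^ 2 ∂(channelMeasure L H) := by
  rw [← channel_sub (f := fun x => f (a x)) (g := fun x => f (b x)) (hf.comp ha) (hf.comp hb)]
  have h1 := channel_cauchy_schwarz (L := L) (H := H) (f := fun x => f (a x) - f (b x)) (g := fun _ => 1)
    (by fun_prop) continuous_const
  simp only [mul_one, one_pow] at h1
  rw [integral_channel_const hL hH, one_mul] at h1
  refine h1.trans ?_
  have h2 : ∫ x, (f (a x) - f (b x)) ^ 2 ∂(channelMeasure L H) ≤
      ∫ x, K ^ 2 * (a x - b x) ^ 2 ∂(channelMeasure L H) := by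
    refine channel_mono_cell (by fun_prop) (by fun_prop) fun x hx => ?_
    have := hK _ _ (haQ x hx) (hbQ x hx)
    rw [← sq_abs, ← sq_abs (a x - b x), ← mul_pow]
    exact pow_le_pow_left₀ (abs_nonneg _) this 2
  rw [integral_const_mul] at h2
  have := mul_le_mul_of_nonneg_right h2 (by positivity : 0 ≤ L * H)
  linarith

/-- The coefficient of `cos (2πx₂/H)`. -/
noncomputable def cosCoeff (L H : ℝ) (h : ℝ × ℝ → ℝ) : ℝ :=
  2 / (L * H) * ∫ x, h x * Real.cos (2 * Real.pi / H * x.2) ∂(channelMeasure L H)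

theorem integral_waveMode_mul_snd {b : ℝ → ℝ} (hb : Continuous b) (A B : ℝ) :
    ∫ x, waveMode L H A B x * b x.2 ∂(channelMeasure L H) = 0 := by
  have e : ∀ x : ℝ × ℝ, waveMode L H A B x * b x.2 = (A * Real.cos (2 * Real.pi / L * x.1) +
      B * Real.sin (2 * Real.pi / L * x.1)) * (Real.sin (Real.pi / H * x.2) * b x.2) := fun x => by
    unfold waveMode; ring
  simp_rw [e]
  rw [integral_channel_mul hL hH (a := fun x => A * Real.cos (2 * Real.pi / L * x) +
    B * Real.sin (2 * Real.pi / L * x)) (b := fun y => Real.sin (Real.pi / H * y) * b y)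
    (by fun_prop) (by fun_prop), integral_trig_fst hL hH, zero_mul]

theorem integral_shearMode_mul_cos (C D : ℝ) :
    ∫ x, shearMode H C D x * Real.cos (2 * Real.pi / H * x.2) ∂(channelMeasure L H) = L * H / 2 * C := by
  have e : ∀ y : ℝ, (C * Real.cos (2 * Real.pi / H * y) + D * Real.sin (2 * Real.pi / H * y)) *
      Real.cos (2 * Real.pi / H * y) = C * Real.cos (2 * Real.pi / H * y) ^ 2 +
      D * (Real.cos (2 * Real.pi / H * y) * Real.sin (2 * Real.pi / H * y)) := fun y => by ring
  unfold shearMode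
  rw [integral_channel_snd hL hH (b := fun y => (C * Real.cos (2 * Real.pi / H * y) +
    D * Real.sin (2 * Real.pi / H * y)) * Real.cos (2 * Real.pi / H * y)) (by fun_prop)]
  simp_rw [e]
  rw [intervalIntegral.integral_add (Continuous.intervalIntegrable (by fun_prop) _ _)
    (Continuous.intervalIntegrable (by fun_prop) _ _), intervalIntegral.integral_const_mul,
    intervalIntegral.integral_const_mul, integral_cos_sq_period hH, integral_cos_mul_sin_period hH]
  ring

theorem integral_shearMode_mul_snd (C D : ℝ) :
    ∫ x, shearMode H C D x * x.2 ∂(channelMeasure L H) = -(L * (H ^ 2 / (2 * Real.pi)) * D) := by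
  have e : ∀ y : ℝ, (C * Real.cos (2 * Real.pi / H * y) + D * Real.sin (2 * Real.pi / H * y)) * y =
      C * (y * Real.cos (2 * Real.pi / H * y)) + D * (y * Real.sin (2 * Real.pi / H * y)) := fun y => by ring
  unfold shearMode
  rw [integral_channel_snd hL hH (b := fun y => (C * Real.cos (2 * Real.pi / H * y) +
    D * Real.sin (2 * Real.pi / H * y)) * y) (by fun_prop)]
  simp_rw [e]
  rw [intervalIntegral.integral_add (Continuous.intervalIntegrable (by fun_prop) _ _)
    (Continuous.intervalIntegrable (by fun_prop) _ _), intervalIntegral.integral_const_mul,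
    intervalIntegral.integral_const_mul, integral_snd_mul_cos hH, integral_snd_mul_sin hH]
  ring

/-- In an approximation by the lowest modes, the coefficient of `cos (2πx₂/H)` may be taken to be the
Fourier coefficient, and that of `sin (2πx₂/H)` is controlled by the momentum. -/
theorem exists_mode_correction : ∃ K, 0 ≤ K ∧ ∀ (h : ℝ × ℝ → ℝ) (A B C D δ κ : ℝ), Continuous h →
    ∫ x, (h x - waveMode L H A B x - shearMode H C D x) ^ 2 ∂(channelMeasure L H) ≤ δ →
    (∫ x, x.2 * h x ∂(channelMeasure L H)) ^ 2 ≤ κ →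
    ∫ x, (h x - (waveMode L H A B x + cosCoeff L H h * Real.cos (2 * Real.pi / H * x.2))) ^ 2
      ∂(channelMeasure L H) ≤ K * (δ + κ) := by
  set Y := ∫ x, x.2 ^ 2 ∂(channelMeasure L H) with hY
  have hY0 : 0 ≤ Y := integral_nonneg fun x => sq_nonneg _
  set q := L * (H ^ 2 / (2 * Real.pi)) with hq
  have hq0 : 0 < q := by have := Real.pi_pos; positivity
  refine ⟨2 + L * H * (2 / (L * H)) + L * H * (2 * (Y + 1) / q ^ 2), by positivity, ?_⟩
  intro h A B C D δ κ ch hδ hκ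
  have cw := continuous_waveMode L H A B
  have cs := continuous_shearMode H C D
  set ρ : ℝ × ℝ → ℝ := fun x => h x - waveMode L H A B x - shearMode H C D x with hρ
  have cρ : Continuous ρ := by fun_prop
  have hδ0 : 0 ≤ δ := (integral_nonneg fun x => sq_nonneg _).trans hδ
  have hκ0 : 0 ≤ κ := (sq_nonneg _).trans hκ
  have split : ∀ b : ℝ → ℝ, Continuous b → ∫ x, ρ x * b x.2 ∂(channelMeasure L H) =
      (∫ x, h x * b x.2 ∂(channelMeasure L H)) - ∫ x, shearMode H C D x * b x.2 ∂(channelMeasure L H) := by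
    intro b hb
    have e : ∀ x, ρ x * b x.2 = (h x * b x.2 - waveMode L H A B x * b x.2) - shearMode H C D x * b x.2 :=
      fun x => by simp only [hρ]; ring
    simp_rw [e]
    rw [channel_sub (f := fun x => h x * b x.2 - waveMode L H A B x * b x.2)
      (g := fun x => shearMode H C D x * b x.2) (by fun_prop) (by fun_prop),
      channel_sub (f := fun x => h x * b x.2) (g := fun x => waveMode L H A B x * b x.2)
      (by fun_prop) (by fun_prop), integral_waveMode_mul_snd hL hH hb, sub_zero]
  -- The amplitudes in the mode approximation are chosen separately at each time. The Fourier
  -- coefficient is within the error of C and, unlike it, depends continuously on time, as the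
  -- trapping argument requires.
  set E := cosCoeff L H h with hE
  have hC : ∫ x, ρ x * Real.cos (2 * Real.pi / H * x.2) ∂(channelMeasure L H) = L * H / 2 * (E - C) := by
    rw [split (fun y => Real.cos (2 * Real.pi / H * y)) (by fun_prop), integral_shearMode_mul_cos hL hH, hE,
      cosCoeff]
    field_simp
  have hC2 : (E - C) ^ 2 ≤ 2 / (L * H) * δ := by
    have h1 := channel_cauchy_schwarz (L := L) (H := H) (f := ρ)
      (g := fun x => Real.cos (2 * Real.pi / H * x.2)) cρ (by fun_prop)
    have h2 := integral_shearMode_sq hL hH 1 0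
    simp only [shearMode, one_mul, zero_mul, add_zero] at h2
    rw [hC, h2] at h1
    have h3 : (L * H / 2 * (E - C)) ^ 2 ≤ δ * (L * H / 2 * (1 ^ 2 + 0 ^ 2)) :=
      h1.trans (mul_le_mul_of_nonneg_right hδ (by positivity))
    have h4 : (E - C) ^ 2 * (L * H / 2) ^ 2 ≤ δ * (L * H / 2) := by linarith
    rw [div_mul_eq_mul_div, le_div_iff₀ (by positivity)]
    have h5 : 0 < L * H / 2 := by positivity
    have h6 : (E - C) ^ 2 * (L * H / 2) ≤ δ := by
      refine le_of_mul_le_mul_right ?_ h5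
      linarith
    linarith
  -- Pairing the residual with x₂ eliminates the wave and the cosine, leaving D in terms of the
  -- residual and the momentum.
  have hD : q * D = (∫ x, ρ x * x.2 ∂(channelMeasure L H)) - ∫ x, x.2 * h x ∂(channelMeasure L H) := by
    rw [split (fun y => y) continuous_id, integral_shearMode_mul_snd hL hH]
    simp_rw [mul_comm (h _)]
    ring
  have hD2 : D ^ 2 ≤ 2 * (Y + 1) / q ^ 2 * (δ + κ) := by
    have h1 := channel_cauchy_schwarz (L := L) (H := H) (f := ρ) (g := fun x => x.2) cρ continuous_snd
    have h2 : (∫ x, ρ x * x.2 ∂(channelMeasure L H)) ^ 2 ≤ δ * Y :=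
      h1.trans (mul_le_mul_of_nonneg_right hδ hY0)
    have h3 : (q * D) ^ 2 ≤ 2 * (δ * Y) + 2 * κ := by
      rw [hD]
      generalize (∫ x, ρ x * x.2 ∂(channelMeasure L H)) = a at *
      generalize (∫ x, x.2 * h x ∂(channelMeasure L H)) = b at *
      linarith [sq_nonneg (a + b)]
    rw [div_mul_eq_mul_div, le_div_iff₀ (by positivity)]
    have := mul_nonneg hκ0 hY0
    linarith
  have fin : ∫ x, (h x - (waveMode L H A B x + E * Real.cos (2 * Real.pi / H * x.2))) ^ 2
      ∂(channelMeasure L H) ≤ 2 * (∫ x, ρ x ^ 2 ∂(channelMeasure L H)) +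
      2 * ∫ x, shearMode H (C - E) D x ^ 2 ∂(channelMeasure L H) := by
    have cs' := continuous_shearMode H (C - E) D
    rw [← integral_const_mul, ← integral_const_mul, ← channel_add hL hH (f := fun x => 2 * ρ x ^ 2)
      (g := fun x => 2 * shearMode H (C - E) D x ^ 2) (by fun_prop) (by fun_prop)]
    refine channel_mono (by fun_prop) (by fun_prop) fun x _ => ?_
    have : h x - (waveMode L H A B x + E * Real.cos (2 * Real.pi / H * x.2)) =
        ρ x + shearMode H (C - E) D x := by simp only [hρ, shearMode]; ring
    rw [this]
    linarith [sq_nonneg (ρ x - shearMode H (C - E) D x)]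
  rw [integral_shearMode_sq hL hH] at fin
  have e1 : (C - E) ^ 2 = (E - C) ^ 2 := by ring
  rw [e1] at fin
  have LH : 0 < L * H := by positivity
  have f1 := mul_le_mul_of_nonneg_left hC2 LH.le
  have f2 := mul_le_mul_of_nonneg_left hD2 LH.le
  have f3 : 0 ≤ L * H * (2 / (L * H)) * κ := by positivity
  linarith

end

/-- The polynomial relation satisfied by the coefficient of `cos (2πx₂/H)` when the second and third
moments of the vorticity are preserved. -/
noncomputable def shearPoly (L H N₀ s₀ s₁ s₂ s₃ : ℝ) : Polynomial ℝ :=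
  Cubic.toPoly ⟨3 * L * H / 4, 3 * L * s₁ - 3 * L * s₀ + 3 * L * s₃,
    3 * L * s₂ - 12 * L / H * s₁ * s₀ - 3 * L * H / 8 * N₀, 0⟩

theorem shearPoly_ne_zero {L H : ℝ} (hL : 0 < L) (hH : 0 < H) (N₀ s₀ s₁ s₂ s₃ : ℝ) :
    shearPoly L H N₀ s₀ s₁ s₂ s₃ ≠ 0 :=
  Cubic.ne_zero_of_a_ne_zero (by positivity)

/-- Subtracting 6/H (s₀ - CH/4) times the second-moment relation from the third cancels the unknown
N. The cubic term 3LH/4 comes from C · C² in that product; the third moment has none, since cos³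
integrates to zero. -/
theorem eval_shearPoly {L H : ℝ} (hH : H ≠ 0) (N N₀ s₀ s₁ s₂ s₃ C e₂ e₃ : ℝ)
    (h2 : e₂ = L * H / 4 * (N - N₀) + L * (2 * C * s₁ + C ^ 2 * (H / 2)))
    (h3 : e₃ = 3 * L / 2 * N * (s₀ - C * (H / 4)) - 3 * L / 2 * N₀ * s₀ +
      L * (3 * C * s₂ + 3 * C ^ 2 * s₃)) :
    (shearPoly L H N₀ s₀ s₁ s₂ s₃).eval C = e₃ - 6 / H * (s₀ - C * (H / 4)) * e₂ := by
  simp only [shearPoly, Cubic.toPoly, Polynomial.eval_add, Polynomial.eval_mul, Polynomial.eval_C, Polynomial.eval_pow,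
    Polynomial.eval_X, h2, h3]
  field_simp
  ring

theorem abs_sq_sub_sq_le {R s t : ℝ} (hs : |s| ≤ R) (ht : |t| ≤ R) : |s ^ 2 - t ^ 2| ≤ 2 * R * |s - t| := by
  have : s ^ 2 - t ^ 2 = (s + t) * (s - t) := by ring
  rw [this, abs_mul]
  exact mul_le_mul_of_nonneg_right ((abs_add_le s t).trans (by linarith)) (abs_nonneg _)

theorem abs_cube_sub_cube_le {R s t : ℝ} (hs : |s| ≤ R) (ht : |t| ≤ R) :
    |s ^ 3 - t ^ 3| ≤ 3 * R ^ 2 * |s - t| := by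
  have : s ^ 3 - t ^ 3 = (s ^ 2 + s * t + t ^ 2) * (s - t) := by ring
  rw [this, abs_mul]
  refine mul_le_mul_of_nonneg_right ?_ (abs_nonneg _)
  have h1 : |s| ^ 2 ≤ R ^ 2 := pow_le_pow_left₀ (abs_nonneg _) hs 2
  have h2 : |t| ^ 2 ≤ R ^ 2 := pow_le_pow_left₀ (abs_nonneg _) ht 2
  rw [sq_abs] at h1 h2
  rw [abs_le]
  constructor <;> nlinarith [sq_nonneg (s + t), sq_nonneg (s - t)]

theorem abs_waveMode_le (L H A B : ℝ) (x : ℝ × ℝ) : |waveMode L H A B x| ≤ |A| + |B| := by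
  unfold waveMode
  rw [abs_mul]
  refine (mul_le_of_le_one_left (abs_nonneg _) (Real.abs_sin_le_one _)).trans ?_
  refine (abs_add_le _ _).trans (add_le_add ?_ ?_) <;> rw [abs_mul]
  · exact mul_le_of_le_one_right (abs_nonneg _) (Real.abs_cos_le_one _)
  · exact mul_le_of_le_one_right (abs_nonneg _) (Real.abs_sin_le_one _)

set_option maxHeartbeats 1000000 in
/-- Nearly conserved moments of the vorticity, in terms of its approximation by the lowest modes. -/
theorem exists_moment_relations {L H : ℝ} (hL : 0 < L) (hH : 0 < H) {ωb φ : ℝ × ℝ → ℝ} {γ : ℝ → ℝ}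
    {M Λ r : ℝ} {n : ℕ}
    (hωb : Continuous ωb) (hM0 : 0 ≤ M) (hM : ∀ x ∈ Icc 0 L ×ˢ Icc 0 H, |ωb x| ≤ M)
    (hφ : Continuous φ) (hγ : Continuous γ) (hΛ : 0 < Λ) (hs : SlopeBound γ univ Λ)
    (hγφ : ∀ x ∈ Icc 0 L ×ˢ Icc 0 H, ωb x = γ (φ x)) (hn : n ≠ 0) (hr : r.HolderConjugate (2 * n))
    (hwave : Λ ≤ waveEigenvalue L H) (hshear : Λ ≤ shearEigenvalue H) {A₀ B₀ : ℝ} {σ : ℝ → ℝ}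
    (hσ : Continuous σ) (hdec : ∀ x ∈ strip H, ωb x = waveMode L H A₀ B₀ x + σ x.2) :
    ∃ K, 0 ≤ K ∧ ∃ s₀ s₁ s₂ s₃ : ℝ, ∀ ω χ χ₁ χ₂, Perturbation L H ωb φ ω χ χ₁ χ₂ →
      ∀ d, 0 ≤ d → d ≤ 1 →
      ∫ x, |ω 0 x - ωb x| ∂(channelMeasure L H) ≤ d →
      (∫ x, |ω 0 x - ωb x| ^ r ∂(channelMeasure L H)) ^ (1 / r) ≤ d →
      ∀ t C, C = cosCoeff L H (fun x => clip M (ω t x) - ωb x) → ∃ A B e₂ : ℝ,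
        ∫ x, (clip M (ω t x) - ωb x - (waveMode L H A B x +
          C * Real.cos (2 * Real.pi / H * x.2))) ^ 2 ∂(channelMeasure L H) ≤ K * d ∧
        e₂ = L * H / 4 * ((A₀ + A) ^ 2 + (B₀ + B) ^ 2 - (A₀ ^ 2 + B₀ ^ 2)) +
          L * (2 * C * s₁ + C ^ 2 * (H / 2)) ∧
        e₂ ^ 2 ≤ K * d ∧
        ((shearPoly L H (A₀ ^ 2 + B₀ ^ 2) s₀ s₁ s₂ s₃).eval C) ^ 2 ≤ K * d := by
  obtain ⟨K₁, hK₁, h₁⟩ := exists_mode_approximation hL hH hωb hM0 hM hφ hγ hΛ hs hγφ hn hr hwave hshear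
  obtain ⟨K₂, hK₂, h₂⟩ := exists_mode_correction hL hH
  have LH : 0 < L * H := by positivity
  set s₀ := ∫ y in (0 : ℝ)..H, Real.sin (Real.pi / H * y) ^ 2 * σ y with hs₀
  set s₁ := ∫ y in (0 : ℝ)..H, σ y * Real.cos (2 * Real.pi / H * y) with hs₁
  set s₂ := ∫ y in (0 : ℝ)..H, σ y ^ 2 * Real.cos (2 * Real.pi / H * y) with hs₂
  set s₃ := ∫ y in (0 : ℝ)..H, σ y * Real.cos (2 * Real.pi / H * y) ^ 2 with hs₃
  set K₃ := K₂ * (K₁ + 4 * H ^ 2) with hK₃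
  have hK₃0 : 0 ≤ K₃ := by positivity
  -- S bounds the squared L² norm of the modes: the truncated perturbation is at most 2M pointwise
  -- and its distance to the modes is at most `K₃` when d ≤ 1. Then Q bounds each amplitude and R
  -- the model vorticity below.
  set S := 2 * K₃ + 2 * ((2 * M) ^ 2 * (L * H)) with hS
  set Q := √(4 * S / (L * H)) with hQ
  have hQ0 : 0 ≤ Q := Real.sqrt_nonneg _
  have hQ2 : Q ^ 2 = 4 * S / (L * H) := Real.sq_sqrt (by positivity)
  set R := M + 3 * Q with hR
  have hR0 : 0 ≤ R := by positivity
  set G := 6 / H * (|s₀| + Q * (H / 4)) with hG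
  set E₂ := 2 * ((2 * R) ^ 2 * (L * H) * K₃) + 2 * (2 * M) ^ 2 with hE₂
  set E₃ := 2 * ((3 * R ^ 2) ^ 2 * (L * H) * K₃) + 2 * (3 * M ^ 2) ^ 2 with hE₃
  have hE₂0 : 0 ≤ E₂ := by positivity
  have hE₃0 : 0 ≤ E₃ := by positivity
  refine ⟨K₃ + E₂ + (2 * E₃ + 2 * G ^ 2 * E₂), by positivity, s₀, s₁, s₂, s₃, ?_⟩
  intro ω χ χ₁ χ₂ P d hd0 hd1 hd hdr t C hC
  obtain ⟨A, B, C', D', h3⟩ := h₁ ω χ χ₁ χ₂ P d hd0 hd1 hd hdr t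
  have cη := P.continuous_clip_slice M t
  set η : ℝ × ℝ → ℝ := fun x => clip M (ω t x) with hη
  have hηM : ∀ x, |η x| ≤ M := fun x => abs_clip_le hM0 _
  have hmom : (∫ x, x.2 * (η x - ωb x) ∂(channelMeasure L H)) ^ 2 ≤ 4 * H ^ 2 * d := by
    have h := (P.abs_integral_snd_mul_clip_sub_le hωb hM t).trans
      (mul_le_mul_of_nonneg_left hd (by positivity))
    rw [← sq_abs]
    refine (pow_le_pow_left₀ (abs_nonneg _) h 2).trans ?_
    have : d * d ≤ d * 1 := mul_le_mul_of_nonneg_left hd1 hd0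
    have := mul_le_mul_of_nonneg_left this (by positivity : 0 ≤ 4 * H ^ 2)
    linarith
  have happ : ∫ x, (η x - ωb x - (waveMode L H A B x + C * Real.cos (2 * Real.pi / H * x.2))) ^ 2
      ∂(channelMeasure L H) ≤ K₃ * d := by
    have := h₂ (fun x => η x - ωb x) A B C' D' (K₁ * d) (4 * H ^ 2 * d) (cη.sub hωb) h3 hmom
    rw [hC]
    refine this.trans (le_of_eq ?_)
    rw [hK₃]; ring
  have cw := continuous_waveMode L H A B
  set e : ℝ × ℝ → ℝ := fun x => waveMode L H A B x + C * Real.cos (2 * Real.pi / H * x.2) with he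
  have ce : Continuous e := by fun_prop
  -- the amplitudes are bounded
  have hamp : L * H / 4 * (A ^ 2 + B ^ 2) + L * (C ^ 2 * (H / 2)) ≤ S := by
    have i1 := integral_waveMode_add_sq hL hH (b := fun y => C * Real.cos (2 * Real.pi / H * y))
      (by fun_prop) A B
    have i2 : ∫ y in (0 : ℝ)..H, (C * Real.cos (2 * Real.pi / H * y)) ^ 2 = C ^ 2 * (H / 2) := by
      simp_rw [mul_pow]
      rw [intervalIntegral.integral_const_mul, integral_cos_sq_period hH]
    rw [i2] at i1
    rw [← i1]
    have i3 : ∫ x, e x ^ 2 ∂(channelMeasure L H) ≤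
        ∫ x, (2 * (η x - ωb x - e x) ^ 2 + 2 * (2 * M) ^ 2) ∂(channelMeasure L H) := by
      refine channel_mono_cell (by fun_prop) (by fun_prop) fun x hx => ?_
      have h1 : |η x - ωb x| ≤ 2 * M := (abs_sub _ _).trans (by linarith [hηM x, hM x hx])
      have h2 := pow_le_pow_left₀ (abs_nonneg _) h1 2
      rw [sq_abs] at h2
      linarith [sq_nonneg (2 * (η x - ωb x) - e x)]
    rw [channel_add hL hH (f := fun x => 2 * (η x - ωb x - e x) ^ 2) (g := fun _ => 2 * (2 * M) ^ 2)
      (by fun_prop) (by fun_prop), integral_const_mul, integral_channel_const hL hH] at i3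
    have i4 : K₃ * d ≤ K₃ * 1 := mul_le_mul_of_nonneg_left hd1 hK₃0
    have i5 : ∫ x, (waveMode L H A B x + C * Real.cos (2 * Real.pi / H * x.2)) ^ 2 ∂(channelMeasure L H) =
        ∫ x, e x ^ 2 ∂(channelMeasure L H) := rfl
    linarith
  have hbd : ∀ a : ℝ, L * H / 4 * a ^ 2 ≤ S → |a| ≤ Q := fun a ha => by
    refine abs_le_of_sq_le_sq ?_ hQ0
    rw [hQ2, le_div_iff₀ LH]; linarith
  have pA : 0 ≤ L * H * A ^ 2 := by positivity
  have pB : 0 ≤ L * H * B ^ 2 := by positivity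
  have pC : 0 ≤ L * H * C ^ 2 := by positivity
  have hA : |A| ≤ Q := hbd A (by linarith)
  have hB : |B| ≤ Q := hbd B (by linarith)
  have hCQ : |C| ≤ Q := hbd C (by linarith)
  have heQ : ∀ x, |e x| ≤ 3 * Q := fun x => by
    refine (abs_add_le _ _).trans ?_
    have h1 := abs_waveMode_le L H A B x
    have h2 : |C * Real.cos (2 * Real.pi / H * x.2)| ≤ |C| := by
      rw [abs_mul]; exact mul_le_of_le_one_right (abs_nonneg _) (Real.abs_cos_le_one _)
    linarith
  -- The model vorticity: its moments are explicit in the amplitudes. They are compared with those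
  -- of ω̄ through the truncated vorticity, using L² closeness on one side and conservation on the
  -- other.
  set ζ : ℝ × ℝ → ℝ := fun x => ωb x + e x with hζ
  have cζ : Continuous ζ := hωb.add ce
  have hζR : ∀ x ∈ Icc 0 L ×ˢ Icc 0 H, |ζ x| ≤ R := fun x hx =>
    (abs_add_le _ _).trans (add_le_add (hM x hx) (heQ x))
  have hηR : ∀ x ∈ Icc 0 L ×ˢ Icc 0 H, |η x| ≤ R := fun x _ => (hηM x).trans (by linarith)
  have hζη : ∫ x, (ζ x - η x) ^ 2 ∂(channelMeasure L H) ≤ K₃ * d := by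
    refine le_trans (le_of_eq (integral_congr_ae (ae_of_all _ fun x => ?_))) happ
    simp only [hζ, he]; ring
  -- the second and third moments
  have moment : ∀ (f : ℝ → ℝ) (a b : ℝ), Continuous f → 0 ≤ b →
      (∀ s t, |s| ≤ R → |t| ≤ R → |f s - f t| ≤ a * |s - t|) →
      (∀ s t, |s| ≤ M → |t| ≤ M → |f s - f t| ≤ b * |s - t|) →
      ((∫ x, f (ζ x) ∂(channelMeasure L H)) - ∫ x, f (ωb x) ∂(channelMeasure L H)) ^ 2 ≤
        (2 * (a ^ 2 * (L * H) * K₃) + 2 * b ^ 2) * d := by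
    intro f a b cf hb ha1 hb1
    have h1 := (sq_integral_comp_sub_le hL hH cζ cη hζR hηR cf ha1).trans
      (mul_le_mul_of_nonneg_left hζη (by positivity))
    have h2 := (P.abs_integral_comp_clip_sub_le hωb hM cf hb1 t).trans
      (mul_le_mul_of_nonneg_left hd (abs_nonneg _))
    rw [abs_of_nonneg hb] at h2
    have h3 := pow_le_pow_left₀ (abs_nonneg _) h2 2
    rw [sq_abs] at h3
    change ((∫ x, f (η x) ∂(channelMeasure L H)) - _) ^ 2 ≤ _ at h3
    have h4 : (b * d) ^ 2 ≤ b ^ 2 * d := by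
      have := mul_le_mul_of_nonneg_left (mul_le_mul_of_nonneg_left hd1 hd0) (sq_nonneg b)
      linarith
    generalize (∫ x, f (ζ x) ∂(channelMeasure L H)) = X at *
    generalize (∫ x, f (η x) ∂(channelMeasure L H)) = Y at *
    generalize (∫ x, f (ωb x) ∂(channelMeasure L H)) = Z at *
    linarith [sq_nonneg ((X - Y) - (Y - Z))]
  have m2 := moment (fun z => z ^ 2) (2 * R) (2 * M) (by fun_prop) (by positivity)
    (fun s t => abs_sq_sub_sq_le) (fun s t => abs_sq_sub_sq_le)
  have m3 := moment (fun z => z ^ 3) (3 * R ^ 2) (3 * M ^ 2) (by fun_prop) (by positivity)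
    (fun s t => abs_cube_sub_cube_le) (fun s t => abs_cube_sub_cube_le)
  have ζdec : ∀ x ∈ strip H, ζ x = waveMode L H (A₀ + A) (B₀ + B) x +
      (fun y => σ y + C * Real.cos (2 * Real.pi / H * y)) x.2 := fun x hx => by
    simp only [hζ, he, hdec x hx, waveMode]; ring
  have cb : Continuous (fun y => σ y + C * Real.cos (2 * Real.pi / H * y)) := by fun_prop
  have z2 : ∫ x, ζ x ^ 2 ∂(channelMeasure L H) = L * H / 4 * ((A₀ + A) ^ 2 + (B₀ + B) ^ 2) +
      L * ((∫ y in (0 : ℝ)..H, σ y ^ 2) + 2 * C * s₁ + C ^ 2 * (H / 2)) := by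
    rw [channel_congr fun x hx => by rw [ζdec x hx], integral_waveMode_add_sq hL hH cb,
      integral_add_cos_sq hH hσ]
  have z3 : ∫ x, ζ x ^ 3 ∂(channelMeasure L H) = 3 * L / 2 * ((A₀ + A) ^ 2 + (B₀ + B) ^ 2) *
      (s₀ - C * (H / 4)) + L * ((∫ y in (0 : ℝ)..H, σ y ^ 3) + 3 * C * s₂ + 3 * C ^ 2 * s₃) := by
    rw [channel_congr fun x hx => by rw [ζdec x hx], integral_waveMode_add_cube hL hH cb,
      integral_add_cos_cube hH hσ, integral_sin_sq_mul_add_cos hH hσ]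
  have w2 : ∫ x, ωb x ^ 2 ∂(channelMeasure L H) = L * H / 4 * (A₀ ^ 2 + B₀ ^ 2) +
      L * (∫ y in (0 : ℝ)..H, σ y ^ 2) := by
    rw [channel_congr fun x hx => by rw [hdec x hx], integral_waveMode_add_sq hL hH hσ]
  have w3 : ∫ x, ωb x ^ 3 ∂(channelMeasure L H) = 3 * L / 2 * (A₀ ^ 2 + B₀ ^ 2) * s₀ +
      L * (∫ y in (0 : ℝ)..H, σ y ^ 3) := by
    rw [channel_congr fun x hx => by rw [hdec x hx], integral_waveMode_add_cube hL hH hσ]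
  set e₂ := (∫ x, ζ x ^ 2 ∂(channelMeasure L H)) - ∫ x, ωb x ^ 2 ∂(channelMeasure L H) with he₂
  set e₃ := (∫ x, ζ x ^ 3 ∂(channelMeasure L H)) - ∫ x, ωb x ^ 3 ∂(channelMeasure L H) with he₃
  have r2 : e₂ = L * H / 4 * ((A₀ + A) ^ 2 + (B₀ + B) ^ 2 - (A₀ ^ 2 + B₀ ^ 2)) +
      L * (2 * C * s₁ + C ^ 2 * (H / 2)) := by rw [he₂, z2, w2]; ring
  have r3 : e₃ = 3 * L / 2 * ((A₀ + A) ^ 2 + (B₀ + B) ^ 2) * (s₀ - C * (H / 4)) -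
      3 * L / 2 * (A₀ ^ 2 + B₀ ^ 2) * s₀ + L * (3 * C * s₂ + 3 * C ^ 2 * s₃) := by rw [he₃, z3, w3]; ring
  have ev := eval_shearPoly (L := L) hH.ne' _ _ s₀ s₁ s₂ s₃ C e₂ e₃ r2 r3
  have m2' : e₂ ^ 2 ≤ E₂ * d := m2
  have m3' : e₃ ^ 2 ≤ E₃ * d := m3
  have p1 : 0 ≤ K₃ * d := by positivity
  have p2 : 0 ≤ E₂ * d := by positivity
  have p3 : 0 ≤ (2 * E₃ + 2 * G ^ 2 * E₂) * d := by positivity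
  -- The third-moment relation is used only through the polynomial; the second is kept, to recover
  -- the wave amplitude once C is known to be small.
  refine ⟨A, B, e₂, by linarith, r2, by linarith, ?_⟩
  rw [ev]
  have hGb : |6 / H * (s₀ - C * (H / 4))| ≤ G := by
    rw [abs_mul, abs_of_pos (by positivity : 0 < 6 / H)]
    refine mul_le_mul_of_nonneg_left ((abs_sub _ _).trans (add_le_add le_rfl ?_)) (by positivity)
    rw [abs_mul, abs_of_pos (by positivity : 0 < H / 4)]
    exact mul_le_mul_of_nonneg_right hCQ (by positivity)
  have hG2 := pow_le_pow_left₀ (abs_nonneg _) hGb 2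
  rw [sq_abs] at hG2
  generalize 6 / H * (s₀ - C * (H / 4)) = g at *
  have q1 : g ^ 2 * e₂ ^ 2 ≤ G ^ 2 * (E₂ * d) := mul_le_mul hG2 m2' (sq_nonneg _) (sq_nonneg _)
  linarith [sq_nonneg (e₃ + g * e₂)]

/-! ### Orbital stability of the truncated vorticity in L². -/

theorem continuous_channel_param {L H : ℝ} (hL : 0 < L) (hH : 0 < H) {F : ℝ → ℝ × ℝ → ℝ}
    (hF : Continuous fun q : ℝ × (ℝ × ℝ) => F q.1 q.2) :
    Continuous fun t => ∫ x, F t x ∂(channelMeasure L H) := by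
  have e : ∀ t, ∫ x, F t x ∂(channelMeasure L H) = ∫ x in (0 : ℝ)..L, ∫ y in (0 : ℝ)..H, F t (x, y) :=
    fun t => integral_channel hL hH (hF.comp (Continuous.prodMk_right t))
  simp_rw [e]
  refine intervalIntegral.continuous_parametric_intervalIntegral_of_continuous' (f := fun t x =>
    ∫ y in (0 : ℝ)..H, F t (x, y)) ?_ _ _
  refine intervalIntegral.continuous_parametric_intervalIntegral_of_continuous'
    (f := fun (q : ℝ × ℝ) y => F q.1 (q.2, y)) ?_ _ _
  have h : Continuous fun q : (ℝ × ℝ) × ℝ => ((q.1.1, (q.1.2, q.2)) : ℝ × (ℝ × ℝ)) := by fun_prop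
  exact hF.comp h

theorem abs_cosCoeff_le {L H : ℝ} (hL : 0 < L) (hH : 0 < H) {h : ℝ × ℝ → ℝ} (hh : Continuous h) :
    |cosCoeff L H h| ≤ 2 / (L * H) * ∫ x, |h x| ∂(channelMeasure L H) := by
  rw [cosCoeff, abs_mul, abs_of_pos (by positivity : 0 < 2 / (L * H))]
  refine mul_le_mul_of_nonneg_left ?_ (by positivity)
  have := abs_channel_mul_le (L := L) (H := H) (K := 1) hh
    (g := fun x => Real.cos (2 * Real.pi / H * x.2)) (by fun_prop) (fun x _ => Real.abs_cos_le_one _)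
  linarith

/-- Orbital stability in `L²` of the truncated vorticity. -/
theorem exists_orbital_estimate {L H : ℝ} (hL : 0 < L) (hH : 0 < H) {ωb φ : ℝ × ℝ → ℝ} {γ : ℝ → ℝ}
    {M Λ r : ℝ} {n : ℕ}
    (hωb : Continuous ωb) (hM0 : 0 ≤ M) (hM : ∀ x ∈ Icc 0 L ×ˢ Icc 0 H, |ωb x| ≤ M)
    (hφ : Continuous φ) (hγ : Continuous γ) (hΛ : 0 < Λ) (hs : SlopeBound γ univ Λ)
    (hγφ : ∀ x ∈ Icc 0 L ×ˢ Icc 0 H, ωb x = γ (φ x)) (hn : n ≠ 0) (hr : r.HolderConjugate (2 * n))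
    (hwave : Λ ≤ waveEigenvalue L H) (hshear : Λ ≤ shearEigenvalue H) {A₀ B₀ : ℝ} {σ : ℝ → ℝ}
    (hσ : Continuous σ) (hdec : ∀ x ∈ strip H, ωb x = waveMode L H A₀ B₀ x + σ x.2)
    {ε : ℝ} (hε : 0 < ε) :
    ∃ d, 0 < d ∧ ∀ ω χ χ₁ χ₂, Perturbation L H ωb φ ω χ χ₁ χ₂ →
      ∫ x, |ω 0 x - ωb x| ∂(channelMeasure L H) ≤ d →
      (∫ x, |ω 0 x - ωb x| ^ r ∂(channelMeasure L H)) ^ (1 / r) ≤ d →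
      ∀ t, ∃ α : ℝ, ∫ x, (clip M (ω t x) - ωb (x.1 + α, x.2)) ^ 2 ∂(channelMeasure L H) ≤ ε := by
  obtain ⟨K, hK, s₀, s₁, s₂, s₃, hrel⟩ := exists_moment_relations hL hH hωb hM0 hM hφ hγ hΛ hs hγφ hn hr
    hwave hshear hσ hdec
  have LH : 0 < L * H := by positivity
  -- J collects the coefficients of `ε₁` in the final three-term estimate. The `κ` terms contribute
  -- at most 6κ ≤ ε/2, which explains the bound ε/12 on `κ`.
  set J := 3 * (L * H / 2) + 3 * (L * (2 * |s₁| + H / 2)) with hJ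
  have hJ0 : 0 ≤ J := by positivity
  set ε₁ := min 1 (ε / (2 * (J + 1))) with hε₁
  have hε₁0 : 0 < ε₁ := by positivity
  have hε₁J : ε₁ * J ≤ ε / 2 := by
    have h1 : ε₁ * (J + 1) ≤ ε / (2 * (J + 1)) * (J + 1) :=
      mul_le_mul_of_nonneg_right (min_le_right _ _) (by positivity)
    have h2 : ε / (2 * (J + 1)) * (J + 1) = ε / 2 := by field_simp
    linarith
  obtain ⟨δ, hδ, htrap⟩ := exists_trapping (shearPoly_ne_zero hL hH (A₀ ^ 2 + B₀ ^ 2) s₀ s₁ s₂ s₃) hε₁0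
  set κ := min (min δ 1) (ε / 12) with hκ
  have hκ0 : 0 < κ := by positivity
  have hκδ : κ ≤ δ := (min_le_left _ _).trans (min_le_left _ _)
  have hκ1 : κ ≤ 1 := (min_le_left _ _).trans (min_le_right _ _)
  have hκε : κ ≤ ε / 12 := min_le_right _ _
  have hκκ : κ ^ 2 ≤ κ := by
    have := mul_le_mul_of_nonneg_left hκ1 hκ0.le
    linarith
  set d := min 1 (min (κ ^ 2 / (K + 1)) (δ * (L * H) / 2)) with hd
  have hd0 : 0 < d := by positivity
  have hd1 : d ≤ 1 := min_le_left _ _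
  have hKd : K * d ≤ κ ^ 2 := by
    have h1 : (K + 1) * d ≤ (K + 1) * (κ ^ 2 / (K + 1)) :=
      mul_le_mul_of_nonneg_left ((min_le_right _ _).trans (min_le_left _ _)) (by positivity)
    rw [mul_div_cancel₀ _ (by positivity)] at h1
    linarith
  have hdδ : 2 / (L * H) * d ≤ δ := by
    have h1 : d ≤ δ * (L * H) / 2 := (min_le_right _ _).trans (min_le_right _ _)
    rw [div_mul_eq_mul_div, div_le_iff₀ LH]
    linarith
  refine ⟨d, hd0, fun ω χ χ₁ χ₂ P hP1 hPr => ?_⟩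
  have hrel := fun t => hrel ω χ χ₁ χ₂ P d hd0.le hd1 hP1 hPr t _ rfl
  set c : ℝ → ℝ := fun t => cosCoeff L H (fun x => clip M (ω t x) - ωb x) with hc
  have hcc : Continuous c := by
    refine continuous_const.mul (continuous_channel_param hL hH (F := fun t x =>
      (clip M (ω t x) - ωb x) * Real.cos (2 * Real.pi / H * x.2)) ?_)
    have := (continuous_clip M).comp P.cont
    exact (this.sub (hωb.comp continuous_snd)).mul (by fun_prop)
  have hc0 : |c 0| ≤ δ := by
    refine (abs_cosCoeff_le hL hH ((P.continuous_clip_slice M 0).sub hωb)).trans (le_trans ?_ hdδ)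
    refine mul_le_mul_of_nonneg_left (le_trans ?_ hP1) (by positivity)
    refine channel_mono_cell ((P.continuous_clip_slice M 0).sub hωb).abs
      ((P.continuous_slice 0).sub hωb).abs fun x hx => ?_
    have := abs_clip_sub_clip_le M (ω 0 x) (ωb x)
    rwa [clip_of_abs_le (hM x hx)] at this
  -- The cosine coefficient starts within δ of zero and the polynomial stays within δ along it, so
  -- it is trapped for all times.
  have hsmall := htrap c hcc hc0 fun t => by
    obtain ⟨A, B, e₂, -, -, -, h⟩ := hrel t
    exact (abs_le_of_sq_le_sq (h.trans hKd) hκ0.le).trans hκδ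
  intro t
  obtain ⟨A, B, e₂, h1, h2, h3, -⟩ := hrel t
  have hCt := hsmall t
  change ∫ x, (clip M (ω t x) - ωb x - (waveMode L H A B x + c t * Real.cos (2 * Real.pi / H * x.2))) ^ 2
    ∂(channelMeasure L H) ≤ K * d at h1
  change e₂ = L * H / 4 * ((A₀ + A) ^ 2 + (B₀ + B) ^ 2 - (A₀ ^ 2 + B₀ ^ 2)) +
    L * (2 * c t * s₁ + c t ^ 2 * (H / 2)) at h2
  generalize c t = C at *
  have hC2 : C ^ 2 ≤ ε₁ := by
    have := mul_le_mul hCt (hCt.trans (min_le_left _ _)) (abs_nonneg _) hε₁0.le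
    rw [← sq_abs]; linarith
  have he₂ : |e₂| ≤ κ := abs_le_of_sq_le_sq (h3.trans hKd) hκ0.le
  obtain ⟨θ, hθ⟩ := exists_rotation_near (A₀ + A) (B₀ + B) A₀ B₀
  set a := A₀ * Real.cos θ + B₀ * Real.sin θ with ha
  set b := B₀ * Real.cos θ - A₀ * Real.sin θ with hb
  -- With C small, the second-moment relation makes the squared lengths of the two wave amplitude
  -- vectors nearly equal.
  have hX : L * H / 4 * |(A₀ + A) ^ 2 + (B₀ + B) ^ 2 - (A₀ ^ 2 + B₀ ^ 2)| ≤
      κ + ε₁ * (L * (2 * |s₁| + H / 2)) := by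
    rw [← abs_of_pos (by positivity : 0 < L * H / 4), ← abs_mul]
    have e1 : L * H / 4 * ((A₀ + A) ^ 2 + (B₀ + B) ^ 2 - (A₀ ^ 2 + B₀ ^ 2)) =
        e₂ - L * (2 * C * s₁ + C ^ 2 * (H / 2)) := by rw [h2]; ring
    rw [e1]
    refine (abs_sub _ _).trans (add_le_add he₂ ?_)
    rw [abs_mul, abs_of_pos hL]
    have e2 : |2 * C * s₁| ≤ 2 * (ε₁ * |s₁|) := by
      rw [abs_mul, abs_mul, abs_two]
      have := mul_le_mul_of_nonneg_right hCt (abs_nonneg s₁)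
      linarith
    have e3 : |C ^ 2 * (H / 2)| ≤ ε₁ * (H / 2) := by
      rw [abs_of_nonneg (by positivity)]
      exact mul_le_mul_of_nonneg_right hC2 (by positivity)
    have := mul_le_mul_of_nonneg_left ((abs_add_le (2 * C * s₁) (C ^ 2 * (H / 2))).trans (add_le_add e2 e3)) hL.le
    linarith
  -- Rotating the amplitudes by θ is translating by θL/(2π); the shear part of ω̄ is unaffected.
  refine ⟨θ * L / (2 * Real.pi), ?_⟩
  have cη := P.continuous_clip_slice M t
  set η : ℝ × ℝ → ℝ := fun x => clip M (ω t x) with hη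
  set f : ℝ × ℝ → ℝ := fun x =>
    η x - ωb x - (waveMode L H A B x + C * Real.cos (2 * Real.pi / H * x.2)) with hf
  have cw := continuous_waveMode L H A B
  have cw' := continuous_waveMode L H (A₀ + A - a) (B₀ + B - b)
  have cs := continuous_shearMode H C 0
  have cf : Continuous f := by fun_prop
  have key : ∫ x, (η x - ωb (x.1 + θ * L / (2 * Real.pi), x.2)) ^ 2 ∂(channelMeasure L H) ≤
      3 * (∫ x, f x ^ 2 ∂(channelMeasure L H)) + 3 * (∫ x, shearMode H C 0 x ^ 2 ∂(channelMeasure L H)) +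
      3 * ∫ x, waveMode L H (A₀ + A - a) (B₀ + B - b) x ^ 2 ∂(channelMeasure L H) := by
    rw [← integral_const_mul, ← integral_const_mul, ← integral_const_mul,
      ← channel_add hL hH (f := fun x => 3 * f x ^ 2) (g := fun x => 3 * shearMode H C 0 x ^ 2)
        (by fun_prop) (by fun_prop),
      ← channel_add hL hH (f := fun x => 3 * f x ^ 2 + 3 * shearMode H C 0 x ^ 2)
        (g := fun x => 3 * waveMode L H (A₀ + A - a) (B₀ + B - b) x ^ 2) (by fun_prop) (by fun_prop)]
    refine channel_mono (by fun_prop) (by fun_prop) fun x hx => ?_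
    have hx' : (x.1 + θ * L / (2 * Real.pi), x.2) ∈ strip H := ⟨mem_univ _, hx.2⟩
    have : η x - ωb (x.1 + θ * L / (2 * Real.pi), x.2) =
        f x + shearMode H C 0 x + waveMode L H (A₀ + A - a) (B₀ + B - b) x := by
      rw [hdec _ hx', waveMode_shift hL]
      simp only [hf]
      rw [hdec x hx]
      simp only [waveMode, shearMode]; ring
    rw [this]
    generalize shearMode H C 0 x = u
    generalize waveMode L H (A₀ + A - a) (B₀ + B - b) x = v
    linarith [sq_nonneg (f x - u), sq_nonneg (f x - v), sq_nonneg (u - v)]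
  rw [integral_shearMode_sq hL hH, integral_waveMode_sq hL hH] at key
  have k1 : ∫ x, f x ^ 2 ∂(channelMeasure L H) ≤ κ ^ 2 := h1.trans hKd
  have k2 : L * H / 2 * (C ^ 2 + 0 ^ 2) ≤ L * H / 2 * ε₁ := by
    refine mul_le_mul_of_nonneg_left ?_ (by positivity)
    linarith
  have k3 := mul_le_mul_of_nonneg_left hθ (by positivity : 0 ≤ L * H / 4)
  rw [hJ] at hε₁J
  linarith

/-! ### Passage to L^p and the main theorem. -/

theorem eLpNorm_channel {L H : ℝ} {f : ℝ × ℝ → ℝ} (hf : Continuous f) {s : ℝ} (hs : 0 < s) :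
    eLpNorm f (ENNReal.ofReal s) (channelMeasure L H) =
      ENNReal.ofReal ((∫ x, |f x| ^ s ∂(channelMeasure L H)) ^ (1 / s)) := by
  obtain ⟨K, -, hK⟩ := exists_channel_bound L H hf
  have mem : MemLp f (ENNReal.ofReal s) (channelMeasure L H) :=
    MemLp.of_bound hf.aestronglyMeasurable K (ae_channelMeasure_cell hK)
  rw [mem.eLpNorm_eq_integral_rpow_norm (by simpa using hs) ENNReal.ofReal_ne_top,
    ENNReal.toReal_ofReal hs.le, one_div]
  rfl

theorem exists_norm_comparison {L H s p : ℝ} (hs : 0 < s) (hsp : s ≤ p) {d : ℝ} (hd : 0 < d) :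
    ∃ δ, 0 < δ ∧ ∀ f : ℝ × ℝ → ℝ, Continuous f →
      eLpNorm f (ENNReal.ofReal p) (channelMeasure L H) < ENNReal.ofReal δ →
      (∫ x, |f x| ^ s ∂(channelMeasure L H)) ^ (1 / s) ≤ d := by
  set e := 1 / (ENNReal.ofReal s).toReal - 1 / (ENNReal.ofReal p).toReal with he
  have he0 : 0 ≤ e := by
    rw [he, ENNReal.toReal_ofReal hs.le, ENNReal.toReal_ofReal (hs.le.trans hsp), sub_nonneg]
    exact one_div_le_one_div_of_le hs hsp
  have hfin : channelMeasure L H univ ^ e ≠ ⊤ := ENNReal.rpow_ne_top_of_nonneg he0 (measure_ne_top _ _)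
  set m := (channelMeasure L H univ ^ e).toReal with hm
  have hm0 : 0 ≤ m := ENNReal.toReal_nonneg
  refine ⟨d / (m + 1), by positivity, fun f hf h => ?_⟩
  have h1 := eLpNorm_le_eLpNorm_mul_rpow_measure_univ (μ := channelMeasure L H)
    (ENNReal.ofReal_le_ofReal hsp) hf.aestronglyMeasurable
  rw [eLpNorm_channel hf hs, ← he, ← ENNReal.ofReal_toReal hfin, ← hm] at h1
  have h2 := h1.trans (mul_le_mul_left h.le _)
  rw [← ENNReal.ofReal_mul (by positivity)] at h2
  have h3 := (ENNReal.ofReal_le_ofReal_iff (by positivity)).1 h2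
  refine h3.trans ?_
  rw [div_mul_eq_mul_div, div_le_iff₀ (by positivity)]
  have := mul_nonneg hd.le hm0
  linarith

/-- For |f| ≤ Q and any level τ, |f|^p ≤ τ^p + Q^p f²/τ²: the first term serves where |f| ≤ τ, the
second elsewhere. This covers p below and above 2 alike. -/
theorem exists_interpolation {L H : ℝ} (hL : 0 < L) (hH : 0 < H) {p Q ε : ℝ} (hp : 0 < p) (hQ : 0 ≤ Q)
    (hε : 0 < ε) : ∃ η, 0 < η ∧ ∀ f : ℝ × ℝ → ℝ, Continuous f → (∀ x ∈ strip H, |f x| ≤ Q) →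
      ∫ x, f x ^ 2 ∂(channelMeasure L H) ≤ η →
      eLpNorm f (ENNReal.ofReal p) (channelMeasure L H) < ENNReal.ofReal ε := by
  have LH : 0 < L * H := by positivity
  set E := ε ^ p with hE
  have hE0 : 0 < E := by positivity
  set τ := (E / (2 * (L * H) + 1)) ^ (1 / p) with hτ
  have hτ0 : 0 < τ := by positivity
  have hτp : τ ^ p = E / (2 * (L * H) + 1) := by
    rw [hτ, ← Real.rpow_mul (by positivity), one_div_mul_cancel hp.ne', Real.rpow_one]
  refine ⟨E / 4 / (Q ^ p / τ ^ 2 + 1), by positivity, fun f hf hfQ h => ?_⟩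
  rw [eLpNorm_channel hf hp]
  refine (ENNReal.ofReal_lt_ofReal_iff hε).2 ?_
  have c : Continuous fun x => |f x| ^ p := hf.abs.rpow_const fun _ => Or.inr hp.le
  have h0 : 0 ≤ ∫ x, |f x| ^ p ∂(channelMeasure L H) := integral_nonneg fun x => by positivity
  have h1 : ∫ x, |f x| ^ p ∂(channelMeasure L H) ≤
      ∫ x, (τ ^ p + Q ^ p / τ ^ 2 * f x ^ 2) ∂(channelMeasure L H) := by
    refine channel_mono c (by fun_prop) fun x hx => ?_
    rcases le_total |f x| τ with hx' | hx'
    · have := Real.rpow_le_rpow (abs_nonneg _) hx' hp.le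
      have : 0 ≤ Q ^ p / τ ^ 2 * f x ^ 2 := by positivity
      linarith
    · have h2 := Real.rpow_le_rpow (abs_nonneg _) (hfQ x hx) hp.le
      have h3 := pow_le_pow_left₀ hτ0.le hx' 2
      rw [sq_abs] at h3
      have h4 : Q ^ p ≤ Q ^ p / τ ^ 2 * f x ^ 2 := by
        rw [div_mul_eq_mul_div, le_div_iff₀ (by positivity)]
        exact mul_le_mul_of_nonneg_left h3 (by positivity)
      have : 0 ≤ τ ^ p := by positivity
      linarith
  rw [channel_add hL hH (f := fun _ => τ ^ p) (g := fun x => Q ^ p / τ ^ 2 * f x ^ 2) (by fun_prop)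
    (by fun_prop), integral_channel_const hL hH, integral_const_mul, hτp] at h1
  have h2 : E / (2 * (L * H) + 1) * (L * H) ≤ E / 2 := by
    rw [div_mul_eq_mul_div, div_le_iff₀ (by positivity)]; linarith
  have h3 : Q ^ p / τ ^ 2 * (∫ x, f x ^ 2 ∂(channelMeasure L H)) ≤ E / 4 := by
    have h4 := mul_le_mul_of_nonneg_left h (by positivity : 0 ≤ Q ^ p / τ ^ 2 + 1)
    rw [mul_div_cancel₀ _ (by positivity)] at h4
    have : 0 ≤ ∫ x, f x ^ 2 ∂(channelMeasure L H) := integral_nonneg fun x => sq_nonneg _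
    linarith
  have h4 : ∫ x, |f x| ^ p ∂(channelMeasure L H) < E := by linarith
  calc (∫ x, |f x| ^ p ∂(channelMeasure L H)) ^ (1 / p) < E ^ (1 / p) :=
        Real.rpow_lt_rpow h0 h4 (by positivity)
    _ = ε := by rw [hE, ← Real.rpow_mul hε.le, mul_one_div_cancel hp.ne', Real.rpow_one]

/-- The conjugate exponent 2n/(2n - 1) of 2n tends to 1, so it falls below p once n > 1/(p - 1). -/
theorem exists_holderConjugate {p : ℝ} (hp : 1 < p) :
    ∃ n : ℕ, n ≠ 0 ∧ ∃ r : ℝ, 0 < r ∧ r ≤ p ∧ r.HolderConjugate (2 * n) := by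
  obtain ⟨n, hn⟩ := exists_nat_gt (max 1 (1 / (p - 1)))
  have hn1 : 1 < (n : ℝ) := (le_max_left _ _).trans_lt hn
  have hnp : 1 / (p - 1) < n := (le_max_right _ _).trans_lt hn
  have h : (2 * n : ℝ).HolderConjugate (Real.conjExponent (2 * n)) :=
    Real.HolderConjugate.conjExponent (by linarith)
  refine ⟨n, by rintro rfl; norm_num at hn1, _, h.symm.pos, ?_, h.symm⟩
  rw [Real.conjExponent, div_le_iff₀ (by linarith)]
  rw [div_lt_iff₀ (by linarith)] at hnp
  nlinarith

section
variable {L H : ℝ} (hL : 0 < L) (hH : 0 < H)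
include hL hH

/-- The vorticity of a solution of the stream equation is a superposition of a wave and a shear flow. -/
theorem vorticity_decomposition {g : ℝ → ℝ} (hg : Continuous g) {lam : ℝ} {ψ : ℝ × ℝ → ℝ}
    (hψ : SolvesStreamEquation L H g lam ψ) {A B : ℝ} {m : ℝ → ℝ}
    (hdec : ∀ x ∈ closedStrip H, ψ x = waveMode L H A B x + m x.2) :
    ∃ A₀ B₀ : ℝ, ∃ σ : ℝ → ℝ, Continuous σ ∧
      ∀ x ∈ closedStrip H, g (relStream H lam ψ x) = waveMode L H A₀ B₀ x + σ x.2 := by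
  have cφ := continuous_relStream hL hH lam hψ.1
  obtain ⟨hC2, heq, -, -⟩ := hψ
  set E := waveEigenvalue L H with hE
  obtain ⟨p₁, p₂, p₁₁, p₁₂, p₂₁, p₂₂, hp⟩ := hC2.exists_hasHess hH
  obtain ⟨w₁, w₂, w₁₁, w₁₂, w₂₁, w₂₂, hw, hwE⟩ := exists_hasHess_waveMode (H := H) hL A B
  have hd : HasHess L H (fun x => ψ (clamp H x) - waveMode L H A B x) _ _ _ _ _ _ :=
    ⟨hp.grad.sub hw.grad, hp.grad1.sub hw.grad1, hp.grad2.sub hw.grad2⟩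
  have e1 : ∀ x ∈ strip H, lap (fun x => m x.2) x = (p₁₁ x - w₁₁ x) + (p₂₂ x - w₂₂ x) := fun x hx => by
    rw [← hd.lap_eq hx]
    refine lap_congr (fun z hz => ?_) hx
    rw [clamp_of_mem (strip_subset H hz), hdec z (strip_subset H hz)]; ring
  -- The shear remainder has a Laplacian independent of x₁, so σ can be read off on the line x₁ = 0;
  -- no regularity of m has to be assumed.
  have e2 : ∀ x : ℝ × ℝ, lap (fun x => m x.2) x = lap (fun x => m x.2) (0, x.2) := fun x => by
    simp [lap, pd1, pd2]
  have e3 : ∀ x ∈ strip H, g (relStream H lam ψ x) = -(p₁₁ x + p₂₂ x) := fun x hx => by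
    have hcx := clamp_of_mem (strip_subset H hx)
    rw [← hp.lap_eq hx, lap_congr (g := ψ) (fun z hz => by rw [clamp_of_mem (strip_subset H hz)]) hx,
      heq x hx]
    simp only [relStream, hcx]
  have e4 : ∀ x ∈ strip H, g (relStream H lam ψ x) - waveMode L H (E * A) (E * B) x =
      -lap (fun x => m x.2) x := fun x hx => by
    have : waveMode L H (E * A) (E * B) x = E * waveMode L H A B x := by unfold waveMode; ring
    rw [this, e3 x hx, e1 x hx, ← hwE x]; ring
  have cw := continuous_waveMode L H (E * A) (E * B)
  have ch : Continuous fun x => g (relStream H lam ψ x) - waveMode L H (E * A) (E * B) x := by fun_prop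
  refine ⟨E * A, E * B, fun y => g (relStream H lam ψ (0, y)) - waveMode L H (E * A) (E * B) (0, y),
    ch.comp (by fun_prop : Continuous fun y : ℝ => ((0, y) : ℝ × ℝ)), ?_⟩
  -- The differential equation holds only in the open strip; continuity carries the identity to the
  -- walls.
  have hcl : IsClosed {x : ℝ × ℝ | g (relStream H lam ψ x) = waveMode L H (E * A) (E * B) x +
      (g (relStream H lam ψ (0, x.2)) - waveMode L H (E * A) (E * B) (0, x.2))} := by
    refine isClosed_eq (hg.comp cφ) (cw.add (ch.comp
      (by fun_prop : Continuous fun x : ℝ × ℝ => ((0, x.2) : ℝ × ℝ))))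
  refine fun x hx => hcl.closure_subset_iff.2 (fun z hz => ?_) (closedStrip_subset_closure hH hx)
  have h1 := e4 z hz
  have h2 := e4 (0, z.2) ⟨mem_univ _, hz.2⟩
  rw [e2 z] at h1
  change _ = _
  linarith

/-- Orbital stability of the flow in `L^p`. -/
theorem orbital_stability {g : ℝ → ℝ} (hg : ContDiff ℝ 1 g) {lam : ℝ} {ψ : ℝ × ℝ → ℝ}
    (hψ : SolvesStreamEquation L H g lam ψ) {p : ℝ} (hp : 1 < p) (hg' : ∀ x ∈ closedStrip H,
      0 ≤ deriv g (ψ x - lam * x.2) ∧ deriv g (ψ x - lam * x.2) ≤ firstEigenvalue L H)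
    {ε : ℝ} (hε : 0 < ε) : ∃ δ : ℝ, 0 < δ ∧ ∀ v : ℝ → ℝ × ℝ → ℝ × ℝ, IsEulerFlow L H v →
      eLpNorm (fun x => vorticity (v 0) x - (-lap ψ x)) (ENNReal.ofReal p) (channelMeasure L H) <
        ENNReal.ofReal δ →
      ∀ t : ℝ, ∃ α : ℝ, eLpNorm (fun x => vorticity (v t) x - (-lap ψ (x.1 + α, x.2)))
        (ENNReal.ofReal p) (channelMeasure L H) < ENNReal.ofReal ε := by
  have hp0 : 0 < p := one_pos.trans hp
  obtain ⟨A, B, -, hdec⟩ := stream_decomposition hL hH hg hψ hg'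
  obtain ⟨A₀, B₀, σ, hσ, hωdec⟩ := vorticity_decomposition hL hH hg.continuous hψ
    (m := xmean L (fun z => ψ (clamp H z))) hdec
  have slope := slopeBound_relRange hL hH hg hψ.1 hg'
  have cφ := continuous_relStream hL hH lam hψ.1
  have hord := ordConnected_relRange hL hH lam hψ.1
  set φ := relStream H lam ψ with hφ
  set ωb : ℝ × ℝ → ℝ := fun x => g (φ x) with hωb
  have cωb : Continuous ωb := hg.continuous.comp cφ
  have hlap : ∀ x ∈ strip H, -lap ψ x = ωb x := fun x hx => by
    rw [hψ.2.1 x hx]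
    simp only [hωb, hφ, relStream, clamp_of_mem (strip_subset H hx)]
  -- a bound for the vorticity
  obtain ⟨S, hS⟩ := (isCompact_Icc (a := (0 : ℝ)) (b := H)).exists_bound_of_continuousOn hσ.continuousOn
  have hS0 : 0 ≤ S := (norm_nonneg _).trans (hS 0 ⟨le_rfl, hH.le⟩)
  set M := |A₀| + |B₀| + S with hM
  have hM0 : 0 ≤ M := by positivity
  have hωM : ∀ x ∈ closedStrip H, |ωb x| ≤ M := fun x hx => by
    rw [show ωb x = _ from hωdec x hx]
    exact (abs_add_le _ _).trans (add_le_add (abs_waveMode_le L H A₀ B₀ x) (hS _ hx.2))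
  have hcell : Icc 0 L ×ˢ Icc 0 H ⊆ closedStrip H := Set.prod_mono (subset_univ _) le_rfl
  -- the extension of the vorticity function
  have hcpt : IsCompact (Icc 0 L ×ˢ Icc 0 H) := isCompact_Icc.prod isCompact_Icc
  have hne : (Icc 0 L ×ˢ Icc 0 H).Nonempty := ⟨(0, 0), ⟨le_rfl, hL.le⟩, le_rfl, hH.le⟩
  obtain ⟨a, ha, hamin⟩ := hcpt.exists_isMinOn hne cφ.continuousOn
  obtain ⟨b, hb, hbmax⟩ := hcpt.exists_isMaxOn hne cφ.continuousOn
  have hab : φ a ≤ φ b := hamin hb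
  set Λ := firstEigenvalue L H with hΛ
  have hΛ0 : 0 < Λ := firstEigenvalue_pos hL hH
  have slope' : SlopeBound g (Icc (φ a) (φ b)) Λ := by
    have hsub := hord.out (relStream_mem hL hH lam ψ a) (relStream_mem hL hH lam ψ b)
    exact fun s hs t ht hst => slope s (hsub hs) t (hsub ht) hst
  -- Outside the range of φ nothing is known about g. Projecting the argument onto [min φ, max φ]
  -- gives slopes in [0, Λ] on the whole line without changing g(φ).
  set γ : ℝ → ℝ := fun s => g (max (φ a) (min (φ b) s)) with hγ
  have cγ : Continuous γ := hg.continuous.comp (by fun_prop)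
  have hγφ : ∀ x ∈ Icc 0 L ×ˢ Icc 0 H, ωb x = γ (φ x) := fun x hx => by
    simp only [hγ, hωb]
    rw [min_eq_right (hbmax hx), max_eq_right (hamin hx)]
  obtain ⟨n, hn, r, hr0, hrp, hr⟩ := exists_holderConjugate hp
  have hev := firstEigenvalue_eq hL hH
  obtain ⟨η, hη, hint⟩ := exists_interpolation hL hH hp0 (by positivity : 0 ≤ 2 * M) (half_pos hε)
  obtain ⟨d, hd, hstab⟩ := exists_orbital_estimate hL hH cωb hM0 (fun x hx => hωM x (hcell hx)) cφ cγ hΛ0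
    (slope'.extend hab hΛ0.le) hγφ hn hr (by rw [hΛ, hev]; exact min_le_left _ _)
    (by rw [hΛ, hev]; exact min_le_right _ _) hσ (fun x hx => hωdec x (strip_subset H hx)) hη
  obtain ⟨δ₁, hδ₁, h₁⟩ := exists_norm_comparison (L := L) (H := H) one_pos hp.le hd
  obtain ⟨δ₂, hδ₂, h₂⟩ := exists_norm_comparison (L := L) (H := H) hr0 hrp hd
  -- ε/2 bounds the tail in L^p for all times by conservation; `δ₁` and `δ₂` make the initial
  -- perturbation d-small in L¹ and in L^r.
  refine ⟨min (ε / 2) (min δ₁ δ₂), by positivity, fun v hv hv0 t => ?_⟩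
  obtain ⟨ω, χ, χ₁, χ₂, P, hω⟩ := hv.exists_perturbation hL hH hg.continuous hψ
  have cω := P.continuous_slice
  have cq : Continuous fun x => ω 0 x - ωb x := (cω 0).sub cωb
  rw [eLpNorm_congr_ae (ae_channelMeasure (fun x hx => by beta_reduce; rw [hω 0 x hx, hlap x hx]) :
    (fun x => vorticity (v 0) x - (-lap ψ x)) =ᵐ[channelMeasure L H] fun x => ω 0 x - ωb x)] at hv0
  have hle : ∀ {z : ℝ}, min (ε / 2) (min δ₁ δ₂) ≤ z →
      eLpNorm (fun x => ω 0 x - ωb x) (ENNReal.ofReal p) (channelMeasure L H) < ENNReal.ofReal z :=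
    fun hz => hv0.trans_le (ENNReal.ofReal_le_ofReal hz)
  have q₁ := h₁ _ cq (hle ((min_le_right _ _).trans (min_le_left _ _)))
  have q₂ := h₂ _ cq (hle ((min_le_right _ _).trans (min_le_right _ _)))
  simp only [Real.rpow_one, div_one] at q₁
  obtain ⟨α, hα⟩ := hstab ω χ χ₁ χ₂ P q₁ q₂ t
  refine ⟨α, ?_⟩
  have hshift : ∀ x ∈ strip H, (x.1 + α, x.2) ∈ strip H := fun x hx => ⟨mem_univ _, hx.2⟩
  have cη := P.continuous_clip_slice M t
  have cωα : Continuous fun x : ℝ × ℝ => ωb (x.1 + α, x.2) := by fun_prop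
  have f₁ : Continuous fun x => ω t x - clip M (ω t x) := (cω t).sub cη
  have f₂ : Continuous fun x => clip M (ω t x) - ωb (x.1 + α, x.2) := cη.sub cωα
  rw [eLpNorm_congr_ae (ae_channelMeasure (fun x hx => by
      simp only [Pi.add_apply]; rw [hω t x hx, hlap _ (hshift x hx)]; ring) :
    (fun x => vorticity (v t) x - (-lap ψ (x.1 + α, x.2))) =ᵐ[channelMeasure L H]
      (fun x => ω t x - clip M (ω t x)) + fun x => clip M (ω t x) - ωb (x.1 + α, x.2))]
  refine (eLpNorm_add_le f₁.aestronglyMeasurable f₂.aestronglyMeasurable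
    (by rw [← ENNReal.ofReal_one]; exact ENNReal.ofReal_le_ofReal hp.le)).trans_lt ?_
  have n₁ : eLpNorm (fun x => ω t x - clip M (ω t x)) (ENNReal.ofReal p) (channelMeasure L H) <
      ENNReal.ofReal (ε / 2) := by
    refine lt_of_le_of_lt ?_ (hle (min_le_left _ _))
    rw [eLpNorm_channel f₁ hp0, eLpNorm_channel cq hp0]
    refine ENNReal.ofReal_le_ofReal (Real.rpow_le_rpow (integral_nonneg fun x => by positivity) ?_
      (by positivity))
    exact P.integral_abs_sub_clip_rpow_le cωb (fun x hx => hωM x (hcell hx)) hp0.le t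
  have n₂ : eLpNorm (fun x => clip M (ω t x) - ωb (x.1 + α, x.2)) (ENNReal.ofReal p)
      (channelMeasure L H) < ENNReal.ofReal (ε / 2) := by
    refine hint _ f₂ (fun x hx => ?_) hα
    refine (abs_sub _ _).trans ?_
    linarith [abs_clip_le hM0 (ω t x), hωM _ (strip_subset H (hshift x hx))]
  refine (ENNReal.add_lt_add n₁ n₂).trans_eq ?_
  rw [← ENNReal.ofReal_add (by positivity) (by positivity), add_halves]

end

end PeriodicChannel

end

open PeriodicChannel
theorem mainTheorem2 (L H : ℝ) (hL : 0 < L) (hH : 0 < H)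
    (g : ℝ → ℝ) (hg : ContDiff ℝ 1 g) (lam : ℝ)
    (ψ : ℝ × ℝ → ℝ) (hψ : SolvesStreamEquation L H g lam ψ)
    (p : ℝ) (hp : 1 < p)
    (hg' : ∀ x ∈ closedStrip H,
      0 ≤ deriv g (ψ x - lam * x.2) ∧ deriv g (ψ x - lam * x.2) ≤ firstEigenvalue L H) :
    (∃ ψe ∈ firstEigenspace L H, ∃ ψs : ℝ → ℝ,
      ∀ x ∈ closedStrip H, ψ x = ψe x + ψs x.2) ∧
    (∀ ε : ℝ, 0 < ε → ∃ δ : ℝ, 0 < δ ∧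
      ∀ v : ℝ → ℝ × ℝ → ℝ × ℝ, IsEulerFlow L H v →
        MeasureTheory.eLpNorm (fun x => vorticity (v 0) x - (-lap ψ x))
          (ENNReal.ofReal p) (channelMeasure L H) < ENNReal.ofReal δ →
        ∀ t : ℝ, ∃ α : ℝ,
          MeasureTheory.eLpNorm (fun x => vorticity (v t) x - (-lap ψ (x.1 + α, x.2)))
            (ENNReal.ofReal p) (channelMeasure L H) < ENNReal.ofReal ε) := by
  obtain ⟨A, B, hAB, hdec⟩ := stream_decomposition hL hH hg hψ hg'
  exact ⟨⟨_, hAB, _, hdec⟩, fun ε hε => orbital_stability hL hH hg hψ hp hg' hε⟩
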